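/- Let $\mathbf k$ be an algebraically closed field of characteristic zero. Let $\mathrm{UCob}_2$ be the category of unoriented two-dimensional cobordisms, in its skeletal description by generators and relations: the strict symmetric monoidal category with objects the non-negative integers (numbers of circles), generated by the pairs of pants $m:2\to1$ and $\Delta:1\to2$, the disks $u:0\to1$ and $\varepsilon:1\to0$, the symmetry $\tau:2\to 2$, the orientation-reversing cylinder $\phi:1\to1$ and the crosscap (punctured projective plane) $\theta:0\to1$, subject to the relations that $(1,m,u,\Delta,\varepsilon)$ is a commutative (and cocommutative) Frobenius algebra, that $\phi$ is an involution compatible with $m,u,\Delta,\varepsilon$, and that $\phi\, m(\theta\otimes \mathrm{id})=m(\theta\otimes\mathrm{id})$ and $m(\phi\otimes\mathrm{id})\Delta u=m(\theta\otimes\theta)$. Put $x=m\Delta$ (the handle) and $y=m(\theta\otimes\mathrm{id})$. For sequences $\alpha,\beta,\gamma$ in $\mathbf k$, let $\mathrm{VUCob}_{\alpha,\beta,\gamma}$ be the quotient of the $\mathbf k$-linearization of $\mathrm{UCob}_2$ by the tensor ideal generated by $\varepsilon x^g u-\alpha_g$, $\varepsilon x^g y u-\beta_g$ and $\varepsilon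 x^g y^2u-\gamma_g$ for $g\ge0$. If $\alpha$ has generating function $p/q$ with coprime polynomials $p,q$, $q(0)=1$, and $K=\max(\deg p+1,\deg q)$, let $\mathrm{SUCob}_{\alpha,\beta,\gamma}$ be its quotient by the tensor ideal generated by $\sigma=\sum_i q_i x^{K-i}$, where $q=\sum_i q_iT^i$, and let $\mathrm{SOCob}_\alpha$ be the quotient of $\mathrm{SUCob}_{\alpha,0,0}$ by the tensor ideal generated by $\theta$. For $\lambda,\alpha_0\in\mathbf k^\times$ let $\alpha=(\alpha_0,\lambda\alpha_0,\lambda^2\alpha_0,\dots)$ (so that $\sigma=x-\lambda\,\mathrm{id}$). For $m\ge1$ let $\mathcal S_m\subset \mathrm{Hom}_{\mathrm{UCob}_2}(0,m)$ be the finite set of cobordisms obtained by choosing a partition of the $m$ circles, bounding each block by a connected surface of genus zero, and composing with orientation-reversing cylinders at some subset of the $m$ circles; and let the inner product of $c,d\in\mathcal S_m$ be the value in $\mathrm{End}_{\mathrm{VUCob}_{\alpha,0,0}}(0)$, as a multiple of the identity, of the closed surface obtained by gluing $c$ and $d$ along the corresponding circles. Write $S(m,l)$ for the Stirling numbers of the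 second kind. Then: 1. For all but countably many pairs $(\lambda,\alpha_0)\in\mathbf k^\times\times\mathbf k^\times$, $$\dim\mathrm{Hom}_{\mathrm{SOCob}_\alpha}(0,m)=\sum_{l=1}^m 2^{m-l}S(m,l)\qquad\text{for all } m\ge1 .$$ 2. For every $m\ge1$ there is a non-zero polynomial $p_m\in\mathbf k[\lambda,\alpha_0]$ such that, for all $\lambda,\alpha_0\in\mathbf k^\times$: the classes of $\mathcal S_m$ span $\mathrm{Hom}_{\mathrm{SOCob}_\alpha}(0,m)$; the inner products of elements of $\mathcal S_m$ are well-defined scalars and the determinant of their matrix is $p_m(\lambda,\alpha_0)$; and if $p_m(\lambda,\alpha_0)\neq0$, then the dimension formula in 1 holds for this $m$. -/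

import Mathlib

open CategoryTheory

/-! ### The category `UCob` of unoriented two-dimensional cobordisms

It is the strict symmetric monoidal category with objects the natural numbers (numbers of circles),
presented by the generators `m, u, Δ, ε, τ, φ, θ` and the relations of an extended Frobenius
algebra. Composition is written in diagrammatic order. -/

/-- Formal cobordisms: words in the generators. -/
inductive UCobWord : ℕ → ℕ → Type
  | id (n : ℕ) : UCobWord n n
  | comp {a b c : ℕ} (f : UCobWord a b) (g : UCobWord b c) : UCobWord a c
  | tensor {a b c d : ℕ} (f : UCobWord a b) (g : UCobWord c d) : UCobWord (a + c) (b + d)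
  /-- reverse pair of pants -/
  | mul : UCobWord 2 1
  /-- the disk as a cobordism from the empty set to a circle -/
  | unit : UCobWord 0 1
  /-- pair of pants -/
  | comul : UCobWord 1 2
  /-- the disk as a cobordism from a circle to the empty set -/
  | counit : UCobWord 1 0
  /-- the twist, interchanging two circles -/
  | twist : UCobWord 2 2
  /-- the mapping cylinder of an orientation reversing diffeomorphism of the circle -/
  | flip : UCobWord 1 1
  /-- the once punctured projective plane -/
  | crosscap : UCobWord 0 1

namespace UCobWord

/-- Transport along equalities of source and target. -/
def cast {a b a' b' : ℕ} (ha : a = a') (hb : b = b') (f : UCobWord a b) : UCobWord a' b' :=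
  ha ▸ hb ▸ f

/-- The congruence on words generated by the axioms of a strict monoidal category, the axioms of
the symmetry `twist`, and the relations of a commutative extended Frobenius algebra. -/
inductive Rel : ∀ {a b : ℕ}, UCobWord a b → UCobWord a b → Prop
  | refl {a b : ℕ} (f : UCobWord a b) : Rel f f
  | symm {a b : ℕ} {f g : UCobWord a b} : Rel f g → Rel g f
  | trans {a b : ℕ} {f g h : UCobWord a b} : Rel f g → Rel g h → Rel f h
  | comp_congr {a b c : ℕ} {f f' : UCobWord a b} {g g' : UCobWord b c} :
      Rel f f' → Rel g g' → Rel (comp f g) (comp f' g')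
  | tensor_congr {a b c d : ℕ} {f f' : UCobWord a b} {g g' : UCobWord c d} :
      Rel f f' → Rel g g' → Rel (tensor f g) (tensor f' g')
  -- strict monoidal category
  | id_comp {a b : ℕ} (f : UCobWord a b) : Rel (comp (id a) f) f
  | comp_id {a b : ℕ} (f : UCobWord a b) : Rel (comp f (id b)) f
  | comp_assoc {a b c d : ℕ} (f : UCobWord a b) (g : UCobWord b c) (h : UCobWord c d) :
      Rel (comp (comp f g) h) (comp f (comp g h))
  | tensor_id (a b : ℕ) : Rel (tensor (id a) (id b)) (id (a + b))
  | interchange {a b c a' b' c' : ℕ} (f : UCobWord a b) (g : UCobWord b c)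
      (f' : UCobWord a' b') (g' : UCobWord b' c') :
      Rel (tensor (comp f g) (comp f' g')) (comp (tensor f f') (tensor g g'))
  | tensor_assoc {a b c d a' b' : ℕ} (f : UCobWord a b) (g : UCobWord c d) (h : UCobWord a' b') :
      Rel (cast (Nat.add_assoc a c a') (Nat.add_assoc b d b') (tensor (tensor f g) h))
        (tensor f (tensor g h))
  | empty_tensor {a b : ℕ} (f : UCobWord a b) :
      Rel (cast (Nat.zero_add a) (Nat.zero_add b) (tensor (id 0) f)) f
  | tensor_empty {a b : ℕ} (f : UCobWord a b) : Rel (tensor f (id 0)) f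
  -- the twist is a symmetry, natural in all generators
  | twist_twist : Rel (comp twist twist) (id 2)
  | braid : Rel (comp (comp (tensor twist (id 1) :) (tensor (id 1) twist :)) (tensor twist (id 1) :))
      (comp (comp (tensor (id 1) twist :) (tensor twist (id 1) :)) (tensor (id 1) twist :))
  | unit_twist : Rel (comp (tensor unit (id 1) :) twist) (tensor (id 1) unit :)
  | twist_counit : Rel (comp twist (tensor counit (id 1) :)) (tensor (id 1) counit :)
  | mul_twist : Rel (comp (tensor mul (id 1) :) twist)
      (comp (comp (tensor (id 1) twist :) (tensor twist (id 1) :)) (tensor (id 1) mul :))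
  | comul_twist : Rel
      (comp (comp (tensor comul (id 1) :) (tensor (id 1) twist :)) (tensor twist (id 1) :))
      (comp twist (tensor (id 1) comul :))
  | flip_twist : Rel (comp (tensor flip (id 1) :) twist) (comp twist (tensor (id 1) flip :))
  | crosscap_twist : Rel (comp (tensor crosscap (id 1) :) twist) (tensor (id 1) crosscap :)
  -- commutative Frobenius algebra
  | mul_assoc : Rel (comp (tensor mul (id 1) :) mul) (comp (tensor (id 1) mul :) mul)
  | comul_assoc : Rel (comp comul (tensor comul (id 1) :)) (comp comul (tensor (id 1) comul :))
  | unit_mul : Rel (comp (tensor unit (id 1) :) mul) (id 1)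
  | mul_unit : Rel (comp (tensor (id 1) unit :) mul) (id 1)
  | counit_comul : Rel (comp comul (tensor counit (id 1) :)) (id 1)
  | comul_counit : Rel (comp comul (tensor (id 1) counit :)) (id 1)
  | mul_comm : Rel (comp twist mul) mul
  | comul_comm : Rel (comp comul twist) comul
  | frobenius_left : Rel (comp (tensor (id 1) comul :) (tensor mul (id 1) :)) (comp mul comul)
  | frobenius_right : Rel (comp (tensor comul (id 1) :) (tensor (id 1) mul :)) (comp mul comul)
  -- the involution
  | flip_flip : Rel (comp flip flip) (id 1)
  | flip_mul : Rel (comp (tensor flip flip :) mul) (comp mul flip)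
  | comul_flip : Rel (comp comul (tensor flip flip :)) (comp flip comul)
  | unit_flip : Rel (comp unit flip) unit
  | flip_counit : Rel (comp flip counit) counit
  -- the crosscap
  | crosscap_flip : Rel (comp (comp (tensor crosscap (id 1) :) mul) flip)
      (comp (tensor crosscap (id 1) :) mul)
  | two_crosscaps : Rel (comp (comp (comp unit comul) (tensor flip (id 1) :)) mul)
      (comp (tensor crosscap crosscap :) mul)

/-- The relation `Rel` as a setoid. -/
def setoid (a b : ℕ) : Setoid (UCobWord a b) where
  r := Rel
  iseqv := ⟨Rel.refl, Rel.symm, Rel.trans⟩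

end UCobWord

namespace UCob

/-- `Hom_{UCob}(a, b)`: unoriented cobordisms from `a` circles to `b` circles. -/
def Hom (a b : ℕ) : Type := Quotient (UCobWord.setoid a b)

/-- The cobordism represented by a word. -/
def ofWord {a b : ℕ} (f : UCobWord a b) : Hom a b := Quotient.mk (UCobWord.setoid a b) f

/-- The identity cobordism: `n` cylinders. -/
def id (n : ℕ) : Hom n n := ofWord (.id n)

/-- Gluing: `f` followed by `g`. -/
def comp {a b c : ℕ} (f : Hom a b) (g : Hom b c) : Hom a c :=
  Quotient.map₂ UCobWord.comp (fun _ _ h _ _ h' => UCobWord.Rel.comp_congr h h') f g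

/-- Disjoint union. -/
def tensor {a b c d : ℕ} (f : Hom a b) (g : Hom c d) : Hom (a + c) (b + d) :=
  Quotient.map₂ UCobWord.tensor (fun _ _ h _ _ h' => UCobWord.Rel.tensor_congr h h') f g

def mul : Hom 2 1 := ofWord .mul
def unit : Hom 0 1 := ofWord .unit
def comul : Hom 1 2 := ofWord .comul
def counit : Hom 1 0 := ofWord .counit
def twist : Hom 2 2 := ofWord .twist
def flip : Hom 1 1 := ofWord .flip
def crosscap : Hom 0 1 := ofWord .crosscap

theorem id_comp {a b : ℕ} (f : Hom a b) : comp (id a) f = f := by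
  induction f using Quotient.ind
  exact Quotient.sound (UCobWord.Rel.id_comp _)

theorem comp_id {a b : ℕ} (f : Hom a b) : comp f (id b) = f := by
  induction f using Quotient.ind
  exact Quotient.sound (UCobWord.Rel.comp_id _)

theorem comp_assoc {a b c d : ℕ} (f : Hom a b) (g : Hom b c) (h : Hom c d) :
    comp (comp f g) h = comp f (comp g h) := by
  induction f using Quotient.ind
  induction g using Quotient.ind
  induction h using Quotient.ind
  exact Quotient.sound (UCobWord.Rel.comp_assoc _ _ _)

/-- The handle `x = m ∘ Δ`. -/
def handle : Hom 1 1 := comp comul mul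

/-- The cross `y = m ∘ (θ ⊗ id)`. -/
def cross : Hom 1 1 := comp (tensor crosscap (id 1)) mul

/-- `x ^ g`: the cylinder with `g` handles. -/
def handlePow : ℕ → Hom 1 1
  | 0 => id 1
  | g + 1 => comp (handlePow g) handle

/-- The closed connected orientable surface of genus `g`. -/
def closedOrientable (g : ℕ) : Hom 0 0 := comp (comp unit (handlePow g)) counit

/-- The closed connected surface with `g` handles and one crosscap. -/
def closedOneCross (g : ℕ) : Hom 0 0 := comp (comp (comp unit cross) (handlePow g)) counit

/-- The closed connected surface with `g` handles and two crosscaps. -/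
def closedTwoCross (g : ℕ) : Hom 0 0 :=
  comp (comp (comp (comp unit cross) cross) (handlePow g)) counit

/-- `l` disks, as a cobordism from the empty set. -/
def units : (l : ℕ) → Hom 0 l
  | 0 => id 0
  | l + 1 => tensor (units l) unit

/-- `l` disks, as a cobordism to the empty set. -/
def counits : (l : ℕ) → Hom l 0
  | 0 => id 0
  | l + 1 => tensor (counits l) counit

/-- The pair of pants on the `j`-th circle; its first leg stays in position `j`, the second one
is moved to the last position. All other circles stay in place. -/
def splitOff : (l : ℕ) → Fin l → Hom l (l + 1)
  | 0, j => j.elim0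
  | l + 1, j =>
    if h : j.val < l then comp (tensor (splitOff l ⟨j.val, h⟩) (id 1) :) (tensor (id l) twist :)
    else (tensor (id l) comul :)

/-- The genus zero cobordism with one component for each `i : Fin l`, which joins the `i`-th
incoming circle with the outgoing circles in the positions `f ⁻¹' {i}`. -/
def spread {l : ℕ} : (m : ℕ) → (Fin m → Fin l) → Hom l m
  | 0, _ => counits l
  | m + 1, f =>
    comp (splitOff l (f (Fin.last m))) (tensor (spread m (fun i => f i.castSucc)) (id 1))

open Classical in
/-- `m` cylinders, the `j`-th of which is orientation reversing exactly if `j ∈ J`. -/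
noncomputable def flips : (m : ℕ) → Set (Fin m) → Hom m m
  | 0, _ => id 0
  | m + 1, J =>
    tensor (flips m {i | i.castSucc ∈ J}) (if Fin.last m ∈ J then flip else id 1)

/-- The cobordism `c_{P, J₁, …, J_l}`, where the partition `P = {p₁, …, p_l}` is given by
`pᵢ = f ⁻¹' {i}` and the sets `Jᵢ` by `Jᵢ = J ∩ pᵢ`: its `i`-th component has genus zero, bounds
the circles in `pᵢ`, and has orientation reversing cylinders exactly at the circles in `Jᵢ`. -/
noncomputable def compCob {l m : ℕ} (f : Fin m → Fin l) (J : Set (Fin m)) : Hom 0 m :=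
  comp (comp (units l) (spread m f)) (flips m J)

/-- The set `S_m` of all the cobordisms `c_{P, J₁, …, J_l}`, over all partitions `P` of the `m`
circles into nonempty sets `p₁, …, p_l` and all `Jᵢ ⊆ pᵢ`. (Complementing some `Jᵢ` in `pᵢ` or
reordering the parts does not change the cobordism, so that `S_m` is the set
indexed by partitions and classes of subsets up to complements.) -/
def spanningSet (m : ℕ) : Set (Hom 0 m) :=
  {c | ∃ (l : ℕ) (f : Fin m → Fin l) (J : Set (Fin m)), Function.Surjective f ∧ c = compCob f J}

theorem spanningSet_finite (m : ℕ) : (spanningSet m).Finite := by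
  have h : spanningSet m ⊆ ⋃ l ∈ Set.Iic m,
      Set.range (fun x : (Fin m → Fin l) × Set (Fin m) => compCob x.1 x.2) := by
    rintro c ⟨l, f, J, hf, rfl⟩
    have hl : l ≤ m := by simpa using Fintype.card_le_of_surjective f hf
    simp only [Set.mem_iUnion]
    exact ⟨l, hl, (f, J), rfl⟩
  exact ((Set.finite_Iic m).biUnion fun l _ => Set.finite_range _).subset h

noncomputable instance (m : ℕ) : Fintype (spanningSet m) := (spanningSet_finite m).fintype

/-- The permutation moving the circle in position `m` past the last `n` circles. -/
def pull (m : ℕ) : (n : ℕ) → Hom (m + 1 + n) (m + n + 1)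
  | 0 => id (m + 1)
  | n + 1 => comp (tensor (pull m n) (id 1) :) (tensor (id (m + n)) twist :)

/-- `m` annuli, joining the `i`-th circle with the `(m + i)`-th one. -/
def annuli : (m : ℕ) → Hom (m + m) 0
  | 0 => id 0
  | m + 1 => comp (tensor (pull m m) (id 1) :) (tensor (annuli m) (comp mul counit) :)

/-- The closed surface obtained from two cobordisms `0 → m` by gluing their corresponding
target circles. -/
def glue {m : ℕ} (c d : Hom 0 m) : Hom 0 0 := comp (tensor c d) (annuli m)

end UCob

/-! ### Linear combinations of cobordisms and tensor ideals -/

section Linear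

variable (k : Type*) [Field k]

/-- `k`-linear combinations of cobordisms. -/
abbrev UCobLin (a b : ℕ) : Type _ := UCob.Hom a b →₀ k

namespace UCobLin

variable {k}

/-- The bilinear extension of gluing. -/
noncomputable def comp {a b c : ℕ} :
    UCobLin k a b →ₗ[k] UCobLin k b c →ₗ[k] UCobLin k a c :=
  Finsupp.linearCombination k fun f => Finsupp.lmapDomain k k (UCob.comp f)

/-- The bilinear extension of the disjoint union. -/
noncomputable def tensor {a b c d : ℕ} :
    UCobLin k a b →ₗ[k] UCobLin k c d →ₗ[k] UCobLin k (a + c) (b + d) :=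
  Finsupp.linearCombination k fun f => Finsupp.lmapDomain k k (UCob.tensor f)

/-- A single cobordism as a linear combination. -/
noncomputable def of {a b : ℕ} (f : UCob.Hom a b) : UCobLin k a b := Finsupp.single f 1

theorem comp_of_of {a b c : ℕ} (f : UCob.Hom a b) (g : UCob.Hom b c) :
    comp (of f : UCobLin k a b) (of g) = of (UCob.comp f g) := by
  simp [comp, of]

/-- Membership in the tensor ideal generated by `R`: the smallest family of subspaces that contains
`R` and is closed under composition and tensor product with arbitrary morphisms. -/
inductive MemIdeal (R : ∀ a b : ℕ, Set (UCobLin k a b)) : ∀ {a b : ℕ}, UCobLin k a b → Prop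
  | of_mem {a b : ℕ} {f : UCobLin k a b} : f ∈ R a b → MemIdeal R f
  | zero {a b : ℕ} : MemIdeal R (0 : UCobLin k a b)
  | add {a b : ℕ} {f g : UCobLin k a b} : MemIdeal R f → MemIdeal R g → MemIdeal R (f + g)
  | smul {a b : ℕ} (r : k) {f : UCobLin k a b} : MemIdeal R f → MemIdeal R (r • f)
  | comp_right {a b c : ℕ} {f : UCobLin k a b} (g : UCobLin k b c) :
      MemIdeal R f → MemIdeal R (comp f g)
  | comp_left {a b c : ℕ} (g : UCobLin k a b) {f : UCobLin k b c} :
      MemIdeal R f → MemIdeal R (comp g f)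
  | tensor_right {a b c d : ℕ} {f : UCobLin k a b} (g : UCobLin k c d) :
      MemIdeal R f → MemIdeal R (tensor f g)
  | tensor_left {a b c d : ℕ} (g : UCobLin k a b) {f : UCobLin k c d} :
      MemIdeal R f → MemIdeal R (tensor g f)

/-- The tensor ideal generated by `R`. -/
def ideal (R : ∀ a b : ℕ, Set (UCobLin k a b)) (a b : ℕ) : Submodule k (UCobLin k a b) where
  carrier := {f | MemIdeal R f}
  zero_mem' := .zero
  add_mem' := .add
  smul_mem' r _ h := .smul r h

theorem id_comp {a b : ℕ} (f : UCobLin k a b) : comp (of (UCob.id a)) f = f := by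
  have : (comp (of (UCob.id a)) : UCobLin k a b →ₗ[k] _) = LinearMap.id := by
    ext g : 2
    simp [comp, of, UCob.id_comp]
  rw [this]; rfl

theorem comp_id {a b : ℕ} (f : UCobLin k a b) : comp f (of (UCob.id b)) = f := by
  have : (comp.flip (of (UCob.id b)) : UCobLin k a b →ₗ[k] _) = LinearMap.id := by
    ext g : 2
    simp [comp, of, UCob.comp_id]
  exact congrArg (fun φ => φ f) this

theorem comp_assoc {a b c d : ℕ} (f : UCobLin k a b) (g : UCobLin k b c) (h : UCobLin k c d) :
    comp (comp f g) h = comp f (comp g h) := by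
  have e {a b : ℕ} (f : UCob.Hom a b) (r : k) : Finsupp.single f r = r • of f := by simp [of]
  induction f using Finsupp.induction_linear with
  | zero => simp
  | add f f' hf hf' => simp only [map_add, LinearMap.add_apply, hf, hf']
  | single f r =>
    induction g using Finsupp.induction_linear with
    | zero => simp
    | add g g' hg hg' => simp only [map_add, LinearMap.add_apply, hg, hg']
    | single g s =>
      induction h using Finsupp.induction_linear with
      | zero => simp
      | add h h' hh hh' => simp only [map_add, hh, hh']
      | single h t =>
        simp only [e, map_smul, LinearMap.smul_apply, comp_of_of, UCob.comp_assoc]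

end UCobLin

/-- The category with objects the natural numbers whose morphisms are the `k`-linear combinations
of cobordisms modulo the tensor ideal generated by `R`. -/
structure UCobQuot {k : Type*} [Field k] (R : ∀ a b : ℕ, Set (UCobLin k a b)) where
  /-- the number of circles -/
  circles : ℕ

namespace UCobQuot

variable {k} {R : ∀ a b : ℕ, Set (UCobLin k a b)}

/-- Morphisms from `a` circles to `b` circles: linear combinations of cobordisms modulo the tensor
ideal generated by `R`. -/
def QHom (R : ∀ a b : ℕ, Set (UCobLin k a b)) (a b : ℕ) : Type _ :=
  UCobLin k a b ⧸ UCobLin.ideal R a b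

noncomputable instance (a b : ℕ) : AddCommGroup (QHom R a b) :=
  inferInstanceAs (AddCommGroup (UCobLin k a b ⧸ UCobLin.ideal R a b))

noncomputable instance (a b : ℕ) : Module k (QHom R a b) :=
  inferInstanceAs (Module k (UCobLin k a b ⧸ UCobLin.ideal R a b))

/-- The quotient map. -/
noncomputable def toQuot (R : ∀ a b : ℕ, Set (UCobLin k a b)) {a b : ℕ} :
    UCobLin k a b →ₗ[k] QHom R a b :=
  (UCobLin.ideal R a b).mkQ

theorem toQuot_surjective {a b : ℕ} :
    Function.Surjective (toQuot R : UCobLin k a b →ₗ[k] QHom R a b) :=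
  (UCobLin.ideal R a b).mkQ_surjective

/-- Composition, induced from the gluing of cobordisms. -/
noncomputable def comp {a b c : ℕ} : QHom R a b →ₗ[k] QHom R b c →ₗ[k] QHom R a c :=
  (UCobLin.ideal R a b).liftQ
    { toFun := fun f => (UCobLin.ideal R b c).mapQ (UCobLin.ideal R a c) (UCobLin.comp f)
        (fun _ hg => UCobLin.MemIdeal.comp_left f hg)
      map_add' := fun f f' => by
        refine Submodule.linearMap_qext _ (LinearMap.ext fun g => ?_)
        exact congrArg Submodule.Quotient.mk (LinearMap.congr_fun (map_add UCobLin.comp f f') g)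
      map_smul' := fun r f => by
        refine Submodule.linearMap_qext _ (LinearMap.ext fun g => ?_)
        exact congrArg Submodule.Quotient.mk (LinearMap.congr_fun (map_smul UCobLin.comp r f) g) }
    (fun f hf => by
      refine Submodule.linearMap_qext _ (LinearMap.ext fun g => ?_)
      exact (Submodule.Quotient.mk_eq_zero _).2 (UCobLin.MemIdeal.comp_right g hf))

theorem comp_toQuot {a b c : ℕ} (f : UCobLin k a b) (g : UCobLin k b c) :
    comp (toQuot R f) (toQuot R g) = toQuot R (UCobLin.comp f g) := rfl

noncomputable instance : Category (UCobQuot R) where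
  Hom X Y := QHom R X.circles Y.circles
  id X := toQuot R (UCobLin.of (UCob.id X.circles))
  comp f g := comp f g
  id_comp f := by
    obtain ⟨f, rfl⟩ := toQuot_surjective f
    rw [comp_toQuot, UCobLin.id_comp]
  comp_id f := by
    obtain ⟨f, rfl⟩ := toQuot_surjective f
    rw [comp_toQuot, UCobLin.comp_id]
  assoc f g h := by
    obtain ⟨f, rfl⟩ := toQuot_surjective f
    obtain ⟨g, rfl⟩ := toQuot_surjective g
    obtain ⟨h, rfl⟩ := toQuot_surjective h
    simp only [comp_toQuot, UCobLin.comp_assoc]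

noncomputable instance : Preadditive (UCobQuot R) where
  homGroup X Y := inferInstanceAs (AddCommGroup (QHom R X.circles Y.circles))
  add_comp X Y Z f f' g :=
    LinearMap.map_add₂ (comp (R := R) (a := X.circles) (b := Y.circles) (c := Z.circles)) f f' g
  comp_add X Y Z f g g' :=
    (comp (R := R) (a := X.circles) (b := Y.circles) (c := Z.circles) f).map_add g g'

noncomputable instance : Linear k (UCobQuot R) where
  homModule X Y := inferInstanceAs (Module k (QHom R X.circles Y.circles))
  smul_comp X Y Z r f g :=
    LinearMap.map_smul₂ (comp (R := R) (a := X.circles) (b := Y.circles) (c := Z.circles)) r f g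
  comp_smul X Y Z f r g :=
    (comp (R := R) (a := X.circles) (b := Y.circles) (c := Z.circles) f).map_smul r g

/-- The class of a cobordism. -/
noncomputable def cob (R : ∀ a b : ℕ, Set (UCobLin k a b)) {a b : ℕ} (f : UCob.Hom a b) :
    (⟨a⟩ : UCobQuot R) ⟶ ⟨b⟩ :=
  toQuot R (UCobLin.of f)

end UCobQuot

/-! ### The categories `VUCob`, `SUCob` and `SOCob` -/

variable {k}

/-- The relations of `VUCob`: evaluation of the closed connected surfaces. -/
inductive ClosedRel (α β γ : ℕ → k) : ∀ a b : ℕ, Set (UCobLin k a b)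
  | orientable (g : ℕ) : ClosedRel α β γ 0 0
      (UCobLin.of (UCob.closedOrientable g) - α g • UCobLin.of (UCob.id 0))
  | oneCross (g : ℕ) : ClosedRel α β γ 0 0
      (UCobLin.of (UCob.closedOneCross g) - β g • UCobLin.of (UCob.id 0))
  | twoCross (g : ℕ) : ClosedRel α β γ 0 0
      (UCobLin.of (UCob.closedTwoCross g) - γ g • UCobLin.of (UCob.id 0))

/-- `p / q` is the reduced and normalized form of the generating function of `α`. -/
def IsGeneratingFraction (α : ℕ → k) (p q : Polynomial k) : Prop :=
  IsCoprime p q ∧ q.coeff 0 = 1 ∧ PowerSeries.mk α * (q : PowerSeries k) = (p : PowerSeries k)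

/-- The handle polynomial `σ = ∑ i, qᵢ x ^ (K - i)`, where `K = max (deg p + 1) (deg q)`. -/
noncomputable def handlePolynomial (p q : Polynomial k) : UCobLin k 1 1 :=
  ∑ i ∈ Finset.range (q.natDegree + 1),
    q.coeff i • UCobLin.of (UCob.handlePow (max (p.natDegree + 1) q.natDegree - i))

/-- The relations of `SUCob`: those of `VUCob` and the handle relation `σ = 0`. -/
inductive SkeinRel (α β γ : ℕ → k) : ∀ a b : ℕ, Set (UCobLin k a b)
  | closed {a b : ℕ} {f : UCobLin k a b} : f ∈ ClosedRel α β γ a b → SkeinRel α β γ a b f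
  | handle {p q : Polynomial k} : IsGeneratingFraction α p q →
      SkeinRel α β γ 1 1 (handlePolynomial p q)

/-- The relations of `SOCob`: those of `SUCob` for `β = γ = 0`, and `θ = 0`. -/
inductive OrientableRel (α : ℕ → k) : ∀ a b : ℕ, Set (UCobLin k a b)
  | skein {a b : ℕ} {f : UCobLin k a b} : f ∈ SkeinRel α 0 0 a b → OrientableRel α a b f
  | crosscap : OrientableRel α 0 1 (UCobLin.of UCob.crosscap)

/-- The category `VUCob_{α, β, γ}`. -/
abbrev VUCob (α β γ : ℕ → k) := UCobQuot (ClosedRel α β γ)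

/-- The skein category `SUCob_{α, β, γ}`. -/
abbrev SUCob (α β γ : ℕ → k) := UCobQuot (SkeinRel α β γ)

/-- The orientable skein category `SOCob_α`. -/
abbrev SOCob (α : ℕ → k) := UCobQuot (OrientableRel α)

/-- The sequence `(α₀, λ α₀, λ² α₀, …)`. -/
def geomSeq (l a₀ : k) : ℕ → k := fun n => l ^ n * a₀

/-- `G` is the matrix of inner products of the elements of `S_m` in `VUCob_{α, β, γ}`: the entry at
`(c, d)` is the evaluation of the closed surface obtained by gluing `c` and `d`, that is, the scalar
by which it acts as an endomorphism of `0`. -/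
def IsGramMatrix (α β γ : ℕ → k) (m : ℕ)
    (G : Matrix (UCob.spanningSet m) (UCob.spanningSet m) k) : Prop :=
  ∀ c d, UCobQuot.cob (ClosedRel α β γ) (UCob.glue c.1 d.1) = G c d • 𝟙 (⟨0⟩ : VUCob α β γ)

end Linear

/-! ### The calculus of cobordisms: adding a strand, and the generators on the last strands -/

namespace UCob

local notation:80 f:81 "⨟" g:80 => UCob.comp f g

/-! For all non-zero parameters the classes of `S_m` form a basis of the space of morphisms from 0
to m. So the formula holds everywhere, and the exceptional set is empty.

Spanning. Every cobordism from the empty set has a normal form (`UCob.isNormal`): a disjoint union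
of disks carrying handles x and crosses y, whose boundary circles are spread over the outgoing
circles by genus zero pieces with some flips. The essential case is gluing a pair of pants to two
outgoing circles. If they lie on one component, this creates a handle, or y² when the signs differ;
if they lie on two components, these merge. In `SOCob` x is λ, y is 0 and a sphere is α₀. Hence
every cobordism is a multiple of an element of `S_m`, with a coefficient polynomial in the
parameters (`exists_eqSMul_spanningSet`).

Independence. Take r = λ and 2n colors with a free involution. The functions on the colors, with
Δ(δ_x) = r δ_x ⊗ δ_x, ε(δ_x) = 1/r, φ the involution and θ = 0, define a field theory: the relation
for two crosscaps holds because the involution has no fixed point. A handle acts by r and a sphere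
is 2n/r, so this is a model of `SOCob` only if 2n = rα₀. Other values of α₀ are reached by
interpolation. An element of the tensor ideal takes the value (2n - rα₀) M_n, where M_n is a
combination of values of cobordisms with coefficients polynomial in n
(`Coloring.exists_evalLin_eq_smul`), hence of values of `S_m` with coefficients Q_c(n). For n ≥ m
the values of `S_m` are independent, by a triangularity argument on the number of components. So a
combination with coefficients s_c in the ideal gives s_c = (2n - rα₀) Q_c(n) for infinitely many n,
hence an identity of polynomials in n. Substituting rα₀/2 for n yields s_c = 0
(`Coloring.eq_zero_of_memIdeal`).

Counting. The field theory also shows that two signed surjections give the same cobordism exactly if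
a signed permutation of the components relates them. The action is free, so there are l! S(m,l) 2^m
/ (l! 2^l) elements with l components.

Gram determinant. Closed surfaces are polynomials in the parameters already in `VUCob`. At λ = 1, α₀
= 2n the Gram matrix is B Bᵀ, where the rational matrix B lists the values of `S_m` on colorings;
its rows are independent for n ≥ m, so the determinant is a non-zero polynomial. -/

theorem interchange {a b c a' b' c' : ℕ} (f : Hom a b) (g : Hom b c) (f' : Hom a' b')
    (g' : Hom b' c') : tensor (f ⨟ g) (f' ⨟ g') = tensor f f' ⨟ tensor g g' := by
  induction f using Quotient.ind
  induction g using Quotient.ind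
  induction f' using Quotient.ind
  induction g' using Quotient.ind
  exact Quotient.sound (UCobWord.Rel.interchange _ _ _ _)

theorem tensor_id (a b : ℕ) : tensor (id a) (id b) = id (a + b) :=
  Quotient.sound (UCobWord.Rel.tensor_id _ _)

theorem tensor_empty {a b : ℕ} (f : Hom a b) : tensor f (id 0) = f := by
  induction f using Quotient.ind
  exact Quotient.sound (UCobWord.Rel.tensor_empty _)

/-- Transport of cobordisms along equalities of source and target. -/
def cast {a b a' b' : ℕ} (ha : a = a') (hb : b = b') (f : Hom a b) : Hom a' b' :=
  ha ▸ hb ▸ f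

theorem cast_ofWord {a b a' b' : ℕ} (ha : a = a') (hb : b = b') (f : UCobWord a b) :
    cast ha hb (ofWord f) = ofWord (UCobWord.cast ha hb f) := by
  subst ha hb; rfl

theorem tensor_assoc {a b c d a' b' : ℕ} (f : Hom a b) (g : Hom c d) (h : Hom a' b') :
    cast (Nat.add_assoc a c a') (Nat.add_assoc b d b') (tensor (tensor f g) h) =
      tensor f (tensor g h) := by
  induction f using Quotient.ind
  induction g using Quotient.ind
  induction h using Quotient.ind
  exact (cast_ofWord _ _ _).trans (Quotient.sound (UCobWord.Rel.tensor_assoc _ _ _))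

theorem empty_tensor {a b : ℕ} (f : Hom a b) :
    cast (Nat.zero_add a) (Nat.zero_add b) (tensor (id 0) f) = f := by
  induction f using Quotient.ind
  exact (cast_ofWord _ _ _).trans (Quotient.sound (UCobWord.Rel.empty_tensor _))

theorem reassoc {a b b' c d : ℕ} {f : Hom a b} {g : Hom b c} {f' : Hom a b'} {g' : Hom b' c}
    (e : f ⨟ g = f' ⨟ g') (h : Hom c d) : f ⨟ g ⨟ h = f' ⨟ g' ⨟ h := by
  rw [← comp_assoc, e, comp_assoc]

theorem reassoc_one {a b c d : ℕ} {f : Hom a b} {g : Hom b c} {f' : Hom a c}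
    (e : f ⨟ g = f') (h : Hom c d) : f ⨟ g ⨟ h = f' ⨟ h := by
  rw [← comp_assoc, e]

/-- Adding a cylinder on the right. -/
def addStrand {a b : ℕ} (f : Hom a b) : Hom (a + 1) (b + 1) := tensor f (id 1)

/-- A cobordism with identity cylinders on the left. -/
def whisker (l : ℕ) {a b : ℕ} (f : Hom a b) : Hom (l + a) (l + b) := tensor (id l) f

/-- Generators are kept on the last strands and further strands are added on the right. All sources
and targets then have the form `l + 1 + ... + 1` and agree definitionally, so no transport is needed
in computations. -/
def mulAt (l : ℕ) : Hom (l + 1 + 1) (l + 1) := whisker l mul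
def comulAt (l : ℕ) : Hom (l + 1) (l + 1 + 1) := whisker l comul
def counitAt (l : ℕ) : Hom (l + 1) l := whisker l counit
def twistAt (l : ℕ) : Hom (l + 1 + 1) (l + 1 + 1) := whisker l twist
def flipAt (l : ℕ) : Hom (l + 1) (l + 1) := whisker l flip
/-- The disjoint union with a state of one circle. -/
def stateAt (u : Hom 0 1) (l : ℕ) : Hom l (l + 1) := whisker l u

theorem addStrand_id (a : ℕ) : addStrand (id a) = id (a + 1) := tensor_id a 1

theorem addStrand_comp {a b c : ℕ} (f : Hom a b) (g : Hom b c) :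
    addStrand (f ⨟ g) = addStrand f ⨟ addStrand g := by
  have := interchange f g (id 1) (id 1)
  rwa [id_comp] at this

theorem whisker_id (l a : ℕ) : whisker l (id a) = id (l + a) := tensor_id l a

theorem whisker_comp (l : ℕ) {a b c : ℕ} (f : Hom a b) (g : Hom b c) :
    whisker l (f ⨟ g) = whisker l f ⨟ whisker l g := by
  have := interchange (id l) (id l) f g
  rwa [id_comp] at this

theorem whisker_addStrand (l : ℕ) {a b : ℕ} (f : Hom a b) :
    whisker l (addStrand f) = addStrand (whisker l f) :=
  (tensor_assoc (id l) f (id 1)).symm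

theorem tensor_eq_comp {a b c d : ℕ} (f : Hom a b) (g : Hom c d) :
    tensor f g = tensor f (id c) ⨟ whisker b g := by
  rw [whisker, ← interchange, id_comp, comp_id]

theorem tensor_eq_comp' {a b c d : ℕ} (f : Hom a b) (g : Hom c d) :
    tensor f g = whisker a g ⨟ tensor f (id d) := by
  rw [whisker, ← interchange, id_comp, comp_id]

theorem tensor_id_two {a b : ℕ} (f : Hom a b) :
    tensor f (id 2) = addStrand (addStrand f) := by
  have := tensor_assoc f (id 1) (id 1)
  rw [tensor_id] at this
  exact this.symm

/-- For numerals `a` and `b` the transport is along definitional equalities and disappears; this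
yields the lemmas from `twistAt_succ` to `stateAt_succ`. -/
theorem whisker_whisker_one (l : ℕ) {a b : ℕ} (f : Hom a b) :
    whisker l (whisker 1 f) = cast (Nat.add_assoc l 1 a) (Nat.add_assoc l 1 b)
      (whisker (l + 1) f) := by
  rw [whisker, whisker, whisker, ← tensor_assoc, tensor_id]

/-! ### Interchange of a cobordism with a generator on further strands. -/

section Slide

variable {a b : ℕ} (f : Hom a b)

theorem slide_mul : addStrand (addStrand f) ⨟ mulAt b = mulAt a ⨟ addStrand f := by
  have := (tensor_eq_comp f mul).symm.trans (tensor_eq_comp' f mul)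
  rwa [tensor_id_two] at this

theorem slide_comul : addStrand f ⨟ comulAt b = comulAt a ⨟ addStrand (addStrand f) := by
  have := (tensor_eq_comp f comul).symm.trans (tensor_eq_comp' f comul)
  rwa [tensor_id_two] at this

theorem slide_counit : addStrand f ⨟ counitAt b = counitAt a ⨟ f := by
  have := (tensor_eq_comp f counit).symm.trans (tensor_eq_comp' f counit)
  rwa [tensor_empty] at this

theorem slide_twist : addStrand (addStrand f) ⨟ twistAt b =
    twistAt a ⨟ addStrand (addStrand f) := by
  have := (tensor_eq_comp f twist).symm.trans (tensor_eq_comp' f twist)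
  rwa [tensor_id_two] at this

theorem slide_flip : addStrand f ⨟ flipAt b = flipAt a ⨟ addStrand f :=
  (tensor_eq_comp f flip).symm.trans (tensor_eq_comp' f flip)

theorem slide_state (u : Hom 0 1) : f ⨟ stateAt u b = stateAt u a ⨟ addStrand f := by
  have := (tensor_eq_comp f u).symm.trans (tensor_eq_comp' f u)
  rwa [tensor_empty] at this

end Slide

/-! ### The defining relations, on the last strands. -/

section Relations

variable (l : ℕ)

theorem twistAt_twistAt : twistAt l ⨟ twistAt l = id (l + 1 + 1) := by
  have : twist ⨟ twist = id 2 := Quotient.sound .twist_twist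
  rw [twistAt, ← whisker_comp, this, whisker_id]

theorem twistAt_succ : twistAt (l + 1) = whisker l (whisker 1 twist) :=
  (whisker_whisker_one l twist).symm
theorem mulAt_succ : mulAt (l + 1) = whisker l (whisker 1 mul) :=
  (whisker_whisker_one l mul).symm
theorem comulAt_succ : comulAt (l + 1) = whisker l (whisker 1 comul) :=
  (whisker_whisker_one l comul).symm
theorem counitAt_succ : counitAt (l + 1) = whisker l (whisker 1 counit) :=
  (whisker_whisker_one l counit).symm
theorem flipAt_succ : flipAt (l + 1) = whisker l (whisker 1 flip) :=
  (whisker_whisker_one l flip).symm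
theorem stateAt_succ (u : Hom 0 1) : stateAt u (l + 1) = whisker l (whisker 1 u) :=
  (whisker_whisker_one l u).symm
theorem addStrand_twistAt : addStrand (twistAt l) = whisker l (addStrand twist) :=
  (whisker_addStrand l twist).symm
theorem addStrand_mulAt : addStrand (mulAt l) = whisker l (addStrand mul) :=
  (whisker_addStrand l mul).symm
theorem addStrand_comulAt : addStrand (comulAt l) = whisker l (addStrand comul) :=
  (whisker_addStrand l comul).symm
theorem addStrand_counitAt : addStrand (counitAt l) = whisker l (addStrand counit) :=
  (whisker_addStrand l counit).symm
theorem addStrand_flipAt : addStrand (flipAt l) = whisker l (addStrand flip) :=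
  (whisker_addStrand l flip).symm
theorem addStrand_stateAt (u : Hom 0 1) :
    addStrand (stateAt u l) = whisker l (addStrand u) :=
  (whisker_addStrand l u).symm

theorem braidAt : addStrand (twistAt l) ⨟ twistAt (l + 1) ⨟ addStrand (twistAt l) =
    twistAt (l + 1) ⨟ addStrand (twistAt l) ⨟ twistAt (l + 1) := by
  have : (addStrand twist ⨟ whisker 1 twist) ⨟ addStrand twist =
      (whisker 1 twist ⨟ addStrand twist) ⨟ whisker 1 twist := Quotient.sound .braid
  rw [comp_assoc, comp_assoc] at this
  have := congrArg (whisker l) this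
  rw [whisker_comp, whisker_comp, whisker_comp, whisker_comp] at this
  rw [twistAt_succ, addStrand_twistAt]
  exact this

theorem unit_twistAt : addStrand (stateAt unit l) ⨟ twistAt l = stateAt unit (l + 1) := by
  have : addStrand unit ⨟ twist = whisker 1 unit := Quotient.sound .unit_twist
  rw [addStrand_stateAt, stateAt_succ, ← this, whisker_comp]; rfl

theorem crosscap_twistAt :
    addStrand (stateAt crosscap l) ⨟ twistAt l = stateAt crosscap (l + 1) := by
  have : addStrand crosscap ⨟ twist = whisker 1 crosscap := Quotient.sound .crosscap_twist
  rw [addStrand_stateAt, stateAt_succ, ← this, whisker_comp]; rfl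

theorem twistAt_counit : twistAt l ⨟ addStrand (counitAt l) = counitAt (l + 1) := by
  have : twist ⨟ addStrand counit = whisker 1 counit := Quotient.sound .twist_counit
  rw [addStrand_counitAt, counitAt_succ, ← this, whisker_comp]; rfl

theorem mul_twistAt : addStrand (mulAt l) ⨟ twistAt l =
    twistAt (l + 1) ⨟ addStrand (twistAt l) ⨟ mulAt (l + 1) := by
  have : addStrand mul ⨟ twist = (whisker 1 twist ⨟ addStrand twist) ⨟ whisker 1 mul :=
    Quotient.sound .mul_twist
  rw [comp_assoc] at this
  have := congrArg (whisker l) this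
  rw [whisker_comp, whisker_comp, whisker_comp] at this
  rw [twistAt_succ, addStrand_twistAt, addStrand_mulAt, mulAt_succ]
  exact this

theorem comul_twistAt : addStrand (comulAt l) ⨟ twistAt (l + 1) ⨟ addStrand (twistAt l) =
    twistAt l ⨟ comulAt (l + 1) := by
  have : (addStrand comul ⨟ whisker 1 twist) ⨟ addStrand twist = twist ⨟ whisker 1 comul :=
    Quotient.sound .comul_twist
  rw [comp_assoc] at this
  have := congrArg (whisker l) this
  rw [whisker_comp, whisker_comp, whisker_comp] at this
  rw [twistAt_succ, addStrand_twistAt, addStrand_comulAt, comulAt_succ]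
  exact this

theorem flip_twistAt : addStrand (flipAt l) ⨟ twistAt l = twistAt l ⨟ flipAt (l + 1) := by
  have : addStrand flip ⨟ twist = twist ⨟ whisker 1 flip := Quotient.sound .flip_twist
  have := congrArg (whisker l) this
  rw [whisker_comp, whisker_comp] at this
  rw [addStrand_flipAt, flipAt_succ]
  exact this

theorem mul_assocAt : addStrand (mulAt l) ⨟ mulAt l = mulAt (l + 1) ⨟ mulAt l := by
  have : addStrand mul ⨟ mul = whisker 1 mul ⨟ mul := Quotient.sound .mul_assoc
  have := congrArg (whisker l) this
  rw [whisker_comp, whisker_comp] at this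
  rw [addStrand_mulAt, mulAt_succ]
  exact this

theorem comul_assocAt : comulAt l ⨟ addStrand (comulAt l) = comulAt l ⨟ comulAt (l + 1) := by
  have : comul ⨟ addStrand comul = comul ⨟ whisker 1 comul := Quotient.sound .comul_assoc
  have := congrArg (whisker l) this
  rw [whisker_comp, whisker_comp] at this
  rw [addStrand_comulAt, comulAt_succ]
  exact this

theorem unit_mulAt : addStrand (stateAt unit l) ⨟ mulAt l = id (l + 1) := by
  have : addStrand unit ⨟ mul = id 1 := Quotient.sound .unit_mul
  rw [addStrand_stateAt, ← whisker_id l 1, ← this, whisker_comp]; rfl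

theorem mul_unitAt : stateAt unit (l + 1) ⨟ mulAt l = id (l + 1) := by
  have : whisker 1 unit ⨟ mul = id 1 := Quotient.sound .mul_unit
  rw [stateAt_succ, ← whisker_id l 1, ← this, whisker_comp]; rfl

theorem counit_comulAt : comulAt l ⨟ addStrand (counitAt l) = id (l + 1) := by
  have : comul ⨟ addStrand counit = id 1 := Quotient.sound .counit_comul
  rw [addStrand_counitAt, ← whisker_id l 1, ← this, whisker_comp]; rfl

theorem comul_counitAt : comulAt l ⨟ counitAt (l + 1) = id (l + 1) := by
  have : comul ⨟ whisker 1 counit = id 1 := Quotient.sound .comul_counit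
  rw [counitAt_succ, ← whisker_id l 1, ← this, whisker_comp]; rfl

theorem mul_commAt : twistAt l ⨟ mulAt l = mulAt l := by
  have : twist ⨟ mul = mul := Quotient.sound .mul_comm
  rw [twistAt, mulAt, ← whisker_comp, this]

theorem comul_commAt : comulAt l ⨟ twistAt l = comulAt l := by
  have : comul ⨟ twist = comul := Quotient.sound .comul_comm
  rw [twistAt, comulAt, ← whisker_comp, this]

theorem frobenius_leftAt : comulAt (l + 1) ⨟ addStrand (mulAt l) = mulAt l ⨟ comulAt l := by
  have : whisker 1 comul ⨟ addStrand mul = mul ⨟ comul := Quotient.sound .frobenius_left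
  have := congrArg (whisker l) this
  rw [whisker_comp, whisker_comp] at this
  rw [addStrand_mulAt, comulAt_succ]
  exact this

theorem frobenius_rightAt : addStrand (comulAt l) ⨟ mulAt (l + 1) = mulAt l ⨟ comulAt l := by
  have : addStrand comul ⨟ whisker 1 mul = mul ⨟ comul := Quotient.sound .frobenius_right
  have := congrArg (whisker l) this
  rw [whisker_comp, whisker_comp] at this
  rw [addStrand_comulAt, mulAt_succ]
  exact this

theorem flip_flipAt : flipAt l ⨟ flipAt l = id (l + 1) := by
  have : flip ⨟ flip = id 1 := Quotient.sound .flip_flip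
  rw [flipAt, ← whisker_comp, this, whisker_id]

theorem flip_mulAt : addStrand (flipAt l) ⨟ flipAt (l + 1) ⨟ mulAt l = mulAt l ⨟ flipAt l := by
  have : tensor flip flip ⨟ mul = mul ⨟ flip := Quotient.sound .flip_mul
  rw [tensor_eq_comp, comp_assoc] at this
  have := congrArg (whisker l) this
  rw [whisker_comp, whisker_comp, whisker_comp] at this
  rw [addStrand_flipAt, flipAt_succ]
  exact this

theorem comul_flipAt :
    comulAt l ⨟ addStrand (flipAt l) ⨟ flipAt (l + 1) = flipAt l ⨟ comulAt l := by
  have : comul ⨟ tensor flip flip = flip ⨟ comul := Quotient.sound .comul_flip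
  rw [tensor_eq_comp] at this
  have := congrArg (whisker l) this
  rw [whisker_comp, whisker_comp, whisker_comp] at this
  rw [addStrand_flipAt, flipAt_succ]
  exact this

theorem unit_flip : unit ⨟ flip = unit := Quotient.sound .unit_flip

theorem flip_counitAt : flipAt l ⨟ counitAt l = counitAt l := by
  have : flip ⨟ counit = counit := Quotient.sound .flip_counit
  rw [flipAt, counitAt, ← whisker_comp, this]

end Relations

/-- The cobordisms obtained from the generators on the last strands by composition and by adding
strands on the right. -/
inductive Generated : ∀ {a b : ℕ}, Hom a b → Prop
  | id (a : ℕ) : Generated (UCob.id a)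
  | comp {a b c : ℕ} {f : Hom a b} {g : Hom b c} :
      Generated f → Generated g → Generated (f ⨟ g)
  | addStrand {a b : ℕ} {f : Hom a b} : Generated f → Generated (UCob.addStrand f)
  | mulAt (l : ℕ) : Generated (UCob.mulAt l)
  | comulAt (l : ℕ) : Generated (UCob.comulAt l)
  | unitAt (l : ℕ) : Generated (stateAt unit l)
  | counitAt (l : ℕ) : Generated (UCob.counitAt l)
  | twistAt (l : ℕ) : Generated (UCob.twistAt l)
  | flipAt (l : ℕ) : Generated (UCob.flipAt l)
  | crosscapAt (l : ℕ) : Generated (stateAt crosscap l)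

theorem Generated.cast {a b a' b' : ℕ} (ha : a = a') (hb : b = b') {f : Hom a b}
    (hf : Generated f) : Generated (UCob.cast ha hb f) := by
  subst ha hb; exact hf

theorem generated_whisker_tensor_id (l : ℕ) {a b : ℕ} {f : Hom a b}
    (hf : Generated (whisker l f)) (c : ℕ) : Generated (whisker l (tensor f (id c))) := by
  induction c with
  | zero => rwa [tensor_empty]
  | succ c ih =>
    have h : tensor f (id (c + 1)) = addStrand (tensor f (id c)) := by
      have := tensor_assoc f (id c) (id 1)
      rw [tensor_id] at this
      exact this.symm
    rw [h, whisker_addStrand]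
    exact ih.addStrand

/-- The number `l` of strands on the left has to vary: f ⊗ g is f ⊗ id followed by id ⊗ g, so g
meets the strands of the target of f in addition. -/
theorem generated_whisker_ofWord {a b : ℕ} (w : UCobWord a b) (l : ℕ) :
    Generated (whisker l (ofWord w)) := by
  induction w generalizing l with
  | id n => exact (whisker_id l n) ▸ Generated.id _
  | comp f g hf hg =>
    have := (hf l).comp (hg l)
    rwa [← whisker_comp] at this
  | @tensor a b c d f g hf hg =>
    have e : ofWord (f.tensor g) = tensor (ofWord f) (ofWord g) := rfl
    rw [e, tensor_eq_comp, whisker_comp]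
    refine (generated_whisker_tensor_id l (hf l) c).comp ?_
    have := tensor_assoc (id l) (id b) (ofWord g)
    rw [tensor_id] at this
    rw [whisker, whisker, ← this]
    exact (hg (l + b)).cast _ _
  | mul => exact .mulAt l
  | unit => exact .unitAt l
  | comul => exact .comulAt l
  | counit => exact .counitAt l
  | twist => exact .twistAt l
  | flip => exact .flipAt l
  | crosscap => exact .crosscapAt l

theorem generated {a b : ℕ} (f : Hom a b) : Generated f := by
  rw [← empty_tensor f]
  refine Generated.cast _ _ ?_
  induction f using Quotient.ind with
  | _ w => exact generated_whisker_ofWord w 0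

end UCob

/-! ### Handles, crosses and orientation reversing cylinders -/

namespace UCob

local notation:80 f:81 "⨟" g:80 => UCob.comp f g

section Operators

variable (l : ℕ)

def handleAt : Hom (l + 1) (l + 1) := whisker l handle
def crossAt : Hom (l + 1) (l + 1) := whisker l cross

theorem handleAt_eq : handleAt l = comulAt l ⨟ mulAt l := whisker_comp l comul mul

theorem crossAt_eq : crossAt l = addStrand (stateAt crosscap l) ⨟ mulAt l := by
  have := whisker_comp l (addStrand crosscap) mul
  rw [whisker_addStrand] at this
  exact this

/-- Cocommutativity inserts a twist, naturality of the twist moves it past the multiplication, and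
the ordinary Frobenius relation applies. -/
theorem frobenius_twistAt :
    comulAt (l + 1) ⨟ addStrand (twistAt l) ⨟ mulAt (l + 1) = mulAt l ⨟ comulAt l := by
  rw [← comul_commAt (l + 1), comp_assoc, ← mul_twistAt, reassoc (frobenius_leftAt l),
    comul_commAt]

/-- This is `comul_twistAt` with the involutive twists moved to the other side. -/
theorem slide_twist_comul :
    comulAt (l + 1) ⨟ addStrand (twistAt l) ⨟ twistAt (l + 1) =
      twistAt l ⨟ addStrand (comulAt l) := by
  have h := congrArg (fun z => twistAt l ⨟ z ⨟ addStrand (twistAt l) ⨟ twistAt (l + 1))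
    (comul_twistAt l)
  simp only [comp_assoc, reassoc_one (twistAt_twistAt l), id_comp] at h
  rw [← h, reassoc_one (f := addStrand (twistAt l)) (g := addStrand (twistAt l))
    (f' := id (l + 1 + 1 + 1)), id_comp, twistAt_twistAt, comp_id]
  rw [← addStrand_comp, twistAt_twistAt, addStrand_id]

/-- Handles and crosses move freely through multiplication, comultiplication and twists. This is
what later allows collecting them on the disk of their component. -/
theorem handleAt_mulAt : handleAt (l + 1) ⨟ mulAt l = mulAt l ⨟ handleAt l := by
  rw [handleAt_eq, handleAt_eq, comp_assoc, ← mul_assocAt, reassoc (frobenius_leftAt l)]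

theorem comulAt_handleAt : comulAt l ⨟ handleAt (l + 1) = handleAt l ⨟ comulAt l := by
  rw [handleAt_eq, handleAt_eq, reassoc (comul_assocAt l).symm, frobenius_rightAt, comp_assoc]

theorem handleAt_twistAt : addStrand (handleAt l) ⨟ twistAt l = twistAt l ⨟ handleAt (l + 1) := by
  rw [handleAt_eq, handleAt_eq, addStrand_comp, comp_assoc, mul_twistAt,
    ← reassoc (comul_twistAt l), comp_assoc]

theorem handleAt_flipAt : handleAt l ⨟ flipAt l = flipAt l ⨟ handleAt l := by
  rw [handleAt_eq, comp_assoc, ← flip_mulAt, ← reassoc (comul_flipAt l), comp_assoc]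

theorem slide_handle {a b : ℕ} (f : Hom a b) :
    addStrand f ⨟ handleAt b = handleAt a ⨟ addStrand f :=
  (tensor_eq_comp f handle).symm.trans (tensor_eq_comp' f handle)

theorem slide_cross {a b : ℕ} (f : Hom a b) :
    addStrand f ⨟ crossAt b = crossAt a ⨟ addStrand f :=
  (tensor_eq_comp f cross).symm.trans (tensor_eq_comp' f cross)

theorem crossAt_succ : crossAt (l + 1) = addStrand (addStrand (stateAt crosscap l)) ⨟
    addStrand (twistAt l) ⨟ mulAt (l + 1) := by
  rw [crossAt_eq, ← crosscap_twistAt, addStrand_comp, comp_assoc]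

theorem crossAt_mulAt : crossAt (l + 1) ⨟ mulAt l = mulAt l ⨟ crossAt l := by
  rw [crossAt_succ, crossAt_eq, comp_assoc, comp_assoc, ← mul_assocAt,
    reassoc_one ((addStrand_comp _ _).symm.trans (congrArg addStrand (mul_commAt l))),
    mul_assocAt, reassoc (slide_mul _)]

theorem comulAt_crossAt : comulAt l ⨟ crossAt (l + 1) = crossAt l ⨟ comulAt l := by
  rw [crossAt_succ, crossAt_eq, reassoc (slide_comul _).symm, frobenius_twistAt, comp_assoc]

theorem crossAt_twistAt : addStrand (crossAt l) ⨟ twistAt l = twistAt l ⨟ crossAt (l + 1) := by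
  rw [crossAt_eq, crossAt_succ, addStrand_comp, comp_assoc, mul_twistAt,
    reassoc (slide_twist _)]

theorem crossAt_flipAt : crossAt l ⨟ flipAt l = crossAt l := by
  have : cross ⨟ flip = cross := Quotient.sound .crosscap_flip
  rw [crossAt, flipAt, ← whisker_comp, this]

theorem stateAt_zero (u : Hom 0 1) : stateAt u 0 = u := empty_tensor u
theorem handleAt_zero : handleAt 0 = handle := empty_tensor handle
theorem crossAt_zero : crossAt 0 = cross := empty_tensor cross
theorem flipAt_zero : flipAt 0 = flip := empty_tensor flip

theorem stateAt_comp (u : Hom 0 1) (f : Hom 1 1) : stateAt (u ⨟ f) l = stateAt u l ⨟ whisker l f :=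
  whisker_comp l u f

/-- Multiplying the crosscap by a unit changes nothing, so it is a cross on a disk and needs no
place of its own in normal forms. -/
theorem crosscap_eq : crosscap = unit ⨟ cross := by
  have h := slide_state (stateAt crosscap 0) unit
  have h' := congrArg (fun z => z ⨟ mulAt 0) h
  simp only [comp_assoc] at h'
  rw [mul_unitAt, ← crossAt_eq, comp_id, crossAt_zero, stateAt_zero, stateAt_zero] at h'
  exact h'

theorem two_crosscapsAt : stateAt unit l ⨟ comulAt l ⨟ addStrand (flipAt l) ⨟ mulAt l =
    stateAt crosscap l ⨟ stateAt crosscap (l + 1) ⨟ mulAt l := by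
  have : ((unit ⨟ comul) ⨟ addStrand flip) ⨟ mul = tensor crosscap crosscap ⨟ mul :=
    Quotient.sound .two_crosscaps
  rw [tensor_eq_comp, tensor_empty, comp_assoc, comp_assoc, comp_assoc] at this
  have := congrArg (whisker l) this
  simp only [whisker_comp] at this
  rw [addStrand_flipAt, stateAt_succ]
  exact this

/-- The relation for two crosscaps gives this only on the unit. By the Frobenius relation Δ(a) =
Δ(1)·a, so the identity extends to all of the circle. -/
theorem klein_eq_cross_cross :
    comulAt l ⨟ addStrand (flipAt l) ⨟ mulAt l = crossAt l ⨟ crossAt l := by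
  have h₁ : comulAt l = addStrand (stateAt unit l) ⨟ addStrand (comulAt l) ⨟ mulAt (l + 1) := by
    rw [frobenius_rightAt, reassoc_one (unit_mulAt l), id_comp]
  rw [h₁, comp_assoc, comp_assoc, reassoc (slide_mul _).symm, ← mul_assocAt]
  simp only [← addStrand_comp, ← comp_assoc]
  simp only [comp_assoc, two_crosscapsAt]
  rw [← crosscap_twistAt, comp_assoc, mul_commAt, crossAt_eq, comp_assoc,
    reassoc (slide_mul _).symm, ← mul_assocAt]
  simp only [addStrand_comp, comp_assoc]

end Operators

end UCob

/-! ### Signed spreads -/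

namespace UCob

local notation:80 f:81 "⨟" g:80 => UCob.comp f g

/-- The cylinder on the last strand, orientation reversing if `e` holds. -/
def flipIf (e : Bool) (l : ℕ) : Hom (l + 1) (l + 1) := if e then flipAt l else id (l + 1)

@[simp] theorem flipIf_false (l : ℕ) : flipIf false l = id (l + 1) := rfl
@[simp] theorem flipIf_true (l : ℕ) : flipIf true l = flipAt l := rfl

theorem flipIf_flipIf (e e' : Bool) (l : ℕ) : flipIf e l ⨟ flipIf e' l = flipIf (xor e e') l := by
  cases e <;> cases e' <;> simp [id_comp, comp_id, flip_flipAt]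

theorem slide_flipIf {a b : ℕ} (f : Hom a b) (e : Bool) :
    addStrand f ⨟ flipIf e b = flipIf e a ⨟ addStrand f := by
  cases e <;> simp [id_comp, comp_id, slide_flip]

theorem addStrand_flipIf_twistAt (e : Bool) (l : ℕ) :
    addStrand (flipIf e l) ⨟ twistAt l = twistAt l ⨟ flipIf e (l + 1) := by
  cases e <;> simp [id_comp, comp_id, addStrand_id, flip_twistAt]

theorem flipAt_twistAt (l : ℕ) : flipAt (l + 1) ⨟ twistAt l = twistAt l ⨟ addStrand (flipAt l) := by
  have h := congrArg (fun z => twistAt l ⨟ z ⨟ twistAt l) (flip_twistAt l)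
  simp only [comp_assoc, reassoc_one (twistAt_twistAt l), id_comp, twistAt_twistAt, comp_id] at h
  exact h.symm

theorem flipIf_twistAt (e : Bool) (l : ℕ) :
    flipIf e (l + 1) ⨟ twistAt l = twistAt l ⨟ addStrand (flipIf e l) := by
  cases e <;> simp [id_comp, comp_id, addStrand_id, flipAt_twistAt]

theorem comul_flipIf (e : Bool) (l : ℕ) :
    flipIf e l ⨟ comulAt l = comulAt l ⨟ addStrand (flipIf e l) ⨟ flipIf e (l + 1) := by
  cases e <;> simp [id_comp, comp_id, addStrand_id, comul_flipAt]

theorem flipIf_mul (e : Bool) (l : ℕ) :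
    addStrand (flipIf e l) ⨟ flipIf e (l + 1) ⨟ mulAt l = mulAt l ⨟ flipIf e l := by
  cases e <;> simp [id_comp, comp_id, addStrand_id, flip_mulAt]

theorem flipIf_counit (e : Bool) (l : ℕ) : flipIf e l ⨟ counitAt l = counitAt l := by
  cases e <;> simp [id_comp, flip_counitAt]

theorem splitOff_castSucc (l : ℕ) (j : Fin l) :
    splitOff (l + 1) j.castSucc = addStrand (splitOff l j) ⨟ twistAt l := by
  simp only [splitOff, Fin.val_castSucc, j.is_lt, dite_true]
  rfl

theorem splitOff_last (l : ℕ) : splitOff (l + 1) (Fin.last l) = comulAt l := by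
  simp only [splitOff, Fin.val_last, lt_irrefl, dite_false]
  rfl

theorem counits_succ (l : ℕ) : counits (l + 1) = counitAt l ⨟ counits l := by
  have := tensor_eq_comp' (counits l) counit
  rwa [tensor_empty] at this

/-- The genus zero cobordism which joins the `i`-th incoming circle with the outgoing circles `j`
with `(F j).1 = i`, and has orientation reversing cylinders at the `j` with `(F j).2`. -/
def signedSpread {l : ℕ} : (m : ℕ) → (Fin m → Fin l × Bool) → Hom l m
  | 0, _ => counits l
  | m + 1, F => splitOff l (F (Fin.last m)).1 ⨟
      addStrand (signedSpread m fun i => F i.castSucc) ⨟ flipIf (F (Fin.last m)).2 m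

theorem spread_flips {l m : ℕ} (f : Fin m → Fin l) (J : Set (Fin m)) [DecidablePred (· ∈ J)] :
    spread m f ⨟ flips m J = signedSpread m fun i => (f i, decide (i ∈ J)) := by
  induction m with
  | zero => exact comp_id _
  | succ m ih =>
    have h : flips (m + 1) J = addStrand (flips m {i | i.castSucc ∈ J}) ⨟
        flipIf (decide (Fin.last m ∈ J)) m := by
      have := tensor_eq_comp (flips m {i | i.castSucc ∈ J}) (if Fin.last m ∈ J then flip else id 1)
      rw [flips]
      by_cases hJ : Fin.last m ∈ J
      · simp only [hJ, if_true, decide_true, flipIf_true] at this ⊢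
        exact this
      · simp only [hJ, if_false, decide_false, flipIf_false, comp_id] at this ⊢
        rfl
    have ih' := ih (fun i => f i.castSucc) {i | i.castSucc ∈ J}
    simp only [signedSpread, h, spread]
    change (splitOff l _ ⨟ addStrand _) ⨟ _ = _
    rw [comp_assoc, ← comp_assoc (addStrand _) (addStrand _), ← addStrand_comp, ih']
    rfl

/-- The cobordism `g` commutes with splitting off circles, up to `π`. -/
structure Intertwines {l l' : ℕ} (g : Hom l l') (π : Fin l' → Fin l × Bool) : Prop where
  counits : g ⨟ counits l' = counits l
  splitOff (j : Fin l') : g ⨟ splitOff l' j =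
    splitOff l (π j).1 ⨟ addStrand g ⨟ flipIf (π j).2 l'

/-! ### Precomposition of spreads with relabelings of the components. -/

namespace Intertwines

/-- A spread is built by successively splitting off circles, so compatibility with a single
splitting propagates; the two signs met on the way to a circle add up. -/
theorem comp_signedSpread {l l' : ℕ} {g : Hom l l'} {π : Fin l' → Fin l × Bool}
    (h : Intertwines g π) {m : ℕ} (F : Fin m → Fin l' × Bool) :
    g ⨟ signedSpread m F =
      signedSpread m fun i => ((π (F i).1).1, xor (π (F i).1).2 (F i).2) := by
  induction m with
  | zero => exact h.counits
  | succ m ih =>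
    simp only [signedSpread]
    rw [← comp_assoc, h.splitOff, ← ih, addStrand_comp]
    simp only [comp_assoc]
    rw [reassoc (slide_flipIf _ _).symm, flipIf_flipIf]

theorem comp {l l' l'' : ℕ} {g : Hom l l'} {π : Fin l' → Fin l × Bool}
    {g' : Hom l' l''} {π' : Fin l'' → Fin l' × Bool} (h : Intertwines g π)
    (h' : Intertwines g' π') : Intertwines (g ⨟ g')
      fun j => ((π (π' j).1).1, xor (π (π' j).1).2 (π' j).2) where
  counits := by rw [comp_assoc, h'.counits, h.counits]
  splitOff j := by
    rw [comp_assoc, h'.splitOff, ← comp_assoc, h.splitOff, addStrand_comp]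
    simp only [comp_assoc]
    rw [reassoc (slide_flipIf _ _).symm, flipIf_flipIf]

theorem addStrand {l l' : ℕ} {g : Hom l l'} {π : Fin l' → Fin l × Bool}
    (h : Intertwines g π) {π' : Fin (l' + 1) → Fin (l + 1) × Bool}
    (hlast : π' (Fin.last l') = (Fin.last l, false))
    (hcast : ∀ j, π' (Fin.castSucc j) = ((π j).1.castSucc, (π j).2)) :
    Intertwines (UCob.addStrand g) π' where
  counits := by
    rw [counits_succ, counits_succ, reassoc (slide_counit g), h.counits]
  splitOff j := by
    refine Fin.lastCases ?_ (fun j => ?_) j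
    · rw [hlast, splitOff_last, splitOff_last, flipIf_false, comp_id, slide_comul]
    · rw [hcast, splitOff_castSucc, splitOff_castSucc, ← comp_assoc, ← addStrand_comp, h.splitOff,
        addStrand_comp, addStrand_comp, comp_assoc, comp_assoc, comp_assoc,
        addStrand_flipIf_twistAt, reassoc (slide_twist g)]

theorem twistAt (l : ℕ) {π : Fin (l + 2) → Fin (l + 2) × Bool}
    (hlast : π (Fin.last _) = ((Fin.last l).castSucc, false))
    (hmid : π (Fin.last l).castSucc = (Fin.last _, false))
    (hcast : ∀ j : Fin l, π j.castSucc.castSucc = (j.castSucc.castSucc, false)) :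
    Intertwines (UCob.twistAt l) π where
  counits := by
    rw [counits_succ, counits_succ, ← reassoc (slide_counit _), reassoc_one (twistAt_counit l),
      ← reassoc (slide_counit _)]
  splitOff j := by
    refine Fin.lastCases ?_ (fun j => Fin.lastCases ?_ (fun j => ?_) j) j
    · rw [hlast, splitOff_last, splitOff_castSucc, splitOff_last, flipIf_false, comp_id,
        comp_assoc, comul_twistAt]
    · rw [hmid, splitOff_last, splitOff_castSucc, splitOff_last, flipIf_false, comp_id,
        ← reassoc (slide_twist_comul l), comp_assoc, twistAt_twistAt, comp_id]
    · rw [hcast, splitOff_castSucc, splitOff_castSucc, flipIf_false, comp_id, addStrand_comp,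
        comp_assoc, reassoc (slide_twist _).symm, ← braidAt]
      simp only [comp_assoc]

theorem flipAt (l : ℕ) {π : Fin (l + 1) → Fin (l + 1) × Bool}
    (hlast : π (Fin.last _) = (Fin.last l, true))
    (hcast : ∀ j : Fin l, π j.castSucc = (j.castSucc, false)) :
    Intertwines (UCob.flipAt l) π where
  counits := by rw [counits_succ, reassoc_one (flip_counitAt l)]
  splitOff j := by
    refine Fin.lastCases ?_ (fun j => ?_) j
    · rw [hlast, splitOff_last, flipIf_true, comul_flipAt]
    · rw [hcast, splitOff_castSucc, flipIf_false, comp_id, comp_assoc,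
        reassoc (slide_flip _).symm, flipAt_twistAt]

theorem id (l : ℕ) : Intertwines (UCob.id l) fun j => (j, false) where
  counits := id_comp _
  splitOff j := by rw [id_comp, addStrand_id, id_comp, flipIf_false, comp_id]

/-- Feeding the last two components from the two legs of one pair of pants merges them.
Coassociativity and cocommutativity make it irrelevant from which leg a circle is split off. -/
theorem comulAt (l : ℕ) {π : Fin (l + 2) → Fin (l + 1) × Bool}
    (hlast : π (Fin.last _) = (Fin.last l, false))
    (hcast : ∀ j : Fin (l + 1), π j.castSucc = (j, false)) :
    Intertwines (UCob.comulAt l) π where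
  counits := by
    rw [counits_succ, reassoc_one (comul_counitAt l), id_comp]
  splitOff j := by
    refine Fin.lastCases ?_ (fun j => ?_) j
    · rw [hlast, splitOff_last, splitOff_last, flipIf_false, comp_id, comul_assocAt]
    · rw [hcast, splitOff_castSucc, flipIf_false, comp_id]
      refine Fin.lastCases ?_ (fun j => ?_) j
      · rw [splitOff_last, reassoc (comul_assocAt l), comul_commAt, comul_assocAt]
      · rw [splitOff_castSucc, addStrand_comp, comp_assoc, comp_assoc,
          reassoc (slide_comul _).symm, slide_twist_comul]

/-- Capping the last incoming circle adds a component without outgoing circles. -/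
theorem counitAt (l : ℕ) : Intertwines (UCob.counitAt l) fun j => (j.castSucc, false) where
  counits := (counits_succ l).symm
  splitOff j := by
    rw [splitOff_castSucc, flipIf_false, comp_id, comp_assoc, twistAt_counit, slide_counit]

end Intertwines

/-! ### Composing signed spreads with generators -/

theorem splitOff_comulAt (l : ℕ) (j : Fin l) :
    splitOff l j ⨟ comulAt l = splitOff l j ⨟ addStrand (splitOff l j) := by
  induction l with
  | zero => exact j.elim0
  | succ l ih =>
    refine Fin.lastCases ?_ (fun j => ?_) j
    · rw [splitOff_last, comul_assocAt]
    · have h := congrArg addStrand (ih j)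
      rw [addStrand_comp, addStrand_comp] at h
      rw [splitOff_castSucc, addStrand_comp, comp_assoc, comp_assoc, ← comul_twistAt,
        reassoc h, reassoc (slide_twist _)]

theorem splitOff_counitAt (l : ℕ) (j : Fin l) : splitOff l j ⨟ counitAt l = id l := by
  induction l with
  | zero => exact j.elim0
  | succ l ih =>
    refine Fin.lastCases ?_ (fun j => ?_) j
    · rw [splitOff_last, comul_counitAt]
    · have h := congrArg addStrand (ih j)
      rw [addStrand_comp, addStrand_id] at h
      rw [splitOff_castSucc, comp_assoc, ← twistAt_counit, reassoc_one (twistAt_twistAt l),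
        id_comp, h]

/-- The order in which two circles are split off is irrelevant up to exchanging them. The induction
reduces to cocommutativity when both come from the last circle and to the braid relation when
neither does. -/
theorem splitOff_twistAt (l : ℕ) (i j : Fin l) :
    splitOff l i ⨟ addStrand (splitOff l j) ⨟ twistAt l =
      splitOff l j ⨟ addStrand (splitOff l i) := by
  induction l with
  | zero => exact j.elim0
  | succ l ih =>
    have key (j : Fin l) : splitOff (l + 1) j.castSucc ⨟ addStrand (comulAt l) ⨟ twistAt (l + 1) =
        comulAt l ⨟ addStrand (splitOff (l + 1) j.castSucc) := by
      rw [splitOff_castSucc, addStrand_comp, reassoc (slide_comul _).symm, comp_assoc,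
        reassoc (slide_twist_comul l).symm, comp_assoc, twistAt_twistAt, comp_id]
    revert i j
    refine Fin.lastCases ?_ (fun i => ?_) <;> refine Fin.lastCases ?_ (fun j => ?_)
    · rw [splitOff_last, reassoc (comul_assocAt l), comul_commAt, comul_assocAt]
    · rw [splitOff_last, ← reassoc (key j), comp_assoc, twistAt_twistAt, comp_id]
    · rw [splitOff_last, key i]
    · have h := congrArg addStrand (ih i j)
      simp only [addStrand_comp] at h
      rw [splitOff_castSucc, splitOff_castSucc, addStrand_comp, addStrand_comp, comp_assoc,
        comp_assoc, comp_assoc, reassoc (slide_twist _).symm, ← braidAt, reassoc (slide_twist _).symm,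
        ← reassoc h]
      simp only [comp_assoc]

/-- Composition with `g` takes signed spreads to signed spreads. -/
def PreservesSpreads {a b : ℕ} (g : Hom a b) : Prop :=
  ∀ (l : ℕ) (F : Fin a → Fin l × Bool), ∃ F', signedSpread a F ⨟ g = signedSpread b F'

/-- Flips, counits, comultiplications and twists only change the list of outgoing circles of each
component. Multiplications, units and crosscaps change the components themselves and are treated on
normal forms. -/
theorem PreservesSpreads.addStrand {a b : ℕ} {g : Hom a b} (h : PreservesSpreads g) :
    PreservesSpreads (UCob.addStrand g) := by
  intro l F
  obtain ⟨F', hF'⟩ := h l fun i => F i.castSucc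
  refine ⟨Fin.snoc (α := fun _ => Fin l × Bool) F' (F (Fin.last a)), ?_⟩
  simp only [signedSpread, Fin.snoc_last, Fin.snoc_castSucc, ← hF', addStrand_comp, comp_assoc]
  rw [slide_flipIf]

theorem preservesSpreads_flipAt (m : ℕ) : PreservesSpreads (flipAt m) := by
  intro l F
  refine ⟨Fin.snoc (α := fun _ => Fin l × Bool) (fun i => F i.castSucc)
    ((F (Fin.last m)).1, xor (F (Fin.last m)).2 true), ?_⟩
  simp only [signedSpread, Fin.snoc_last, Fin.snoc_castSucc, comp_assoc, ← flipIf_true,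
    flipIf_flipIf]

theorem preservesSpreads_counitAt (m : ℕ) : PreservesSpreads (counitAt m) := by
  intro l F
  refine ⟨fun i => F i.castSucc, ?_⟩
  simp only [signedSpread, comp_assoc, flipIf_counit, slide_counit]
  rw [reassoc_one (splitOff_counitAt _ _), id_comp]

theorem preservesSpreads_comulAt (m : ℕ) : PreservesSpreads (comulAt m) := by
  intro l F
  refine ⟨Fin.snoc (α := fun _ => Fin l × Bool) F (F (Fin.last m)), ?_⟩
  simp only [signedSpread, Fin.snoc_last, Fin.snoc_castSucc, comp_assoc, comul_flipIf,
    addStrand_comp]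
  rw [reassoc (slide_comul _), reassoc (splitOff_comulAt _ _)]

theorem preservesSpreads_twistAt (m : ℕ) : PreservesSpreads (twistAt m) := by
  intro l F
  refine ⟨Fin.snoc (α := fun _ => Fin l × Bool)
    (Fin.snoc (α := fun _ => Fin l × Bool) (fun i => F i.castSucc.castSucc) (F (Fin.last _)))
    (F (Fin.last m).castSucc), ?_⟩
  simp only [signedSpread, Fin.snoc_last, Fin.snoc_castSucc, comp_assoc, addStrand_comp]
  rw [flipIf_twistAt, reassoc (addStrand_flipIf_twistAt _ m), reassoc (slide_twist _),
    ← slide_flipIf, ← reassoc (splitOff_twistAt l _ _)]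
  simp only [comp_assoc]
  rw [reassoc_one (twistAt_twistAt l), id_comp]

end UCob

/-! ### Normal forms of states -/

namespace UCob

local notation:80 f:81 "⨟" g:80 => UCob.comp f g

/-- Connected surfaces with one boundary circle: disks with handles and crosses. -/
inductive Elementary : Hom 0 1 → Prop
  | unit : Elementary unit
  | handle {u : Hom 0 1} : Elementary u → Elementary (u ⨟ handle)
  | cross {u : Hom 0 1} : Elementary u → Elementary (u ⨟ cross)

theorem elementary_crosscap : Elementary crosscap := crosscap_eq ▸ Elementary.unit.cross

theorem handle_flip : handle ⨟ flip = flip ⨟ handle := by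
  have h := handleAt_flipAt 0
  rwa [handleAt_zero, flipAt_zero] at h

theorem cross_flip : cross ⨟ flip = cross := Quotient.sound .crosscap_flip

namespace Elementary

/-- The flip commutes with handles, is absorbed by a cross and fixes the disk. Hence reversing all
signs of one component does not change the surface. -/
theorem comp_flip {u : Hom 0 1} (hu : Elementary u) : u ⨟ flip = u := by
  induction hu with
  | unit => exact unit_flip
  | handle hu ih => rw [comp_assoc, handle_flip, reassoc_one ih]
  | cross hu ih => rw [comp_assoc, cross_flip]

theorem stateAt_flipIf {u : Hom 0 1} (hu : Elementary u) (e : Bool) (l : ℕ) :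
    stateAt u l ⨟ flipIf e l = stateAt u l := by
  cases e
  · exact comp_id _
  · rw [flipIf_true, flipAt, ← stateAt_comp, hu.comp_flip]

theorem stateAt_twistAt {u : Hom 0 1} (hu : Elementary u) (l : ℕ) :
    addStrand (stateAt u l) ⨟ twistAt l = stateAt u (l + 1) := by
  induction hu with
  | unit => exact unit_twistAt l
  | @handle u hu ih =>
    have e (l : ℕ) : stateAt (u ⨟ UCob.handle) l = stateAt u l ⨟ handleAt l := stateAt_comp l u _
    rw [e, e, addStrand_comp, comp_assoc, handleAt_twistAt, reassoc_one ih]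
  | @cross u hu ih =>
    have e (l : ℕ) : stateAt (u ⨟ UCob.cross) l = stateAt u l ⨟ crossAt l := stateAt_comp l u _
    rw [e, e, addStrand_comp, comp_assoc, crossAt_twistAt, reassoc_one ih]

/-- The handles and crosses of the second surface slide through the pair of pants onto the first
one, until a disk is left, which is a unit. -/
theorem mul {u v : Hom 0 1} (hu : Elementary u) (hv : Elementary v) :
    ∃ w, Elementary w ∧ ∀ l, stateAt u l ⨟ stateAt v (l + 1) ⨟ mulAt l = stateAt w l := by
  induction hv with
  | unit => exact ⟨u, hu, fun l => by rw [mul_unitAt, comp_id]⟩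
  | @handle v hv ih =>
    obtain ⟨w, hw, h⟩ := ih
    refine ⟨_, hw.handle, fun l => ?_⟩
    have e (v : Hom 0 1) (l : ℕ) : stateAt (v ⨟ UCob.handle) l = stateAt v l ⨟ handleAt l :=
      stateAt_comp l v _
    rw [e, e, comp_assoc, handleAt_mulAt, ← h]
    simp only [comp_assoc]
  | @cross v hv ih =>
    obtain ⟨w, hw, h⟩ := ih
    refine ⟨_, hw.cross, fun l => ?_⟩
    have e (v : Hom 0 1) (l : ℕ) : stateAt (v ⨟ UCob.cross) l = stateAt v l ⨟ crossAt l :=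
      stateAt_comp l v _
    rw [e, e, comp_assoc, crossAt_mulAt, ← h]
    simp only [comp_assoc]

end Elementary

/-- The disjoint union of states of one circle. -/
def states : (l : ℕ) → (Fin l → Hom 0 1) → Hom 0 l
  | 0, _ => id 0
  | l + 1, A => states l (fun i => A i.castSucc) ⨟ stateAt (A (Fin.last l)) l

theorem units_eq_states (l : ℕ) : units l = states l fun _ => unit := by
  induction l with
  | zero => rfl
  | succ l ih =>
    have := tensor_eq_comp (units l) unit
    rw [tensor_empty] at this
    rw [units, this, ih]; rfl

/-- The components of elementary states may be permuted by a cobordism, which corresponds to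
permuting the components of a spread. -/
def Permutes {l : ℕ} (σ : Equiv.Perm (Fin l)) : Prop :=
  ∃ g : Hom l l, (∀ A : Fin l → Hom 0 1, (∀ i, Elementary (A i)) →
    states l A ⨟ g = states l (A ∘ σ)) ∧ Intertwines g fun j => (σ j, false)

theorem permutes_one (l : ℕ) : Permutes (1 : Equiv.Perm (Fin l)) :=
  ⟨id l, fun _ _ => comp_id _, Intertwines.id l⟩

theorem Permutes.mul {l : ℕ} {σ τ : Equiv.Perm (Fin l)} (hσ : Permutes σ) (hτ : Permutes τ) :
    Permutes (σ * τ) := by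
  obtain ⟨g, hg, ig⟩ := hσ
  obtain ⟨g', hg', ig'⟩ := hτ
  refine ⟨g ⨟ g', fun A hA => ?_, ?_⟩
  · rw [← comp_assoc, hg A hA, hg' (A ∘ σ) fun i => hA _]; rfl
  · simpa using ig.comp ig'

/-- The last adjacent transposition is the twist; the others arise from smaller ones by adding
strands. Adjacent transpositions generate all permutations. -/
theorem permutes_swap (l : ℕ) (i : Fin l) : Permutes (Equiv.swap i.castSucc i.succ) := by
  induction l with
  | zero => exact i.elim0
  | succ l ih =>
    refine Fin.lastCases ?_ (fun i => ?_) i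
    · rw [Fin.succ_last]
      refine ⟨twistAt l, fun A hA => ?_, Intertwines.twistAt l ?_ ?_ fun j => ?_⟩
      · have h : ∀ j : Fin l, Equiv.swap (Fin.last l).castSucc (Fin.last (l + 1))
            j.castSucc.castSucc = j.castSucc.castSucc := fun j =>
          Equiv.swap_apply_of_ne_of_ne
            (by simp) (Fin.castSucc_lt_last _).ne
        simp only [states, Function.comp, Equiv.swap_apply_right, Equiv.swap_apply_left, h,
          comp_assoc]
        rw [← (hA (Fin.last _)).stateAt_twistAt, comp_assoc, twistAt_twistAt, comp_id,
          ← slide_state]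
      · simp
      · simp
      · rw [Equiv.swap_apply_of_ne_of_ne
            (by simp) (Fin.castSucc_lt_last _).ne]
    · obtain ⟨g, hg, ig⟩ := ih i
      have h : ∀ j : Fin (l + 1), Equiv.swap i.castSucc.castSucc i.castSucc.succ j.castSucc =
          (Equiv.swap i.castSucc i.succ j).castSucc := fun j => by
        rw [Fin.succ_castSucc, ← Function.Injective.map_swap (Fin.castSucc_injective _)]
      have h' : Equiv.swap i.castSucc.castSucc i.castSucc.succ (Fin.last (l + 1)) =
          Fin.last (l + 1) := by
        rw [Fin.succ_castSucc]
        exact Equiv.swap_apply_of_ne_of_ne (Fin.castSucc_lt_last _).ne'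
          (Fin.castSucc_lt_last _).ne'
      refine ⟨addStrand g, fun A hA => ?_, ig.addStrand (by rw [h']) fun j => by rw [h]⟩
      have := hg (fun j => A j.castSucc) fun j => hA _
      rw [states, comp_assoc, ← slide_state, reassoc_one this, states.eq_def (l + 1 + 1)]
      simp only [Function.comp_def, h, h']

theorem permutes {l : ℕ} (σ : Equiv.Perm (Fin l)) : Permutes σ := by
  cases l with
  | zero => rw [Subsingleton.elim σ 1]; exact permutes_one 0
  | succ l =>
    have h : σ ∈ Submonoid.closure (Set.range fun i : Fin l ↦ Equiv.swap i.castSucc i.succ) := by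
      rw [Equiv.Perm.mclosure_swap_castSucc_succ]; trivial
    induction h using Submonoid.closure_induction with
    | mem x hx => obtain ⟨i, rfl⟩ := hx; exact permutes_swap l i
    | one => exact permutes_one _
    | mul x y _ _ hx hy => exact hx.mul hy

theorem states_permute {l m : ℕ} (σ : Equiv.Perm (Fin l)) {A : Fin l → Hom 0 1}
    (hA : ∀ i, Elementary (A i)) (F : Fin m → Fin l × Bool) :
    states l (A ∘ σ) ⨟ signedSpread m F =
      states l A ⨟ signedSpread m fun i => (σ (F i).1, (F i).2) := by
  obtain ⟨g, hg, ig⟩ := permutes σ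
  rw [← hg A hA, comp_assoc, ig.comp_signedSpread]
  simp

theorem exists_flipper (l : ℕ) (s : Fin l → Bool) : ∃ g : Hom l l,
    (∀ A : Fin l → Hom 0 1, (∀ i, Elementary (A i)) → states l A ⨟ g = states l A) ∧
      Intertwines g fun j => (j, s j) := by
  induction l with
  | zero => exact ⟨id 0, fun _ _ => comp_id _, by
      convert Intertwines.id 0 using 1⟩
  | succ l ih =>
    obtain ⟨g, hg, ig⟩ := ih fun j => s j.castSucc
    have h₁ : Intertwines (addStrand g)
        (Fin.snoc (α := fun _ => Fin (l + 1) × Bool) (fun j => (j.castSucc, s j.castSucc))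
          (Fin.last l, false)) :=
      ig.addStrand (by simp) fun j => by simp
    have h₂ : Intertwines (flipIf (s (Fin.last l)) l)
        (Fin.snoc (α := fun _ => Fin (l + 1) × Bool) (fun j => (j.castSucc, false))
          (Fin.last l, s (Fin.last l))) := by
      cases s (Fin.last l)
      · rw [flipIf_false]
        convert Intertwines.id (l + 1) using 1
        funext j
        refine Fin.lastCases ?_ (fun j => ?_) j <;> simp
      · exact Intertwines.flipAt l (by simp) fun j => by simp
    refine ⟨addStrand g ⨟ flipIf (s (Fin.last l)) l, fun A hA => ?_, ?_⟩
    · rw [states, comp_assoc, ← reassoc (slide_state g _),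
        (hA (Fin.last l)).stateAt_flipIf, reassoc_one (hg _ fun j => hA _)]
    · convert h₁.comp h₂ using 1
      funext j
      refine Fin.lastCases ?_ (fun j => ?_) j <;> simp

theorem states_toggle {l m : ℕ} (s : Fin l → Bool) {A : Fin l → Hom 0 1}
    (hA : ∀ i, Elementary (A i)) (F : Fin m → Fin l × Bool) :
    states l A ⨟ signedSpread m F =
      states l A ⨟ signedSpread m fun i => ((F i).1, xor (s (F i).1) (F i).2) := by
  obtain ⟨g, hg, ig⟩ := exists_flipper l s
  conv_lhs => rw [← hg A hA, comp_assoc, ig.comp_signedSpread]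

/-- States in normal form. -/
def IsNormal {m : ℕ} (s : Hom 0 m) : Prop :=
  ∃ (l : ℕ) (A : Fin l → Hom 0 1) (F : Fin m → Fin l × Bool),
    (∀ i, Elementary (A i)) ∧ s = states l A ⨟ signedSpread m F

theorem signedSpread_castSucc {l m : ℕ} (F : Fin m → Fin l × Bool) :
    counitAt l ⨟ signedSpread m F = signedSpread m fun i => ((F i).1.castSucc, (F i).2) := by
  simpa using (Intertwines.counitAt l).comp_signedSpread F

theorem IsNormal.comp_stateAt {m : ℕ} {s : Hom 0 m} (hs : IsNormal s) {u : Hom 0 1}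
    (hu : Elementary u) : IsNormal (s ⨟ stateAt u m) := by
  obtain ⟨l, A, F, hA, rfl⟩ := hs
  refine ⟨l + 1, Fin.snoc (α := fun _ => Hom 0 1) A u,
    Fin.snoc (α := fun _ => Fin (l + 1) × Bool) (fun i => ((F i).1.castSucc, (F i).2))
      (Fin.last l, false), fun i => ?_, ?_⟩
  · refine Fin.lastCases ?_ (fun i => ?_) i
    · simpa using hu
    · simpa using hA i
  · simp only [states, signedSpread, Fin.snoc_last, Fin.snoc_castSucc, flipIf_false, comp_id,
      splitOff_last, comp_assoc, ← signedSpread_castSucc]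
    rw [addStrand_comp, reassoc_one (counit_comulAt l), id_comp, slide_state]

theorem IsNormal.of_preservesSpreads {a b : ℕ} {g : Hom a b} (hg : PreservesSpreads g)
    {s : Hom 0 a} (hs : IsNormal s) : IsNormal (s ⨟ g) := by
  obtain ⟨l, A, F, hA, rfl⟩ := hs
  obtain ⟨F', hF'⟩ := hg l F
  exact ⟨l, A, F', hA, by rw [comp_assoc, hF']⟩

theorem comul_flips_mul (e : Bool) (l : ℕ) :
    comulAt l ⨟ addStrand (flipIf e l) ⨟ flipIf e (l + 1) ⨟ mulAt l = handleAt l ⨟ flipIf e l := by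
  rw [flipIf_mul, handleAt_eq, comp_assoc]

/-- Rejoining two circles of one component with opposite signs attaches a Klein bottle handle, which
is worth two crosses. -/
theorem comul_flips_mul_of_ne {e e' : Bool} (h : e ≠ e') (l : ℕ) :
    comulAt l ⨟ addStrand (flipIf e l) ⨟ flipIf e' (l + 1) ⨟ mulAt l =
      crossAt l ⨟ crossAt l := by
  cases e <;> cases e' <;> first | exact absurd rfl h | skip
  · rw [flipIf_false, addStrand_id, id_comp, ← comul_commAt, comp_assoc, flipIf_true,
      ← reassoc (flip_twistAt l), mul_commAt, klein_eq_cross_cross]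
  · rw [flipIf_false, id_comp, flipIf_true, klein_eq_cross_cross]

/-- Joining one circle split off from each of two components is the same as first merging the
components. Of the resulting three legs one is the joined circle, and the other two feed what
remains of the two spreads. -/
theorem merge_splitOff (l : ℕ) : comulAt (l + 1) ⨟ addStrand (addStrand (comulAt l)) ⨟
    addStrand (twistAt (l + 1)) ⨟ mulAt (l + 2) = mulAt l ⨟ comulAt l ⨟ addStrand (comulAt l) := by
  rw [reassoc (slide_comul _).symm, frobenius_twistAt, reassoc (frobenius_rightAt l), comul_assocAt]

theorem isNormal_of_states_comp {l m : ℕ} {A : Fin (l + 1) → Hom 0 1}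
    (hA : ∀ i, Elementary (A i)) {z : Hom (l + 1) (l + 1)}
    (hz : ∃ w, Elementary w ∧ stateAt (A (Fin.last l)) l ⨟ z = stateAt w l)
    (F : Fin m → Fin (l + 1) × Bool) : IsNormal (states (l + 1) A ⨟ z ⨟ signedSpread m F) := by
  obtain ⟨w, hw, h⟩ := hz
  refine ⟨l + 1, Fin.snoc (α := fun _ => Hom 0 1) (fun i => A i.castSucc) w, F, fun i => ?_, ?_⟩
  · refine Fin.lastCases ?_ (fun i => ?_) i
    · simpa using hw
    · simpa using hA _
  · simp only [states, Fin.snoc_last, Fin.snoc_castSucc, comp_assoc]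
    rw [reassoc_one h]

theorem isNormal_mul_same {l m : ℕ} {A : Fin (l + 1) → Hom 0 1} (hA : ∀ i, Elementary (A i))
    (F : Fin (m + 2) → Fin (l + 1) × Bool) (h₁ : (F (Fin.last _)).1 = Fin.last l)
    (h₂ : (F (Fin.last m).castSucc).1 = Fin.last l) :
    IsNormal ((states (l + 1) A ⨟ signedSpread (m + 2) F) ⨟ mulAt m) := by
  -- Here z is the local operator created by the gluing: a handle, or two crosses. It is pulled back
  -- from the outgoing circle to the incoming circle of its component and absorbed by the elementary
  -- state there.
  have key (z : (n : ℕ) → Hom (n + 1) (n + 1)) (e : Bool)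
      (hz : comulAt m ⨟ addStrand (flipIf (F (Fin.last m).castSucc).2 m) ⨟
        flipIf (F (Fin.last _)).2 (m + 1) ⨟ mulAt m = z m ⨟ flipIf e m)
      (hz' : comulAt l ⨟ z (l + 1) = z l ⨟ comulAt l)
      (hs : addStrand (signedSpread m fun i => F i.castSucc.castSucc) ⨟ z m =
        z (l + 1) ⨟ addStrand (signedSpread m fun i => F i.castSucc.castSucc))
      (hw : ∃ w, Elementary w ∧ stateAt (A (Fin.last l)) l ⨟ z l = stateAt w l) :
      IsNormal ((states (l + 1) A ⨟ signedSpread (m + 2) F) ⨟ mulAt m) := by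
    have e : (states (l + 1) A ⨟ signedSpread (m + 2) F) ⨟ mulAt m =
        states (l + 1) A ⨟ z l ⨟ signedSpread (m + 1)
          (Fin.snoc (α := fun _ => Fin (l + 1) × Bool) (fun i => F i.castSucc.castSucc)
            (Fin.last l, e)) := by
      simp only [signedSpread, Fin.snoc_last, Fin.snoc_castSucc, h₁, h₂, splitOff_last,
        addStrand_comp, comp_assoc]
      rw [reassoc (comul_assocAt l), ← reassoc (slide_comul _), hz, reassoc hs, reassoc hz']
    rw [e]
    exact isNormal_of_states_comp hA hw _
  by_cases h : (F (Fin.last m).castSucc).2 = (F (Fin.last _)).2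
  · refine key handleAt (F (Fin.last _)).2 (by rw [h, comul_flips_mul]) (comulAt_handleAt l)
      (slide_handle _) ⟨_, (hA (Fin.last l)).handle, (stateAt_comp l _ _).symm⟩
  · refine key (fun n => crossAt n ⨟ crossAt n) false ?_ ?_ ?_
      ⟨_, (hA (Fin.last l)).cross.cross, ?_⟩
    · rw [comul_flips_mul_of_ne h, flipIf_false, comp_id]
    · rw [reassoc (comulAt_crossAt l), comulAt_crossAt, comp_assoc]
    · rw [reassoc (slide_cross _), slide_cross, comp_assoc]
    · rw [stateAt_comp, stateAt_comp, comp_assoc]; rfl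

theorem isNormal_mul_ne {l m : ℕ} {A : Fin (l + 2) → Hom 0 1} (hA : ∀ i, Elementary (A i))
    (F : Fin (m + 2) → Fin (l + 2) × Bool) (h₁ : (F (Fin.last _)).1 = Fin.last _)
    (h₂ : (F (Fin.last m).castSucc).1 = (Fin.last l).castSucc)
    (h : (F (Fin.last m).castSucc).2 = (F (Fin.last _)).2) :
    IsNormal ((states (l + 2) A ⨟ signedSpread (m + 2) F) ⨟ mulAt m) := by
  obtain ⟨w, hw, hmul⟩ := (hA (Fin.last l).castSucc).mul (hA (Fin.last _))
  -- The comultiplication left over from `merge_splitOff` relabels the remaining circles of both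
  -- components by the merged one.
  have hΔ : Intertwines (comulAt l) (Fin.snoc (α := fun _ => Fin (l + 1) × Bool)
      (fun j => (j, false)) (Fin.last l, false)) :=
    Intertwines.comulAt l (by simp) fun j => by simp
  have hspread := hΔ.comp_signedSpread fun i => F i.castSucc.castSucc
  set F' : Fin m → Fin (l + 1) × Bool := _ with hF'
  change _ = signedSpread m F' at hspread
  refine ⟨l + 1, Fin.snoc (α := fun _ => Hom 0 1) (fun i => A i.castSucc.castSucc) w,
    Fin.snoc (α := fun _ => Fin (l + 1) × Bool) F' (Fin.last l, (F (Fin.last _)).2),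
    fun i => ?_, ?_⟩
  · refine Fin.lastCases ?_ (fun i => ?_) i
    · simpa using hw
    · simpa using hA _
  · simp only [states, signedSpread, Fin.snoc_last, Fin.snoc_castSucc, h₁, h₂, h, splitOff_last,
      splitOff_castSucc, addStrand_comp, comp_assoc, ← hspread, ← hmul]
    have hm := congrArg (fun z => z ⨟ addStrand (signedSpread m fun i => F i.castSucc.castSucc) ⨟
      flipIf (F (Fin.last _)).2 m) (merge_splitOff l)
    simp only [comp_assoc] at hm
    rw [flipIf_mul, reassoc (slide_mul _), hm]

theorem states_permute' {l m : ℕ} (σ : Equiv.Perm (Fin l)) {A : Fin l → Hom 0 1}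
    (hA : ∀ i, Elementary (A i)) (F : Fin m → Fin l × Bool) :
    states l A ⨟ signedSpread m F =
      states l (A ∘ σ.symm) ⨟ signedSpread m fun i => (σ (F i).1, (F i).2) := by
  rw [← states_permute σ (A := A ∘ σ.symm) (fun i => hA _)]
  simp [Function.comp_assoc]

theorem exists_perm_last {l : ℕ} {i j : Fin (l + 2)} (h : j ≠ i) :
    ∃ σ : Equiv.Perm (Fin (l + 2)), σ i = Fin.last _ ∧ σ j = (Fin.last l).castSucc := by
  refine ⟨Equiv.swap (Equiv.swap i (Fin.last _) j) (Fin.last l).castSucc *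
    Equiv.swap i (Fin.last _), ?_, by simp⟩
  rw [Equiv.Perm.mul_apply, Equiv.swap_apply_left]
  refine Equiv.swap_apply_of_ne_of_ne (fun h' => h ?_) (Fin.castSucc_lt_last _).ne'
  rw [eq_comm, Equiv.swap_apply_eq_iff, Equiv.swap_apply_right] at h'
  exact h'

/-- Permuting components brings those concerned to the end. For two different components, reversing
one of them makes the signs at the glued circles agree. -/
theorem IsNormal.comp_mulAt {m : ℕ} {s : Hom 0 (m + 2)} (hs : IsNormal s) :
    IsNormal (s ⨟ mulAt m) := by
  obtain ⟨l, A, F, hA, rfl⟩ := hs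
  by_cases h : (F (Fin.last m).castSucc).1 = (F (Fin.last _)).1
  · obtain _ | l := l
    · exact (F (Fin.last _)).1.elim0
    rw [states_permute' (Equiv.swap (F (Fin.last _)).1 (Fin.last l)) hA]
    exact isNormal_mul_same (fun i => hA _) _ (by simp) (by simp [h])
  · obtain _ | _ | l := l
    · exact (F (Fin.last _)).1.elim0
    · exact absurd (Subsingleton.elim (α := Fin 1) _ _) h
    obtain ⟨σ, h₁, h₂⟩ := exists_perm_last h
    -- The last component is reversed exactly if the two signs differ.
    rw [states_permute' σ hA, states_toggle (A := A ∘ σ.symm) (fun j => if j = Fin.last (l + 1) then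
      xor (F (Fin.last _)).2 (F (Fin.last m).castSucc).2 else false) (fun i => hA _)]
    refine isNormal_mul_ne (fun i => hA _) _ (by simpa using h₁) (by simpa using h₂) ?_
    have := (Fin.castSucc_lt_last (Fin.last l)).ne
    simp only [h₁, h₂, if_true, if_neg this]
    simp [Bool.xor_comm, Bool.xor_left_comm]

/-- Composition with `g`, after adding `d` strands, takes normal states to normal states. -/
def PreservesNormal : (d : ℕ) → {a b : ℕ} → Hom a b → Prop
  | 0, a, _, g => ∀ s : Hom 0 a, IsNormal s → IsNormal (s ⨟ g)
  | d + 1, _, _, g => PreservesNormal d (addStrand g)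

theorem preservesNormal_id (d a : ℕ) : PreservesNormal d (id a) := by
  induction d generalizing a with
  | zero => intro s hs; rwa [comp_id]
  | succ d ih => rw [PreservesNormal, addStrand_id]; exact ih _

theorem PreservesNormal.comp {d a b c : ℕ} {g : Hom a b} {h : Hom b c}
    (hg : PreservesNormal d g) (hh : PreservesNormal d h) : PreservesNormal d (g ⨟ h) := by
  induction d generalizing a b c with
  | zero => intro s hs; rw [← comp_assoc]; exact hh _ (hg _ hs)
  | succ d ih => rw [PreservesNormal, addStrand_comp]; exact ih hg hh

theorem PreservesSpreads.preservesNormal {a b : ℕ} {g : Hom a b} (hg : PreservesSpreads g)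
    (d : ℕ) : PreservesNormal d g := by
  induction d generalizing a b with
  | zero => exact fun s hs => hs.of_preservesSpreads hg
  | succ d ih => exact ih hg.addStrand

theorem preservesNormal_twistAt (d l : ℕ) : PreservesNormal d (twistAt l) :=
  (preservesSpreads_twistAt l).preservesNormal d

theorem preservesNormal_stateAt {u : Hom 0 1} (hu : Elementary u) (d l : ℕ) :
    PreservesNormal d (stateAt u l) := by
  induction d generalizing l with
  | zero => exact fun s hs => hs.comp_stateAt hu
  | succ d ih =>
    -- A new disk in the next to last position is a disk in the last position followed by a twist,
    -- so `d` decreases.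
    have h : addStrand (stateAt u l) = stateAt u (l + 1) ⨟ twistAt l := by
      rw [← hu.stateAt_twistAt, comp_assoc, twistAt_twistAt, comp_id]
    rw [PreservesNormal, h]
    exact (ih _).comp (preservesNormal_twistAt d l)

theorem preservesNormal_mulAt (d l : ℕ) : PreservesNormal d (mulAt l) := by
  induction d generalizing l with
  | zero => exact fun s hs => hs.comp_mulAt
  | succ d ih =>
    -- Naturality of the twist, solved for the multiplication in the earlier position.
    have h : addStrand (mulAt l) =
        twistAt (l + 1) ⨟ addStrand (twistAt l) ⨟ mulAt (l + 1) ⨟ twistAt l := by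
      have := congrArg (fun z => z ⨟ twistAt l) (mul_twistAt l)
      simpa only [comp_assoc, twistAt_twistAt, comp_id] using this
    rw [PreservesNormal, h]
    have h' : PreservesNormal d (addStrand (twistAt l)) := preservesNormal_twistAt (d + 1) l
    exact (preservesNormal_twistAt _ _).comp (h'.comp
      ((ih _).comp (preservesNormal_twistAt d l)))

/-- The statement covers all `d` at once because adding a strand in the induction raises `d` by one.
-/
theorem Generated.preservesNormal {a b : ℕ} {g : Hom a b} (hg : Generated g) (d : ℕ) :
    PreservesNormal d g := by
  induction hg generalizing d with
  | id a => exact preservesNormal_id d a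
  | comp _ _ hf hg => exact (hf d).comp (hg d)
  | addStrand _ hf => exact hf (d + 1)
  | mulAt l => exact preservesNormal_mulAt d l
  | comulAt l => exact (preservesSpreads_comulAt l).preservesNormal d
  | unitAt l => exact preservesNormal_stateAt .unit d l
  | counitAt l => exact (preservesSpreads_counitAt l).preservesNormal d
  | twistAt l => exact preservesNormal_twistAt d l
  | flipAt l => exact (preservesSpreads_flipAt l).preservesNormal d
  | crosscapAt l => exact preservesNormal_stateAt elementary_crosscap d l

/-- Every cobordism from the empty set has a normal form. -/
theorem isNormal {m : ℕ} (s : Hom 0 m) : IsNormal s := by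
  have h : IsNormal (id 0) :=
    ⟨0, fun i => i.elim0, fun i => i.elim0, fun i => i.elim0, (comp_id _).symm⟩
  have := (generated s).preservesNormal 0 (id 0) h
  rwa [id_comp] at this

/-- Cobordisms `c_{P, J}` in terms of signed spreads. -/
def signedCob {l m : ℕ} (F : Fin m → Fin l × Bool) : Hom 0 m := units l ⨟ signedSpread m F

theorem signedCob_eq_compCob {l m : ℕ} (F : Fin m → Fin l × Bool) :
    signedCob F = compCob (fun i => (F i).1) {i | (F i).2 = true} := by
  rw [compCob, comp_assoc, spread_flips, signedCob]
  simp

theorem compCob_eq_signedCob {l m : ℕ} (f : Fin m → Fin l) (J : Set (Fin m))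
    [DecidablePred (· ∈ J)] : compCob f J = signedCob fun i => (f i, decide (i ∈ J)) := by
  rw [compCob, comp_assoc, spread_flips, signedCob]

theorem mem_spanningSet {m : ℕ} {c : Hom 0 m} : c ∈ spanningSet m ↔
    ∃ (l : ℕ) (F : Fin m → Fin l × Bool), (Function.Surjective fun i => (F i).1) ∧
      signedCob F = c := by
  classical
  constructor
  · rintro ⟨l, f, J, hf, rfl⟩
    exact ⟨l, _, hf, (compCob_eq_signedCob f J).symm⟩
  · rintro ⟨l, F, hF, rfl⟩
    exact ⟨l, _, _, hF, signedCob_eq_compCob F⟩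

/-- Reordering the parts and reversing the orientation of components. -/
theorem signedCob_symm {l m : ℕ} (σ : Equiv.Perm (Fin l)) (s : Fin l → Bool)
    (F : Fin m → Fin l × Bool) :
    signedCob (fun i => (σ (F i).1, xor (s (F i).1) (F i).2)) = signedCob F := by
  have h : ∀ i : Fin l, Elementary ((fun _ => unit) i) := fun _ => .unit
  have h₁ := states_toggle s h F
  have h₂ := states_permute' σ h fun i => ((F i).1, xor (s (F i).1) (F i).2)
  rw [signedCob, signedCob, units_eq_states, h₁, h₂]
  rfl

end UCob

/-! ### Reduction modulo tensor ideals -/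

namespace UCob

local notation:80 f:81 "⨟" g:80 => UCob.comp f g

theorem handle_cross : handle ⨟ cross = cross ⨟ handle := by
  have h : handleAt 0 ⨟ crossAt 0 = crossAt 0 ⨟ handleAt 0 := by
    rw [handleAt_eq, comp_assoc, ← crossAt_mulAt, reassoc (comulAt_crossAt 0)]
  rwa [handleAt_zero, crossAt_zero] at h

theorem handlePow_cross (g : ℕ) : handlePow g ⨟ cross = cross ⨟ handlePow g := by
  induction g with
  | zero => rw [handlePow, id_comp, comp_id]
  | succ g ih => rw [handlePow, comp_assoc, handle_cross, reassoc ih]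

theorem handle_handlePow (g : ℕ) : handle ⨟ handlePow g = handlePow g ⨟ handle := by
  induction g with
  | zero => rw [handlePow, id_comp, comp_id]
  | succ g ih => rw [handlePow, reassoc ih, comp_assoc]

/-- Replace y² by m(φ ⊗ id)Δ. The third cross moves onto the leg that carries the flip and absorbs
it, which leaves an ordinary handle. -/
theorem cross_cross_cross : cross ⨟ cross ⨟ cross = cross ⨟ handle := by
  have h₁ : crossAt 0 ⨟ comulAt 0 = comulAt 0 ⨟ addStrand (crossAt 0) := by
    rw [crossAt_eq, addStrand_comp, comp_assoc, ← frobenius_leftAt, reassoc (slide_comul _)]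
  have h₂ : addStrand (crossAt 0) ⨟ addStrand (flipAt 0) = addStrand (crossAt 0) := by
    rw [← addStrand_comp, crossAt_flipAt]
  have h : crossAt 0 ⨟ crossAt 0 ⨟ crossAt 0 = crossAt 0 ⨟ handleAt 0 := by
    rw [← klein_eq_cross_cross, handleAt_eq, reassoc h₁, reassoc h₁, reassoc_one h₂]
  rwa [handleAt_zero, crossAt_zero] at h

/-- By y³ = yx at most two crosses remain. These are the three shapes whose closures are evaluated
by the relations of `VUCob`. -/
theorem eq_canonical_of_elementary {u : Hom 0 1} (hu : Elementary u) : ∃ g : ℕ,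
    u = unit ⨟ handlePow g ∨ u = (unit ⨟ cross) ⨟ handlePow g ∨
      u = ((unit ⨟ cross) ⨟ cross) ⨟ handlePow g := by
  induction hu with
  | unit => exact ⟨0, Or.inl (comp_id _).symm⟩
  | handle _ ih =>
    obtain ⟨g, rfl | rfl | rfl⟩ := ih
    · exact ⟨g + 1, Or.inl (comp_assoc _ _ _)⟩
    · exact ⟨g + 1, Or.inr (Or.inl (comp_assoc _ _ _))⟩
    · exact ⟨g + 1, Or.inr (Or.inr (comp_assoc _ _ _))⟩
  | cross _ ih =>
    obtain ⟨g, rfl | rfl | rfl⟩ := ih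
    · exact ⟨g, Or.inr (Or.inl (by simp only [comp_assoc, handlePow_cross]))⟩
    · exact ⟨g, Or.inr (Or.inr (by simp only [comp_assoc, handlePow_cross]))⟩
    · refine ⟨g + 1, Or.inr (Or.inl ?_)⟩
      have h := congrArg (fun z => unit ⨟ z ⨟ handlePow g) cross_cross_cross
      simp only [comp_assoc] at h
      simp only [comp_assoc, handlePow_cross, h, handle_handlePow, handlePow]

end UCob

namespace UCobLin

variable {k : Type*} [Field k]

theorem tensor_of_of {a b c d : ℕ} (f : UCob.Hom a b) (g : UCob.Hom c d) :
    tensor (of f : UCobLin k a b) (of g) = of (UCob.tensor f g) := by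
  simp [tensor, of]

/-- The cobordism `f` equals `r` times the cobordism `g` modulo the tensor ideal. -/
def EqSMul (R : ∀ a b : ℕ, Set (UCobLin k a b)) {a b : ℕ} (f : UCob.Hom a b) (r : k)
    (g : UCob.Hom a b) : Prop :=
  MemIdeal R (of f - r • of g)

namespace EqSMul

variable {R : ∀ a b : ℕ, Set (UCobLin k a b)}

theorem refl {a b : ℕ} (f : UCob.Hom a b) : EqSMul R f 1 f := by
  rw [EqSMul, one_smul, sub_self]; exact .zero

theorem trans {a b : ℕ} {f g h : UCob.Hom a b} {r s : k} (hf : EqSMul R f r g)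
    (hg : EqSMul R g s h) : EqSMul R f (r * s) h := by
  have := MemIdeal.add hf (MemIdeal.smul r hg)
  rwa [smul_sub, sub_add_sub_cancel, smul_smul] at this

theorem comp_right {a b c : ℕ} {f g : UCob.Hom a b} {r : k} (h : EqSMul R f r g)
    (z : UCob.Hom b c) : EqSMul R (UCob.comp f z) r (UCob.comp g z) := by
  have := MemIdeal.comp_right (of z) h
  rwa [map_sub, map_smul, LinearMap.sub_apply, LinearMap.smul_apply, comp_of_of,
    comp_of_of] at this

theorem comp_left {a b c : ℕ} {f g : UCob.Hom b c} {r : k} (z : UCob.Hom a b)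
    (h : EqSMul R f r g) : EqSMul R (UCob.comp z f) r (UCob.comp z g) := by
  have := MemIdeal.comp_left (of z) h
  rwa [map_sub, map_smul, comp_of_of, comp_of_of] at this

theorem whisker {a b : ℕ} {f g : UCob.Hom a b} {r : k} (h : EqSMul R f r g)
    (l : ℕ) : EqSMul R (UCob.whisker l f) r (UCob.whisker l g) := by
  have := MemIdeal.tensor_left (of (UCob.id l)) h
  rwa [map_sub, map_smul, tensor_of_of, tensor_of_of] at this

theorem zero_of_memIdeal {a b : ℕ} {f : UCob.Hom a b} (h : MemIdeal R (of f))
    (g : UCob.Hom a b) : EqSMul R f 0 g := by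
  rwa [EqSMul, zero_smul, sub_zero]

theorem toQuot_eq {a b : ℕ} {f g : UCob.Hom a b} {r : k} (h : EqSMul R f r g) :
    UCobQuot.cob R f = r • UCobQuot.cob R g := by
  have := (Submodule.Quotient.eq (UCobLin.ideal R a b)).2 h
  exact this.trans ((UCobLin.ideal R a b).mkQ.map_smul r (of g))

end EqSMul

end UCobLin

/-! ### Reduction of states in `SOCob` and of closed surfaces in `VUCob`. -/

section Reduction

variable {k : Type*} [Field k]

open UCobLin MvPolynomial

theorem isGeneratingFraction_geomSeq (l : k) {a₀ : k} (ha₀ : a₀ ≠ 0) :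
    IsGeneratingFraction (geomSeq l a₀) (Polynomial.C a₀) (1 - Polynomial.C l * Polynomial.X) := by
  refine ⟨⟨Polynomial.C a₀⁻¹, 0, ?_⟩, by simp, ?_⟩
  · rw [← Polynomial.C_mul, inv_mul_cancel₀ ha₀]; simp
  · ext n
    cases n with
    | zero => simp [geomSeq]
    | succ n =>
      simp only [Polynomial.coe_sub, Polynomial.coe_one, Polynomial.coe_mul, Polynomial.coe_C,
        Polynomial.coe_X, mul_sub, mul_one, map_sub, PowerSeries.coeff_mk]
      rw [← mul_assoc, PowerSeries.coeff_succ_mul_X, PowerSeries.coeff_mul_C, PowerSeries.coeff_C]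
      simp only [PowerSeries.coeff_mk, geomSeq, Nat.add_eq_zero_iff, one_ne_zero, and_false,
        if_false]
      ring

/-- The generating function is a₀ / (1 - lT), so K = max(0 + 1, 1) = 1 and the handle polynomial is
x - l. -/
theorem handle_eqSMul {l a₀ : k} (hl : l ≠ 0) (ha₀ : a₀ ≠ 0) :
    EqSMul (OrientableRel (geomSeq l a₀)) UCob.handle l (UCob.id 1) := by
  have h := MemIdeal.of_mem (OrientableRel.skein
    (SkeinRel.handle (β := 0) (γ := 0) (isGeneratingFraction_geomSeq l ha₀)))
  have hd : (1 - Polynomial.C l * Polynomial.X : Polynomial k).natDegree = 1 := by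
    rw [show (1 - Polynomial.C l * Polynomial.X : Polynomial k) =
      Polynomial.C (-l) * Polynomial.X + Polynomial.C 1 by simp; ring]
    exact Polynomial.natDegree_linear (neg_ne_zero.2 hl)
  have e : handlePolynomial (Polynomial.C a₀) (1 - Polynomial.C l * Polynomial.X) =
      of UCob.handle - l • of (UCob.id 1) := by
    rw [handlePolynomial, hd, Finset.sum_range_succ, Finset.sum_range_one]
    simp [UCob.handlePow, UCob.id_comp, Polynomial.coeff_one, sub_eq_add_neg]
  rwa [e] at h

theorem cross_eqSMul (l a₀ : k) :
    EqSMul (OrientableRel (geomSeq l a₀)) UCob.cross 0 (UCob.id 1) := by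
  apply EqSMul.zero_of_memIdeal
  have h := MemIdeal.comp_right (of UCob.mul) (MemIdeal.tensor_right (of (UCob.id 1))
    (MemIdeal.of_mem (OrientableRel.crosscap (α := geomSeq l a₀))))
  rwa [tensor_of_of, comp_of_of] at h

/-- The polynomial is chosen before the parameters; this uniformity is what the later interpolation
needs. -/
theorem UCob.Elementary.eqSMul_unit {u : UCob.Hom 0 1} (hu : UCob.Elementary u) :
    ∃ P : MvPolynomial (Fin 2) k, ∀ l a₀ : k, l ≠ 0 → a₀ ≠ 0 →
      EqSMul (OrientableRel (geomSeq l a₀)) u (eval ![l, a₀] P) UCob.unit := by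
  induction hu with
  | unit => exact ⟨1, fun l a₀ _ _ => by rw [map_one]; exact EqSMul.refl _⟩
  | @handle u _ ih =>
    obtain ⟨P, hP⟩ := ih
    refine ⟨X 0 * P, fun l a₀ hl ha₀ => ?_⟩
    have h := (EqSMul.comp_left u (handle_eqSMul hl ha₀))
    rw [UCob.comp_id] at h
    simpa using h.trans (hP l a₀ hl ha₀)
  | @cross u _ ih =>
    refine ⟨0, fun l a₀ hl ha₀ => ?_⟩
    rw [map_zero]
    apply EqSMul.zero_of_memIdeal
    have h := EqSMul.comp_left u (cross_eqSMul l a₀)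
    rwa [EqSMul, zero_smul, sub_zero] at h

theorem states_eqSMul_units {n : ℕ} {A : Fin n → UCob.Hom 0 1}
    (hA : ∀ i, UCob.Elementary (A i)) :
    ∃ P : MvPolynomial (Fin 2) k, ∀ l a₀ : k, l ≠ 0 → a₀ ≠ 0 →
      EqSMul (OrientableRel (geomSeq l a₀)) (UCob.states n A) (eval ![l, a₀] P)
        (UCob.units n) := by
  induction n with
  | zero => exact ⟨1, fun l a₀ _ _ => by rw [map_one]; exact EqSMul.refl _⟩
  | succ n ih =>
    obtain ⟨P, hP⟩ := ih (A := fun i => A i.castSucc) fun i => hA _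
    obtain ⟨Q, hQ⟩ := (hA (Fin.last n)).eqSMul_unit (k := k)
    refine ⟨P * Q, fun l a₀ hl ha₀ => ?_⟩
    have h := ((hP l a₀ hl ha₀).comp_right (UCob.stateAt (A (Fin.last n)) n)).trans
      (EqSMul.comp_left (UCob.units n) ((hQ l a₀ hl ha₀).whisker n))
    rw [map_mul, UCob.units_eq_states]
    rw [UCob.units_eq_states] at h
    exact h

/-- A component that meets no outgoing circle is a sphere and contributes a factor a₀. Removing such
components one by one makes the labeling surjective. -/
theorem signedCob_eqSMul_spanningSet {n m : ℕ} (F : Fin m → Fin n × Bool) :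
    ∃ P : MvPolynomial (Fin 2) k, ∃ c ∈ UCob.spanningSet m, ∀ l a₀ : k,
      EqSMul (OrientableRel (geomSeq l a₀)) (UCob.signedCob F) (eval ![l, a₀] P) c := by
  induction n with
  | zero =>
    exact ⟨1, _, UCob.mem_spanningSet.2 ⟨0, F, fun j => j.elim0, rfl⟩,
      fun l a₀ => by rw [map_one]; exact EqSMul.refl _⟩
  | succ n ih =>
    by_cases hF : Function.Surjective fun i => (F i).1
    · exact ⟨1, _, UCob.mem_spanningSet.2 ⟨_, F, hF, rfl⟩,
        fun l a₀ => by rw [map_one]; exact EqSMul.refl _⟩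
    · simp only [Function.Surjective, not_forall, not_exists] at hF
      obtain ⟨j, hj⟩ := hF
      -- The empty component is moved to the last position, where the spread factors through a
      -- counit.
      have hne : ∀ i, Equiv.swap j (Fin.last n) (F i).1 ≠ Fin.last n := fun i h => by
        rw [Equiv.swap_apply_eq_iff, Equiv.swap_apply_right] at h
        exact hj i h
      have hF' := UCob.signedCob_symm (Equiv.swap j (Fin.last n)) (fun _ => false) F
      choose f hf using fun i => Fin.exists_castSucc_eq.2 (hne i)
      obtain ⟨P, c, hc, hP⟩ := ih fun i => (f i, (F i).2)
      refine ⟨X 1 * P, c, hc, fun l a₀ => ?_⟩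
      have e : UCob.signedCob F = UCob.comp (UCob.comp (UCob.units n)
          (UCob.whisker n (UCob.comp UCob.unit UCob.counit)))
            (UCob.signedSpread m fun i => (f i, (F i).2)) := by
        rw [← hF', UCob.signedCob, UCob.whisker_comp]
        simp only [← hf, Bool.false_xor]
        have hc := UCob.signedSpread_castSucc fun i => (f i, (F i).2)
        rw [← hc, UCob.units_eq_states, UCob.units_eq_states]
        simp only [UCob.states, UCob.comp_assoc]
        rfl
      have hs : EqSMul (OrientableRel (geomSeq l a₀)) (UCob.comp UCob.unit UCob.counit) a₀
          (UCob.id 0) := by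
        have h := MemIdeal.of_mem (OrientableRel.skein
          (SkeinRel.closed (ClosedRel.orientable (α := geomSeq l a₀) (β := 0) (γ := 0) 0)))
        rw [EqSMul]
        simpa only [UCob.closedOrientable, UCob.handlePow, UCob.comp_id, geomSeq, pow_zero,
          one_mul] using h
      have h := ((EqSMul.comp_left (UCob.units n) (hs.whisker n)).comp_right
        (UCob.signedSpread m fun i => (f i, (F i).2)))
      have hid : UCob.whisker n (UCob.id 0) = UCob.id n := UCob.whisker_id n 0
      have hid' : UCob.comp (UCob.units n) (UCob.whisker n (UCob.id 0)) = UCob.units n := by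
        rw [hid]; exact UCob.comp_id _
      rw [hid'] at h
      rw [e]
      simpa using h.trans (hP l a₀)

/-- Modulo the relations of `SOCob`, every cobordism from the empty set is a multiple of an
element of the spanning set. The coefficient depends polynomially on the parameters. -/
theorem exists_eqSMul_spanningSet {m : ℕ} (s : UCob.Hom 0 m) :
    ∃ P : MvPolynomial (Fin 2) k, ∃ c ∈ UCob.spanningSet m, ∀ l a₀ : k, l ≠ 0 → a₀ ≠ 0 →
      EqSMul (OrientableRel (geomSeq l a₀)) s (eval ![l, a₀] P) c := by
  obtain ⟨n, A, F, hA, rfl⟩ := UCob.isNormal s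
  obtain ⟨P, hP⟩ := states_eqSMul_units (k := k) hA
  obtain ⟨Q, c, hc, hQ⟩ := signedCob_eqSMul_spanningSet (k := k) F
  refine ⟨P * Q, c, hc, fun l a₀ hl ha₀ => ?_⟩
  rw [map_mul]
  exact ((hP l a₀ hl ha₀).comp_right (UCob.signedSpread m F)).trans (hQ l a₀)

/-- No handle relation is available in `VUCob`, so the surface is brought into canonical form before
being evaluated. -/
theorem UCob.Elementary.counit_eqSMul {u : UCob.Hom 0 1} (hu : UCob.Elementary u) :
    ∃ P : MvPolynomial (Fin 2) k, ∀ l a₀ : k,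
      EqSMul (ClosedRel (geomSeq l a₀) 0 0) (UCob.comp u UCob.counit) (eval ![l, a₀] P)
        (UCob.id 0) := by
  obtain ⟨g, rfl | rfl | rfl⟩ := UCob.eq_canonical_of_elementary hu
  · refine ⟨X 0 ^ g * X 1, fun l a₀ => ?_⟩
    rw [EqSMul]
    simpa [geomSeq, UCob.closedOrientable, UCob.closedOneCross, UCob.closedTwoCross] using
      MemIdeal.of_mem (ClosedRel.orientable (α := geomSeq l a₀) (β := 0) (γ := 0) g)
  · refine ⟨0, fun l a₀ => ?_⟩
    rw [EqSMul]
    simpa [geomSeq, UCob.closedOrientable, UCob.closedOneCross, UCob.closedTwoCross] using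
      MemIdeal.of_mem (ClosedRel.oneCross (α := geomSeq l a₀) (β := 0) (γ := 0) g)
  · refine ⟨0, fun l a₀ => ?_⟩
    rw [EqSMul]
    simpa [geomSeq, UCob.closedOrientable, UCob.closedOneCross, UCob.closedTwoCross] using
      MemIdeal.of_mem (ClosedRel.twoCross (α := geomSeq l a₀) (β := 0) (γ := 0) g)

/-- In `VUCob`, every closed surface is a polynomial in the parameters. -/
theorem exists_eqSMul_id (s : UCob.Hom 0 0) :
    ∃ P : MvPolynomial (Fin 2) k, ∀ l a₀ : k,
      EqSMul (ClosedRel (geomSeq l a₀) 0 0) s (eval ![l, a₀] P) (UCob.id 0) := by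
  obtain ⟨n, A, F, hA, rfl⟩ := UCob.isNormal s
  rw [UCob.signedSpread]
  clear F
  induction n with
  | zero => exact ⟨1, fun l a₀ => by
      rw [map_one]; exact (UCob.comp_id (UCob.id 0)).symm ▸ EqSMul.refl _⟩
  | succ n ih =>
    obtain ⟨P, hP⟩ := ih (fun i => A i.castSucc) fun i => hA _
    obtain ⟨Q, hQ⟩ := (hA (Fin.last n)).counit_eqSMul (k := k)
    refine ⟨Q * P, fun l a₀ => ?_⟩
    rw [map_mul]
    refine EqSMul.trans ?_ (hP l a₀)
    have h := (EqSMul.comp_left (UCob.states n fun i => A i.castSucc)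
      ((hQ l a₀).whisker n)).comp_right (UCob.counits n)
    have hid : UCob.comp (UCob.states n fun i => A i.castSucc) (UCob.whisker n (UCob.id 0)) =
        UCob.states n fun i => A i.castSucc := by
      rw [UCob.whisker_id]; exact UCob.comp_id _
    rw [hid, UCob.whisker_comp] at h
    rw [UCob.states, UCob.counits_succ]
    simp only [UCob.comp_assoc] at h ⊢
    exact h

end Reduction

/-! ### The field theory of colorings -/

/-- The colors: a free `ℤ/2`-set with `n` orbits. -/
abbrev Color (n : ℕ) : Type := Fin n × Bool

/-- The free involution on the colors. -/
def Color.flip {n : ℕ} (x : Color n) : Color n := (x.1, !x.2)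

@[simp] theorem Color.flip_flip {n : ℕ} (x : Color n) : x.flip.flip = x := by
  simp [Color.flip]

theorem Color.flip_ne {n : ℕ} (x : Color n) : x.flip ≠ x := by
  intro h
  simpa [Color.flip] using congrArg Prod.snd h

namespace Coloring

variable {k : Type*} [Field k] {X : Type*}

/-- The matrix of a map between sets of colorings. -/
def graph [DecidableEq X] {a b : ℕ} (f : (Fin a → X) → (Fin b → X)) :
    Matrix (Fin a → X) (Fin b → X) k :=
  Matrix.of fun x y => if y = f x then 1 else 0

/-- The transposed matrix of a map between sets of colorings. -/
def cograph [DecidableEq X] {a b : ℕ} (f : (Fin b → X) → (Fin a → X)) :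
    Matrix (Fin a → X) (Fin b → X) k :=
  Matrix.of fun x y => if x = f y then 1 else 0

/-- The tensor product of matrices indexed by colorings. -/
def kron {a b c d : ℕ} (M : Matrix (Fin a → X) (Fin b → X) k)
    (N : Matrix (Fin c → X) (Fin d → X) k) :
    Matrix (Fin (a + c) → X) (Fin (b + d) → X) k :=
  Matrix.of fun x y => M (x ∘ Fin.castAdd c) (y ∘ Fin.castAdd d) *
    N (x ∘ Fin.natAdd a) (y ∘ Fin.natAdd b)

/-- Maps of colorings in parallel. -/
def par {a b c d : ℕ} (f : (Fin a → X) → (Fin b → X)) (g : (Fin c → X) → (Fin d → X)) :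
    (Fin (a + c) → X) → (Fin (b + d) → X) :=
  fun x => Fin.append (f (x ∘ Fin.castAdd c)) (g (x ∘ Fin.natAdd a))

theorem eq_append_iff {b d : ℕ} (y : Fin (b + d) → X) (u : Fin b → X) (v : Fin d → X) :
    y = Fin.append u v ↔ y ∘ Fin.castAdd d = u ∧ y ∘ Fin.natAdd b = v := by
  constructor
  · rintro rfl
    exact ⟨funext fun i => by simp, funext fun i => by simp⟩
  · rintro ⟨rfl, rfl⟩
    funext i
    refine Fin.addCases (fun i => ?_) (fun i => ?_) i <;> simp

section

variable {a b c d : ℕ}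

theorem kron_smul_left (r : k) (M : Matrix (Fin a → X) (Fin b → X) k)
    (N : Matrix (Fin c → X) (Fin d → X) k) : kron (r • M) N = r • kron M N := by
  ext x y; simp [kron, mul_assoc]

theorem kron_smul_right (r : k) (M : Matrix (Fin a → X) (Fin b → X) k)
    (N : Matrix (Fin c → X) (Fin d → X) k) : kron M (r • N) = r • kron M N := by
  ext x y; simp [kron, mul_left_comm]

theorem kron_zero_left (N : Matrix (Fin c → X) (Fin d → X) k) :
    kron (0 : Matrix (Fin a → X) (Fin b → X) k) N = 0 := by
  ext x y; simp [kron]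

theorem kron_zero_right (M : Matrix (Fin a → X) (Fin b → X) k) :
    kron M (0 : Matrix (Fin c → X) (Fin d → X) k) = 0 := by
  ext x y; simp [kron]

theorem kron_add_left (M M' : Matrix (Fin a → X) (Fin b → X) k)
    (N : Matrix (Fin c → X) (Fin d → X) k) : kron (M + M') N = kron M N + kron M' N := by
  ext x y; simp [kron, add_mul]

theorem kron_add_right (M : Matrix (Fin a → X) (Fin b → X) k)
    (N N' : Matrix (Fin c → X) (Fin d → X) k) : kron M (N + N') = kron M N + kron M N' := by
  ext x y; simp [kron, mul_add]

theorem kron_mul [Fintype X] {a' b' c' : ℕ} (A : Matrix (Fin a → X) (Fin b → X) k)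
    (B : Matrix (Fin b → X) (Fin c → X) k) (A' : Matrix (Fin a' → X) (Fin b' → X) k)
    (B' : Matrix (Fin b' → X) (Fin c' → X) k) :
    kron (A * B) (A' * B') = kron A A' * kron B B' := by
  ext x y
  simp only [kron, Matrix.of_apply, Matrix.mul_apply, Finset.sum_mul_sum]
  rw [← Fintype.sum_prod_type', ← (Fin.appendEquiv (α := X) b b').sum_comp]
  refine Finset.sum_congr rfl fun z _ => ?_
  have h₁ : Fin.appendEquiv b b' z ∘ Fin.castAdd b' = z.1 := funext fun i => by
    simp [Fin.appendEquiv]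
  have h₂ : Fin.appendEquiv b b' z ∘ Fin.natAdd b = z.2 := funext fun i => by
    simp [Fin.appendEquiv]
  rw [h₁, h₂]; ring

variable [DecidableEq X]

theorem kron_graph (f : (Fin a → X) → (Fin b → X)) (g : (Fin c → X) → (Fin d → X)) :
    kron (graph f : Matrix _ _ k) (graph g) = graph (par f g) := by
  ext x y
  simp only [kron, graph, Matrix.of_apply, par, eq_append_iff, ite_and, mul_ite, mul_one, mul_zero]
  split_ifs <;> simp_all

theorem kron_cograph (f : (Fin b → X) → (Fin a → X)) (g : (Fin d → X) → (Fin c → X)) :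
    kron (cograph f : Matrix _ _ k) (cograph g) = cograph (par f g) := by
  ext x y
  simp only [kron, cograph, Matrix.of_apply, par, eq_append_iff, ite_and, mul_ite, mul_one,
    mul_zero]
  split_ifs <;> simp_all

theorem one_eq_graph : (1 : Matrix (Fin a → X) (Fin a → X) k) = graph fun x => x := by
  ext x y; simp [graph, Matrix.one_apply, eq_comm]

theorem one_eq_cograph : (1 : Matrix (Fin a → X) (Fin a → X) k) = cograph fun x => x := by
  ext x y; simp [cograph, Matrix.one_apply]

variable [Fintype X]

theorem graph_mul_apply (f : (Fin a → X) → (Fin b → X)) (M : Matrix (Fin b → X) (Fin c → X) k)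
    (x : Fin a → X) (y : Fin c → X) : ((graph f : Matrix _ _ k) * M) x y = M (f x) y := by
  simp [graph, Matrix.mul_apply]

theorem mul_cograph_apply (f : (Fin c → X) → (Fin b → X)) (M : Matrix (Fin a → X) (Fin b → X) k)
    (x : Fin a → X) (y : Fin c → X) : (M * (cograph f : Matrix _ _ k)) x y = M x (f y) := by
  simp [cograph, Matrix.mul_apply]

theorem graph_mul_graph (f : (Fin a → X) → (Fin b → X)) (g : (Fin b → X) → (Fin c → X)) :
    (graph f : Matrix (Fin a → X) (Fin b → X) k) * (graph g : Matrix (Fin b → X) (Fin c → X) k) =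
      graph fun x => g (f x) := by
  ext x y
  rw [graph_mul_apply]; rfl

theorem cograph_mul_cograph (f : (Fin b → X) → (Fin a → X)) (g : (Fin c → X) → (Fin b → X)) :
    (cograph f : Matrix (Fin a → X) (Fin b → X) k) *
      (cograph g : Matrix (Fin b → X) (Fin c → X) k) = cograph fun x => f (g x) := by
  ext x y
  rw [mul_cograph_apply]; rfl

end

/-- Both legs of a pair of pants have the same color. -/
def dup (x : Fin 1 → X) : Fin 2 → X := ![x 0, x 0]
def forget (_ : Fin 1 → X) : Fin 0 → X := ![]
def exchange (x : Fin 2 → X) : Fin 2 → X := ![x 1, x 0]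
def reverse {n : ℕ} (x : Fin 1 → Color n) : Fin 1 → Color n := ![(x 0).flip]

theorem exchange_exchange (x : Fin 2 → X) : exchange (exchange x) = x := by
  ext i; fin_cases i <;> rfl

theorem reverse_reverse {n : ℕ} (x : Fin 1 → Color n) : reverse (reverse x) = x := by
  funext i; fin_cases i; simp [reverse]

theorem graph_exchange [DecidableEq X] :
    (graph exchange : Matrix (Fin 2 → X) (Fin 2 → X) k) = cograph exchange := by
  ext x y
  simp only [graph, cograph, Matrix.of_apply]
  congr 1
  exact propext ⟨fun h => by rw [h, exchange_exchange], fun h => by rw [h, exchange_exchange]⟩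

theorem graph_reverse {n : ℕ} :
    (graph reverse : Matrix (Fin 1 → Color n) (Fin 1 → Color n) k) = cograph reverse := by
  ext x y
  simp only [graph, cograph, Matrix.of_apply]
  congr 1
  exact propext ⟨fun h => by rw [h, reverse_reverse], fun h => by rw [h, reverse_reverse]⟩

theorem graph_mul_cograph_apply [DecidableEq X] [Fintype X] {a b c : ℕ}
    (f : (Fin a → X) → (Fin b → X)) (g : (Fin c → X) → (Fin b → X)) (x : Fin a → X)
    (y : Fin c → X) : ((graph f : Matrix (Fin a → X) (Fin b → X) k) *
      (cograph g : Matrix (Fin b → X) (Fin c → X) k)) x y = if f x = g y then 1 else 0 := by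
  rw [graph_mul_apply]; rfl

theorem cograph_mul_graph_apply [DecidableEq X] [Fintype X] {a b : ℕ}
    (f : (Fin 1 → X) → (Fin a → X)) (g : (Fin 1 → X) → (Fin b → X)) (x : Fin a → X)
    (y : Fin b → X) : ((cograph f : Matrix (Fin a → X) (Fin 1 → X) k) *
      (graph g : Matrix (Fin 1 → X) (Fin b → X) k)) x y =
        ∑ z : X, if x = f (fun _ => z) ∧ y = g (fun _ => z) then 1 else 0 := by
  rw [Matrix.mul_apply, ← (Equiv.funUnique (Fin 1) X).symm.sum_comp]
  refine Finset.sum_congr rfl fun z _ => ?_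
  simp only [cograph, graph, Matrix.of_apply, ite_and, ite_mul, one_mul, zero_mul]
  rfl

theorem eq_dup_iff (x : Fin 2 → X) (z : X) : x = dup (fun _ => z) ↔ x 0 = z ∧ x 1 = z := by
  constructor
  · rintro rfl; exact ⟨rfl, rfl⟩
  · rintro ⟨h₀, h₁⟩
    funext i; fin_cases i
    · exact h₀
    · exact h₁

theorem cograph_dup_mul_graph_dup [DecidableEq X] [Fintype X] (x y : Fin 2 → X) :
    ((cograph dup : Matrix (Fin 2 → X) (Fin 1 → X) k) *
      (graph dup : Matrix (Fin 1 → X) (Fin 2 → X) k)) x y =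
        if x 0 = x 1 ∧ y 0 = x 1 ∧ y 1 = x 1 then 1 else 0 := by
  rw [cograph_mul_graph_apply, Finset.sum_eq_single (x 1)]
  · simp only [eq_dup_iff, and_true]
  · intro z _ hz
    rw [if_neg]
    rintro ⟨h, -⟩
    exact hz ((eq_dup_iff x z).1 h).2.symm
  · simp

/-- The value of the field theory on words. -/
noncomputable def evalWord (r : k) (n : ℕ) : {a b : ℕ} → UCobWord a b →
    Matrix (Fin a → Color n) (Fin b → Color n) k
  | _, _, .id _ => 1
  | _, _, .comp f g => evalWord r n f * evalWord r n g
  | _, _, .tensor f g => kron (evalWord r n f) (evalWord r n g)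
  | _, _, .mul => cograph dup
  | _, _, .unit => cograph forget
  | _, _, .comul => r • graph dup
  | _, _, .counit => r⁻¹ • graph forget
  | _, _, .twist => graph exchange
  | _, _, .flip => graph reverse
  | _, _, .crosscap => 0

theorem evalWord_cast (r : k) (n : ℕ) {a b a' b' : ℕ} (ha : a = a') (hb : b = b')
    (w : UCobWord a b) (x : Fin a' → Color n) (y : Fin b' → Color n) :
    evalWord r n (w.cast ha hb) x y = evalWord r n w (x ∘ Fin.cast ha) (y ∘ Fin.cast hb) := by
  subst ha hb; rfl

set_option linter.unusedSimpArgs false in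
-- Apart from the relations involving the crosscap, multiplication is the transposed matrix of the
-- duplication of colors, and comultiplication a multiple of its matrix. Most relations become
-- identities between maps of colorings. The Frobenius relations mix both types, and the relation
-- for two crosscaps uses that the involution on colors is free.
theorem evalWord_rel {r : k} (hr : r ≠ 0) (n : ℕ) {a b : ℕ} {f g : UCobWord a b}
    (h : UCobWord.Rel f g) : evalWord r n f = evalWord r n g := by
  induction h with
  | refl f => rfl
  | symm _ ih => exact ih.symm
  | trans _ _ ih ih' => exact ih.trans ih'
  | comp_congr _ _ ih ih' => simp only [evalWord, ih, ih']
  | tensor_congr _ _ ih ih' => simp only [evalWord, ih, ih']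
  | id_comp f => exact Matrix.one_mul _
  | comp_id f => exact Matrix.mul_one _
  | comp_assoc f g h => exact Matrix.mul_assoc _ _ _
  | tensor_id a b =>
    simp only [evalWord, one_eq_graph, kron_graph]
    congr 1; funext x; exact ((eq_append_iff _ _ _).2 ⟨rfl, rfl⟩).symm
  | interchange f g f' g' => exact kron_mul _ _ _ _
  | tensor_assoc f g h =>
    ext x y
    rw [evalWord_cast]
    simp only [evalWord, kron, Matrix.of_apply, mul_assoc]
    refine congrArg₂ (· * ·) rfl (congrArg₂ (· * ·) rfl (congrArg₂ (evalWord r n h)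
      (funext fun i => congrArg x (Fin.ext ?_)) (funext fun i => congrArg y (Fin.ext ?_)))) <;>
    simp [add_assoc]
  | empty_tensor f =>
    ext x y
    rw [evalWord_cast]
    simp only [evalWord, kron, Matrix.of_apply]
    rw [Subsingleton.elim ((x ∘ Fin.cast (Nat.zero_add _)) ∘ Fin.castAdd _)
      ((y ∘ Fin.cast (Nat.zero_add _)) ∘ Fin.castAdd _),
      Matrix.one_apply_eq, one_mul]
    refine congrArg₂ (evalWord r n f)
      (funext fun i => congrArg x (Fin.ext ?_)) (funext fun i => congrArg y (Fin.ext ?_)) <;> simp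
  | tensor_empty f =>
    ext x y
    simp only [evalWord, kron, Matrix.of_apply]
    rw [Subsingleton.elim (x ∘ Fin.natAdd _) (y ∘ Fin.natAdd _), Matrix.one_apply_eq, mul_one]
    rfl
  | twist_twist =>
    simp only [evalWord, one_eq_graph, kron_graph, kron_smul_left, kron_smul_right,
      graph_mul_graph, Matrix.smul_mul, Matrix.mul_smul, smul_smul]
    refine congrArg graph (funext fun x => funext fun i => ?_)
    fin_cases i <;> rfl
  | braid =>
    simp only [evalWord, one_eq_graph, kron_graph, kron_smul_left, kron_smul_right,
      graph_mul_graph, Matrix.smul_mul, Matrix.mul_smul, smul_smul]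
    refine congrArg graph (funext fun x => funext fun i => ?_)
    fin_cases i <;> rfl
  | unit_twist =>
    simp only [evalWord, one_eq_cograph, graph_exchange, graph_reverse, kron_cograph,
      cograph_mul_cograph]
    refine congrArg cograph (funext fun x => funext fun i => ?_)
    fin_cases i; rfl
  | twist_counit =>
    simp only [evalWord, one_eq_graph, kron_graph, kron_smul_left, kron_smul_right,
      graph_mul_graph, Matrix.smul_mul, Matrix.mul_smul, smul_smul]
    refine congrArg (_ • graph ·) (funext fun x => funext fun i => ?_)
    fin_cases i; rfl
  | mul_twist =>
    simp only [evalWord, one_eq_cograph, graph_exchange, graph_reverse, kron_cograph,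
      cograph_mul_cograph]
    refine congrArg cograph (funext fun x => funext fun i => ?_)
    fin_cases i <;> rfl
  | comul_twist =>
    simp only [evalWord, one_eq_graph, kron_graph, kron_smul_left, kron_smul_right,
      graph_mul_graph, Matrix.smul_mul, Matrix.mul_smul, smul_smul]
    refine congrArg (_ • graph ·) (funext fun x => funext fun i => ?_)
    fin_cases i <;> rfl
  | flip_twist =>
    simp only [evalWord, one_eq_graph, kron_graph, kron_smul_left, kron_smul_right,
      graph_mul_graph, Matrix.smul_mul, Matrix.mul_smul, smul_smul]
    refine congrArg graph (funext fun x => funext fun i => ?_)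
    fin_cases i <;> rfl
  | crosscap_twist =>
    simp only [evalWord, kron_zero_left, kron_zero_right, Matrix.zero_mul]
  | mul_assoc =>
    simp only [evalWord, one_eq_cograph, graph_exchange, graph_reverse, kron_cograph,
      cograph_mul_cograph]
    refine congrArg cograph (funext fun x => funext fun i => ?_)
    fin_cases i <;> rfl
  | comul_assoc =>
    simp only [evalWord, one_eq_graph, kron_graph, kron_smul_left, kron_smul_right,
      graph_mul_graph, Matrix.smul_mul, Matrix.mul_smul, smul_smul]
    refine congrArg (_ • graph ·) (funext fun x => funext fun i => ?_)
    fin_cases i <;> rfl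
  | unit_mul =>
    simp only [evalWord, one_eq_cograph, graph_exchange, graph_reverse, kron_cograph,
      cograph_mul_cograph]
    refine congrArg cograph (funext fun x => funext fun i => ?_)
    fin_cases i; rfl
  | mul_unit =>
    simp only [evalWord, one_eq_cograph, graph_exchange, graph_reverse, kron_cograph,
      cograph_mul_cograph]
    refine congrArg cograph (funext fun x => funext fun i => ?_)
    fin_cases i; rfl
  | counit_comul =>
    simp only [evalWord, one_eq_graph, kron_graph, kron_smul_left, kron_smul_right,
      graph_mul_graph, Matrix.smul_mul, Matrix.mul_smul, smul_smul]
    rw [inv_mul_cancel₀ hr, one_smul]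
    refine congrArg graph (funext fun x => funext fun i => ?_)
    fin_cases i; rfl
  | comul_counit =>
    simp only [evalWord, one_eq_graph, kron_graph, kron_smul_left, kron_smul_right,
      graph_mul_graph, Matrix.smul_mul, Matrix.mul_smul, smul_smul]
    rw [inv_mul_cancel₀ hr, one_smul]
    refine congrArg graph (funext fun x => funext fun i => ?_)
    fin_cases i; rfl
  | mul_comm =>
    simp only [evalWord, one_eq_cograph, graph_exchange, graph_reverse, kron_cograph,
      cograph_mul_cograph]
    refine congrArg cograph (funext fun x => funext fun i => ?_)
    fin_cases i <;> rfl
  | comul_comm =>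
    simp only [evalWord, one_eq_graph, kron_graph, kron_smul_left, kron_smul_right,
      graph_mul_graph, Matrix.smul_mul, Matrix.mul_smul, smul_smul]
    refine congrArg (_ • graph ·) (funext fun x => funext fun i => ?_)
    fin_cases i <;> rfl
  | frobenius_left =>
    -- Both sides of the Frobenius relation are r times the indicator of all four colors being
    -- equal.
    have h : ∀ x y : Fin 2 → Color n, par (fun x : Fin 1 → Color n => x) dup x = par dup (fun x : Fin 1 → Color n => x) y ↔
        (x 0 = x 1 ∧ y 0 = x 1 ∧ y 1 = x 1) := by
      intro x y
      constructor
      · intro h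
        have h₀ : x 0 = y 0 := congrFun h 0
        have h₁ : x 1 = y 0 := congrFun h 1
        have h₂ : x 1 = y 1 := congrFun h 2
        simp_all
      · rintro ⟨h₀, h₁, h₂⟩
        funext i
        fin_cases i
        · exact h₀.trans h₁.symm
        · exact h₁.symm
        · exact h₂.symm
    ext x y
    simp only [evalWord, kron_smul_left, kron_smul_right, Matrix.smul_mul, Matrix.mul_smul,
      Matrix.smul_apply]
    rw [cograph_dup_mul_graph_dup]
    simp only [← h]
    refine congrArg (r • ·) (Eq.trans ?_ (graph_mul_cograph_apply _ _ x y))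
    rw [← kron_graph, ← kron_cograph, ← one_eq_graph, ← one_eq_cograph]
  | frobenius_right =>
    have h : ∀ x y : Fin 2 → Color n, par dup (fun x : Fin 1 → Color n => x) x = par (fun x : Fin 1 → Color n => x) dup y ↔
        (x 0 = x 1 ∧ y 0 = x 1 ∧ y 1 = x 1) := by
      intro x y
      constructor
      · intro h
        have h₀ : x 0 = y 0 := congrFun h 0
        have h₁ : x 0 = y 1 := congrFun h 1
        have h₂ : x 1 = y 1 := congrFun h 2
        simp_all
      · rintro ⟨h₀, h₁, h₂⟩
        funext i
        fin_cases i
        · exact h₀.trans h₁.symm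
        · exact h₀.trans h₂.symm
        · exact h₂.symm
    ext x y
    simp only [evalWord, kron_smul_left, kron_smul_right, Matrix.smul_mul, Matrix.mul_smul,
      Matrix.smul_apply]
    rw [cograph_dup_mul_graph_dup]
    simp only [← h]
    refine congrArg (r • ·) (Eq.trans ?_ (graph_mul_cograph_apply _ _ x y))
    rw [← kron_graph, ← kron_cograph, ← one_eq_graph, ← one_eq_cograph]
  | flip_flip =>
    simp only [evalWord, one_eq_graph, graph_mul_graph, reverse_reverse]
  | flip_mul =>
    simp only [evalWord, one_eq_cograph, graph_exchange, graph_reverse, kron_cograph,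
      cograph_mul_cograph]
    refine congrArg cograph (funext fun x => funext fun i => ?_)
    fin_cases i <;> rfl
  | comul_flip =>
    simp only [evalWord, one_eq_graph, kron_graph, kron_smul_left, kron_smul_right,
      graph_mul_graph, Matrix.smul_mul, Matrix.mul_smul, smul_smul]
    refine congrArg (_ • graph ·) (funext fun x => funext fun i => ?_)
    fin_cases i <;> rfl
  | unit_flip =>
    simp only [evalWord, one_eq_cograph, graph_exchange, graph_reverse, kron_cograph,
      cograph_mul_cograph]
    refine congrArg cograph (funext fun x => funext fun i => ?_)
    fin_cases i
  | flip_counit =>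
    simp only [evalWord, one_eq_graph, kron_graph, kron_smul_left, kron_smul_right,
      graph_mul_graph, Matrix.smul_mul, Matrix.mul_smul, smul_smul]
    refine congrArg (_ • graph ·) (funext fun x => funext fun i => ?_)
    fin_cases i
  | crosscap_flip =>
    simp only [evalWord, kron_zero_left, kron_zero_right, Matrix.zero_mul]
  | two_crosscaps =>
    -- A non-zero term on the left would require a color z with `z.flip = z`.
    have h : ∀ (x : Fin 2 → Color n) (y : Fin 1 → Color n) (z : Color n), x = dup (fun _ => z) →
        ¬ par reverse (fun x : Fin 1 → Color n => x) x = dup y := by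
      rintro x y z rfl h
      have h₀ : z.flip = y 0 := congrFun h 0
      have h₁ : z = y 0 := congrFun h 1
      exact z.flip_ne (h₀.trans h₁.symm)
    simp only [evalWord, kron_zero_left, Matrix.zero_mul, one_eq_graph, kron_graph,
      Matrix.smul_mul, Matrix.mul_smul]
    refine (congrArg (r • ·) ?_).trans (smul_zero r)
    rw [Matrix.mul_assoc]
    ext x y
    rw [Matrix.mul_apply]
    refine Finset.sum_eq_zero fun w _ => ?_
    refine (congrArg₂ (· * ·) (cograph_mul_graph_apply _ _ x w)
      (graph_mul_cograph_apply _ _ w y)).trans ?_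
    rw [Finset.sum_mul]
    refine Finset.sum_eq_zero fun z _ => ?_
    by_cases hw : w = dup (fun _ => z)
    · rw [if_neg (h w y z hw), mul_zero]
    · rw [if_neg (fun h => hw h.2), zero_mul]

end Coloring

/-! ### The field theory on tensor ideals, and its dependence on the number of colors. -/

namespace Coloring

open Polynomial

variable {k : Type*} [Field k]

/-- The value of the field theory on cobordisms. -/
noncomputable def evalHom (r : kˣ) (n : ℕ) {a b : ℕ} (f : UCob.Hom a b) :
    Matrix (Fin a → Color n) (Fin b → Color n) k :=
  Quotient.lift (evalWord (r : k) n) (fun _ _ h => evalWord_rel r.ne_zero n h) f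

section

variable (r : kˣ) (n : ℕ)

theorem evalHom_id (a : ℕ) : evalHom r n (UCob.id a) = 1 := rfl

theorem evalHom_comp {a b c : ℕ} (f : UCob.Hom a b) (g : UCob.Hom b c) :
    evalHom r n (UCob.comp f g) = evalHom r n f * evalHom r n g := by
  induction f using Quotient.ind
  induction g using Quotient.ind
  rfl

theorem evalHom_tensor {a b c d : ℕ} (f : UCob.Hom a b) (g : UCob.Hom c d) :
    evalHom r n (UCob.tensor f g) = kron (evalHom r n f) (evalHom r n g) := by
  induction f using Quotient.ind
  induction g using Quotient.ind
  rfl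

theorem evalHom_mul : evalHom r n UCob.mul = cograph dup := rfl
theorem evalHom_unit : evalHom r n UCob.unit = cograph forget := rfl
theorem evalHom_comul : evalHom r n UCob.comul = (r : k) • graph dup := rfl
theorem evalHom_counit : evalHom r n UCob.counit = (r : k)⁻¹ • graph forget := rfl
theorem evalHom_twist : evalHom r n UCob.twist = graph exchange := rfl
theorem evalHom_flip : evalHom r n UCob.flip = graph reverse := rfl
theorem evalHom_crosscap : evalHom r n UCob.crosscap = 0 := rfl

theorem evalHom_handle : evalHom r n UCob.handle = (r : k) • 1 := by
  rw [UCob.handle, evalHom_comp, evalHom_comul, evalHom_mul, Matrix.smul_mul]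
  congr 1
  ext x y
  rw [graph_mul_cograph_apply, Matrix.one_apply]
  congr 1
  refine propext ⟨fun h => funext fun i => ?_, fun h => by rw [h]⟩
  rw [Subsingleton.elim i 0]
  exact congrFun h 0

theorem evalHom_handlePow (g : ℕ) : evalHom r n (UCob.handlePow g) = (r : k) ^ g • 1 := by
  induction g with
  | zero => rw [UCob.handlePow, evalHom_id, pow_zero, one_smul]
  | succ g ih =>
    rw [UCob.handlePow, evalHom_comp, ih, evalHom_handle, Matrix.smul_mul, Matrix.one_mul,
      smul_smul, pow_succ]

theorem evalHom_cross : evalHom r n UCob.cross = 0 := by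
  rw [UCob.cross, evalHom_comp, evalHom_tensor, evalHom_crosscap, kron_zero_left, Matrix.zero_mul]

/-- Each of the 2n colors contributes r⁻¹ for the sphere and a factor r per handle. Thus n colors up
to the involution realize the parameter α₀ = 2n/r. -/
theorem evalHom_closedOrientable (g : ℕ) : evalHom r n (UCob.closedOrientable g) =
    ((r : k) ^ g * (r : k)⁻¹ * (2 * n)) • 1 := by
  simp only [UCob.closedOrientable, evalHom_comp, evalHom_handlePow, evalHom_unit, evalHom_counit,
    Matrix.mul_smul, Matrix.smul_mul, Matrix.mul_one, smul_smul]
  rw [mul_comm (r : k)⁻¹, mul_smul (_ * _)]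
  congr 1
  ext x y
  rw [cograph_mul_graph_apply]
  simp only [Subsingleton.elim x y, Subsingleton.elim (forget _) y, and_self, if_true,
    Matrix.smul_apply, Matrix.one_apply_eq]
  simp [mul_comm]

theorem evalHom_closedOneCross (g : ℕ) : evalHom r n (UCob.closedOneCross g) = 0 := by
  simp [UCob.closedOneCross, evalHom_comp, evalHom_cross]

theorem evalHom_closedTwoCross (g : ℕ) : evalHom r n (UCob.closedTwoCross g) = 0 := by
  simp [UCob.closedTwoCross, evalHom_comp, evalHom_cross]

/-- The linear extension of the field theory. -/
noncomputable def evalLin {a b : ℕ} :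
    UCobLin k a b →ₗ[k] Matrix (Fin a → Color n) (Fin b → Color n) k :=
  Finsupp.linearCombination k (evalHom r n)

theorem evalLin_of {a b : ℕ} (f : UCob.Hom a b) : evalLin r n (UCobLin.of f) = evalHom r n f := by
  simp [evalLin, UCobLin.of]

theorem evalLin_comp {a b c : ℕ} (f : UCobLin k a b) (g : UCobLin k b c) :
    evalLin r n (UCobLin.comp f g) = evalLin r n f * evalLin r n g := by
  have e {a b : ℕ} (f : UCob.Hom a b) (r : k) : Finsupp.single f r = r • UCobLin.of f := by
    simp [UCobLin.of]
  induction f using Finsupp.induction_linear with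
  | zero => simp
  | add f f' hf hf' => simp only [map_add, LinearMap.add_apply, hf, hf', Matrix.add_mul]
  | single f s =>
    induction g using Finsupp.induction_linear with
    | zero => simp
    | add g g' hg hg' => simp only [map_add, hg, hg', Matrix.mul_add]
    | single g t =>
      simp only [e, map_smul, LinearMap.smul_apply, UCobLin.comp_of_of, evalLin_of, evalHom_comp,
        Matrix.smul_mul, Matrix.mul_smul]

theorem evalLin_tensor {a b c d : ℕ} (f : UCobLin k a b) (g : UCobLin k c d) :
    evalLin r n (UCobLin.tensor f g) = kron (evalLin r n f) (evalLin r n g) := by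
  have e {a b : ℕ} (f : UCob.Hom a b) (r : k) : Finsupp.single f r = r • UCobLin.of f := by
    simp [UCobLin.of]
  induction f using Finsupp.induction_linear with
  | zero => simp [kron_zero_left]
  | add f f' hf hf' => simp only [map_add, LinearMap.add_apply, hf, hf', kron_add_left]
  | single f s =>
    induction g using Finsupp.induction_linear with
    | zero => simp [kron_zero_right]
    | add g g' hg hg' => simp only [map_add, hg, hg', kron_add_right]
    | single g t =>
      simp only [e, map_smul, LinearMap.smul_apply, UCobLin.tensor_of_of, evalLin_of,
        evalHom_tensor, kron_smul_left, kron_smul_right]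

end

/-- The families of matrices, indexed by the number of colors, which are combinations of values of
the field theory with coefficients polynomial in the number of colors. -/
def polyFamilies (r : kˣ) (a b : ℕ) :
    Submodule k (∀ n : ℕ, Matrix (Fin a → Color n) (Fin b → Color n) k) :=
  Submodule.span k {M | ∃ (p : k[X]) (f : UCob.Hom a b), 
    M = fun n : ℕ => p.eval (n : k) • evalHom r n f}

section

variable {r : kˣ} {a b c d : ℕ}

theorem smul_mem_polyFamilies (p : k[X])
    {M : ∀ n : ℕ, Matrix (Fin a → Color n) (Fin b → Color n) k} (hM : M ∈ polyFamilies r a b) :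
    (fun n : ℕ => p.eval (n : k) • M n) ∈ polyFamilies r a b := by
  induction hM using Submodule.span_induction with
  | mem M hM =>
    obtain ⟨q, f, rfl⟩ := hM
    refine Submodule.subset_span ⟨p * q, f, funext fun n => ?_⟩
    rw [eval_mul, mul_smul]
  | zero =>
    convert (polyFamilies r a b).zero_mem using 1
    funext n; exact smul_zero _
  | add M N _ _ hM hN =>
    convert (polyFamilies r a b).add_mem hM hN using 1
    funext n; exact smul_add _ _ _
  | smul s M _ hM =>
    convert (polyFamilies r a b).smul_mem s hM using 1
    funext n; exact smul_comm (p.eval (n : k)) s (M n)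

theorem evalLin_mem_polyFamilies (f : UCobLin k a b) :
    (fun n => evalLin r n f) ∈ polyFamilies r a b := by
  induction f using Finsupp.induction_linear with
  | zero =>
    convert (polyFamilies r a b).zero_mem using 1
    funext n; exact map_zero _
  | add f g hf hg =>
    convert (polyFamilies r a b).add_mem hf hg using 1
    funext n; exact map_add _ _ _
  | single f s =>
    refine Submodule.subset_span ⟨C s, f, funext fun n => ?_⟩
    simp [evalLin]

theorem map_mem_polyFamilies
    (Θ : ∀ n : ℕ, Matrix (Fin a → Color n) (Fin b → Color n) k →ₗ[k]
      Matrix (Fin c → Color n) (Fin d → Color n) k)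
    (hΘ : ∀ f : UCob.Hom a b, (fun n => Θ n (evalHom r n f)) ∈ polyFamilies r c d)
    {M : ∀ n : ℕ, Matrix (Fin a → Color n) (Fin b → Color n) k} (hM : M ∈ polyFamilies r a b) :
    (fun n => Θ n (M n)) ∈ polyFamilies r c d := by
  induction hM using Submodule.span_induction with
  | mem M hM =>
    obtain ⟨q, f, rfl⟩ := hM
    convert smul_mem_polyFamilies q (hΘ f) using 1
    funext n; exact (Θ n).map_smul _ _
  | zero =>
    convert (polyFamilies r c d).zero_mem using 1
    funext n; exact map_zero _
  | add M N _ _ hM hN =>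
    convert (polyFamilies r c d).add_mem hM hN using 1
    funext n; exact map_add _ _ _
  | smul s M _ hM =>
    convert (polyFamilies r c d).smul_mem s hM using 1
    funext n; exact (Θ n).map_smul s (M n)

/-- Comparison with a₀ / (1 - rT) shows that every representing fraction has q(1/r) = 0. The handle
polynomial acts by r^K q(1/r). -/
theorem eval_handlePolynomial {a₀ : k} (ha₀ : a₀ ≠ 0) {p q : k[X]}
    (h : IsGeneratingFraction (geomSeq (r : k) a₀) p q) (n : ℕ) :
    evalLin r n (handlePolynomial p q) = 0 := by
  have h₁ : p * (1 - C (r : k) * X) = C a₀ * q := by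
    have h₂ := (isGeneratingFraction_geomSeq (r : k) ha₀).2.2
    have h₃ : ((p * (1 - C (r : k) * X) : k[X]) : PowerSeries k) = ((C a₀ * q : k[X]) :
        PowerSeries k) := by
      rw [coe_mul, coe_mul, ← h.2.2, ← h₂]; ring
    exact_mod_cast h₃
  have h₂ : q.eval (r : k)⁻¹ = 0 := by
    have h₃ := congrArg (eval (r : k)⁻¹) h₁
    simp only [eval_mul, eval_sub, eval_one, eval_C, eval_X, mul_inv_cancel₀ r.ne_zero, sub_self,
      mul_zero] at h₃
    exact (mul_eq_zero.1 h₃.symm).resolve_left ha₀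
  rw [handlePolynomial, map_sum]
  simp only [map_smul, evalLin_of, evalHom_handlePow, smul_smul, ← Finset.sum_smul]
  rw [eval_eq_sum_range] at h₂
  have h₃ : ∑ i ∈ Finset.range (q.natDegree + 1),
      q.coeff i * (r : k) ^ (max (p.natDegree + 1) q.natDegree - i) = 0 := by
    rw [← mul_zero ((r : k) ^ max (p.natDegree + 1) q.natDegree), ← h₂, Finset.mul_sum]
    refine Finset.sum_congr rfl fun i hi => ?_
    have hi' : i ≤ max (p.natDegree + 1) q.natDegree :=
      (Nat.lt_succ_iff.1 (Finset.mem_range.1 hi)).trans (le_max_right _ _)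
    rw [pow_sub₀ _ r.ne_zero hi', inv_pow]; ring
  rw [h₃, zero_smul]

/-- The value of the field theory on elements of the tensor ideal of `SOCob` vanishes to first
order at the parameter `2 * n = r * a₀`. -/
theorem exists_evalLin_eq_smul {a₀ : k} (ha₀ : a₀ ≠ 0) {f : UCobLin k a b}
    (hf : UCobLin.MemIdeal (OrientableRel (geomSeq (r : k) a₀)) f) :
    ∃ M ∈ polyFamilies r a b, ∀ n : ℕ, evalLin r n f = (2 * (n : k) - r * a₀) • M n := by
  have hzero : ∀ {a b : ℕ} {f : UCobLin k a b}, (∀ n, evalLin r n f = 0) →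
      ∃ M ∈ polyFamilies r a b, ∀ n : ℕ, evalLin r n f = (2 * (n : k) - r * a₀) • M n :=
    fun h => ⟨0, Submodule.zero_mem _, fun n => by
      rw [h n]; exact (smul_zero _).symm⟩
  induction hf with
  | of_mem h =>
    cases h with
    | skein h =>
      cases h with
      | closed h =>
        cases h with
        | orientable g =>
          -- The relation takes the value r^g (2n/r - a₀) = r^(g-1) (2n - r a₀). It is the only
          -- generator with a non-zero value.
          refine ⟨fun n => evalLin r n (((r : k) ^ g * (r : k)⁻¹) • UCobLin.of (UCob.id 0)),
            evalLin_mem_polyFamilies _, fun n => ?_⟩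
          have := r.ne_zero
          rw [map_sub, map_smul, evalLin_of, evalLin_of, evalHom_closedOrientable,
            evalHom_id, ← sub_smul, geomSeq]
          simp only [map_smul, evalLin_of, evalHom_id, smul_smul]
          congr 1
          field_simp
        | oneCross g =>
          refine hzero fun n => ?_
          rw [map_sub, map_smul, evalLin_of, evalHom_closedOneCross]
          simp
        | twoCross g =>
          refine hzero fun n => ?_
          rw [map_sub, map_smul, evalLin_of, evalHom_closedTwoCross]
          simp
      | handle h => exact hzero fun n => eval_handlePolynomial ha₀ h n
    | crosscap => exact hzero fun n => by rw [evalLin_of, evalHom_crosscap]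
  | zero => exact hzero fun n => map_zero _
  | add _ _ ihf ihg =>
    obtain ⟨M, hM, h⟩ := ihf
    obtain ⟨N, hN, h'⟩ := ihg
    exact ⟨M + N, Submodule.add_mem _ hM hN, fun n => by
      rw [map_add, h, h', Pi.add_apply, smul_add]⟩
  | smul s _ ih =>
    obtain ⟨M, hM, h⟩ := ih
    exact ⟨s • M, Submodule.smul_mem _ s hM, fun n => by
      rw [map_smul, h, Pi.smul_apply, smul_comm]⟩
  | @comp_right a b c f g _ ih =>
    obtain ⟨M, hM, h⟩ := ih
    refine ⟨fun n => M n * evalLin r n g, map_mem_polyFamilies (fun n =>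
      { toFun := fun N => N * evalLin r n g
        map_add' := fun _ _ => Matrix.add_mul _ _ _
        map_smul' := fun _ _ => Matrix.smul_mul _ _ _ }) (fun f => ?_) hM, fun n => ?_⟩
    · convert evalLin_mem_polyFamilies (r := r) (UCobLin.comp (UCobLin.of f) g) using 1
      funext n; rw [evalLin_comp, evalLin_of]; rfl
    · rw [evalLin_comp, h, Matrix.smul_mul]
  | @comp_left a b c g f _ ih =>
    obtain ⟨M, hM, h⟩ := ih
    refine ⟨fun n => evalLin r n g * M n, map_mem_polyFamilies (fun n =>
      { toFun := fun N => evalLin r n g * N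
        map_add' := fun _ _ => Matrix.mul_add _ _ _
        map_smul' := fun _ _ => Matrix.mul_smul _ _ _ }) (fun f => ?_) hM, fun n => ?_⟩
    · convert evalLin_mem_polyFamilies (r := r) (UCobLin.comp g (UCobLin.of f)) using 1
      funext n; rw [evalLin_comp, evalLin_of]; rfl
    · rw [evalLin_comp, h, Matrix.mul_smul]
  | @tensor_right a b c d f g _ ih =>
    obtain ⟨M, hM, h⟩ := ih
    refine ⟨fun n => kron (M n) (evalLin r n g), map_mem_polyFamilies (fun n =>
      { toFun := fun N => kron N (evalLin r n g)
        map_add' := fun _ _ => kron_add_left _ _ _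
        map_smul' := fun _ _ => kron_smul_left _ _ _ }) (fun f => ?_) hM, fun n => ?_⟩
    · convert evalLin_mem_polyFamilies (r := r) (UCobLin.tensor (UCobLin.of f) g) using 1
      funext n; rw [evalLin_tensor, evalLin_of]; rfl
    · rw [evalLin_tensor, h, kron_smul_left]
  | @tensor_left a b c d g f _ ih =>
    obtain ⟨M, hM, h⟩ := ih
    refine ⟨fun n => kron (evalLin r n g) (M n), map_mem_polyFamilies (fun n =>
      { toFun := fun N => kron (evalLin r n g) N
        map_add' := fun _ _ => kron_add_right _ _ _
        map_smul' := fun _ _ => kron_smul_right _ _ _ }) (fun f => ?_) hM, fun n => ?_⟩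
    · convert evalLin_mem_polyFamilies (r := r) (UCobLin.tensor g (UCobLin.of f)) using 1
      funext n; rw [evalLin_tensor, evalLin_of]; rfl
    · rw [evalLin_tensor, h, kron_smul_right]

variable [CharZero k]

/-- At a₀ = 2n/r the factor 2n - r a₀ vanishes, so the field theory factors through `SOCob`. The
case n = 0 is excluded since there a₀ would be zero. -/
theorem evalHom_eq_smul_of_eqSMul {n : ℕ} (hn : n ≠ 0) {f g : UCob.Hom a b} {s : k}
    (h : UCobLin.EqSMul (OrientableRel (geomSeq (r : k) ((r : k)⁻¹ * (2 * n)))) f s g) :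
    evalHom r n f = s • evalHom r n g := by
  have h₀ : (r : k)⁻¹ * (2 * n) ≠ 0 :=
    mul_ne_zero (inv_ne_zero r.ne_zero) (mul_ne_zero two_ne_zero (Nat.cast_ne_zero.2 hn))
  obtain ⟨M, -, hM⟩ := exists_evalLin_eq_smul h₀ h
  have := hM n
  rw [mul_inv_cancel_left₀ r.ne_zero, sub_self, zero_smul, map_sub, map_smul, evalLin_of,
    evalLin_of, sub_eq_zero] at this
  exact this

/-- For each n, cobordisms can be reduced to the spanning set in the category `SOCob` with parameter
2n/r. The coefficients come from polynomials in the parameters, hence are polynomial in n. -/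
theorem exists_coeffs_of_mem_polyFamilies {m : ℕ}
    {M : ∀ n : ℕ, Matrix (Fin 0 → Color n) (Fin m → Color n) k} (hM : M ∈ polyFamilies r 0 m) :
    ∃ Q : UCob.spanningSet m → k[X], ∀ n : ℕ, n ≠ 0 →
      M n = ∑ c, (Q c).eval (n : k) • evalHom r n c.1 := by
  classical
  induction hM using Submodule.span_induction with
  | mem M hM =>
    obtain ⟨q, f, rfl⟩ := hM
    obtain ⟨P, c, hc, hP⟩ := exists_eqSMul_spanningSet (k := k) f
    -- The substitution λ = r, α₀ = (2/r) X turns the coefficient into a polynomial in the number n.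
    refine ⟨Pi.single ⟨c, hc⟩
      (q * MvPolynomial.aeval ![C (r : k), C ((r : k)⁻¹ * 2) * X] P), fun n hn => ?_⟩
    have h₀ : (r : k)⁻¹ * (2 * n) ≠ 0 :=
      mul_ne_zero (inv_ne_zero r.ne_zero) (mul_ne_zero two_ne_zero (Nat.cast_ne_zero.2 hn))
    change q.eval (n : k) • evalHom r n f = _
    rw [Finset.sum_eq_single ⟨c, hc⟩ (fun d _ hd => by rw [Pi.single_eq_of_ne hd]; simp) (by simp),
      Pi.single_eq_same, evalHom_eq_smul_of_eqSMul hn (hP r _ r.ne_zero h₀), smul_smul, eval_mul]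
    congr 2
    have h₁ : (Polynomial.evalRingHom (n : k)).comp (MvPolynomial.aeval
        ![C (r : k), C ((r : k)⁻¹ * 2) * X] : MvPolynomial (Fin 2) k →ₐ[k] k[X]).toRingHom =
          MvPolynomial.eval ![(r : k), (r : k)⁻¹ * (2 * n)] := by
      refine MvPolynomial.ringHom_ext (fun s => by simp) fun i => ?_
      fin_cases i
      · simp
      · simp [mul_assoc]
    exact (RingHom.congr_fun h₁ P).symm
  | zero => exact ⟨0, fun n _ => by simp⟩
  | add M N _ _ hM hN =>
    obtain ⟨Q, hQ⟩ := hM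
    obtain ⟨Q', hQ'⟩ := hN
    exact ⟨Q + Q', fun n hn => by
      simp only [Pi.add_apply, hQ n hn, hQ' n hn, eval_add, add_smul, Finset.sum_add_distrib]⟩
  | smul s M _ hM =>
    obtain ⟨Q, hQ⟩ := hM
    exact ⟨fun c => C s * Q c, fun n hn => by
      simp only [Pi.smul_apply, hQ n hn, eval_mul, eval_C, mul_smul, Finset.smul_sum]⟩

end

end Coloring

/-! ### Values of the field theory on the spanning set -/

namespace Coloring

variable {k : Type*} [Field k] {X : Type*}

theorem append_one {l : ℕ} (u : Fin l → X) (v : Fin 1 → X) :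
    Fin.append u v = Fin.snoc (α := fun _ => X) u (v 0) := by
  funext i
  refine Fin.lastCases ?_ (fun i => ?_) i
  · rw [Fin.snoc_last]; exact Fin.append_right u v 0
  · rw [Fin.snoc_castSucc]; exact Fin.append_left u v i

theorem append_two {l : ℕ} (u : Fin l → X) (v : Fin 2 → X) :
    Fin.append u v = Fin.snoc (α := fun _ => X) (Fin.snoc (α := fun _ => X) u (v 0)) (v 1) := by
  funext i
  refine Fin.lastCases ?_ (fun i => Fin.lastCases ?_ (fun i => ?_) i) i
  · rw [Fin.snoc_last]; exact Fin.append_right u v 1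
  · rw [Fin.snoc_castSucc, Fin.snoc_last]; exact Fin.append_right u v 0
  · rw [Fin.snoc_castSucc, Fin.snoc_castSucc]; exact Fin.append_left u v i

theorem par_id_one {a b : ℕ} (f : (Fin a → X) → (Fin b → X)) (x : Fin (a + 1) → X) :
    par f (fun y : Fin 1 → X => y) x =
      Fin.snoc (α := fun _ => X) (f fun i => x i.castSucc) (x (Fin.last a)) :=
  append_one _ _

/-- The color of a circle joined by a cylinder to a circle of color `x`. -/
def act {n : ℕ} (e : Bool) (x : Color n) : Color n := (x.1, xor e x.2)

theorem act_act {n : ℕ} (e e' : Bool) (x : Color n) : act e (act e' x) = act (xor e e') x := by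
  simp [act]

@[simp] theorem act_false {n : ℕ} (x : Color n) : act false x = x := by simp [act]

section

variable (r : kˣ) (n : ℕ)

theorem evalHom_addStrand {a b : ℕ} (f : UCob.Hom a b) (s : k)
    (h : (Fin a → Color n) → (Fin b → Color n)) (hf : evalHom r n f = s • graph h) :
    evalHom r n (UCob.addStrand f) = s • graph fun x =>
      Fin.snoc (α := fun _ => Color n) (h fun i => x i.castSucc) (x (Fin.last a)) := by
  rw [UCob.addStrand, evalHom_tensor, hf, evalHom_id, one_eq_graph, kron_smul_left, kron_graph]
  exact congrArg (s • graph ·) (funext fun x => par_id_one h x)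

theorem evalHom_comulAt (l : ℕ) : evalHom r n (UCob.comulAt l) = (r : k) • graph fun x =>
    Fin.snoc (α := fun _ => Color n) x (x (Fin.last l)) := by
  rw [UCob.comulAt, UCob.whisker, evalHom_tensor, evalHom_id, one_eq_graph, evalHom_comul,
    kron_smul_right, kron_graph]
  refine congrArg ((r : k) • graph ·) (funext fun x => ?_)
  refine (append_two _ _).trans ?_
  congr 1
  exact Fin.snoc_init_self x

theorem evalHom_twistAt (l : ℕ) : evalHom r n (UCob.twistAt l) = graph fun x =>
    Fin.snoc (α := fun _ => Color n) (Fin.snoc (α := fun _ => Color n)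
      (fun i => x i.castSucc.castSucc) (x (Fin.last _))) (x (Fin.last l).castSucc) := by
  rw [UCob.twistAt, UCob.whisker, evalHom_tensor, evalHom_id, one_eq_graph, evalHom_twist,
    kron_graph]
  exact congrArg graph (funext fun x => append_two _ _)

theorem evalHom_flipIf (e : Bool) (l : ℕ) : evalHom r n (UCob.flipIf e l) = graph fun x =>
    Fin.snoc (α := fun _ => Color n) (fun i => x i.castSucc) (act e (x (Fin.last l))) := by
  cases e with
  | false =>
    rw [UCob.flipIf_false, evalHom_id, one_eq_graph]
    refine congrArg graph (funext fun x => ?_)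
    rw [act_false]
    exact (Fin.snoc_init_self x).symm
  | true =>
    rw [UCob.flipIf_true, UCob.flipAt, UCob.whisker, evalHom_tensor, evalHom_id, one_eq_graph,
      evalHom_flip, kron_graph]
    refine congrArg graph (funext fun x => (append_one _ _).trans ?_)
    congr 1
    simp only [act, reverse, Color.flip, Bool.true_xor]
    rfl

theorem evalHom_counits (l : ℕ) : evalHom r n (UCob.counits l) =
    ((r : k)⁻¹) ^ l • graph fun _ => Fin.elim0 := by
  induction l with
  | zero =>
    rw [UCob.counits, evalHom_id, one_eq_graph, pow_zero, one_smul]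
    exact congrArg graph (funext fun x => Subsingleton.elim _ _)
  | succ l ih =>
    rw [UCob.counits, evalHom_tensor, ih, evalHom_counit, kron_smul_left, kron_smul_right,
      kron_graph, smul_smul, pow_succ]
    exact congrArg (_ • graph ·) (funext fun x => Subsingleton.elim (α := Fin 0 → Color n) _ _)

theorem evalHom_splitOff {l : ℕ} (j : Fin l) : evalHom r n (UCob.splitOff l j) =
    (r : k) • graph fun x => Fin.snoc (α := fun _ => Color n) x (x j) := by
  induction l with
  | zero => exact j.elim0
  | succ l ih =>
    refine Fin.lastCases ?_ (fun j => ?_) j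
    · rw [UCob.splitOff_last, evalHom_comulAt]
    · rw [UCob.splitOff_castSucc, evalHom_comp, evalHom_addStrand r n _ _ _ (ih j),
        evalHom_twistAt, Matrix.smul_mul, graph_mul_graph]
      refine congrArg ((r : k) • graph ·) (funext fun x => ?_)
      simp only [Fin.snoc_last, Fin.snoc_castSucc]
      congr 1
      exact Fin.snoc_init_self x

theorem evalHom_signedSpread {l m : ℕ} (F : Fin m → Fin l × Bool) :
    evalHom r n (UCob.signedSpread m F) =
      ((r : k) ^ m * ((r : k)⁻¹) ^ l) • graph fun z i => act (F i).2 (z (F i).1) := by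
  induction m with
  | zero =>
    rw [UCob.signedSpread, evalHom_counits, pow_zero, one_mul]
    exact congrArg (_ • graph ·) (funext fun x => Subsingleton.elim _ _)
  | succ m ih =>
    rw [UCob.signedSpread, evalHom_comp, evalHom_comp, evalHom_splitOff,
      evalHom_addStrand r n _ _ _ (ih _), evalHom_flipIf]
    simp only [Matrix.smul_mul, Matrix.mul_smul, graph_mul_graph, smul_smul]
    congr 1
    · ring
    · refine congrArg graph (funext fun x => funext fun i => ?_)
      refine Fin.lastCases ?_ (fun i => ?_) i <;> simp

theorem evalHom_units (l : ℕ) : evalHom r n (UCob.units l) = cograph fun _ => Fin.elim0 := by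
  induction l with
  | zero =>
    rw [UCob.units, evalHom_id, one_eq_cograph]
    exact congrArg cograph (funext fun x => Subsingleton.elim _ _)
  | succ l ih =>
    rw [UCob.units, evalHom_tensor, ih, evalHom_unit, kron_cograph]
    exact congrArg cograph (funext fun x => Subsingleton.elim (α := Fin 0 → Color n) _ _)

end

/-- The coloring `x` of the outgoing circles extends to the components. -/
def Compatible {l m n : ℕ} (F : Fin m → Fin l × Bool) (x : Fin m → Color n) : Prop :=
  ∃ z : Fin l → Color n, ∀ i, x i = act (F i).2 (z (F i).1)

open Classical in
-- By surjectivity the colors of the outgoing circles determine those of the components, so at most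
-- one term of the matrix product survives. Its weight is r for each splitting and r⁻¹ for each
-- final counit.
theorem evalHom_signedCob (r : kˣ) (n : ℕ) {l m : ℕ} {F : Fin m → Fin l × Bool}
    (hF : Function.Surjective fun i => (F i).1) (o : Fin 0 → Color n) (x : Fin m → Color n) :
    evalHom r n (UCob.signedCob F) o x =
      if Compatible F x then (r : k) ^ m * ((r : k)⁻¹) ^ l else 0 := by
  rw [UCob.signedCob, evalHom_comp, evalHom_units, evalHom_signedSpread, Matrix.mul_smul,
    Matrix.smul_apply, Matrix.mul_apply]
  have ho : ∀ z : Fin l → Color n, (cograph (fun _ : Fin l → Color n => Fin.elim0) :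
      Matrix (Fin 0 → Color n) (Fin l → Color n) k) o z = 1 := fun z => by
    rw [cograph, Matrix.of_apply, if_pos (Subsingleton.elim _ _)]
  simp only [ho, one_mul, graph, Matrix.of_apply]
  by_cases h : Compatible F x
  · obtain ⟨z, hz⟩ := h
    rw [if_pos ⟨z, hz⟩, Finset.sum_eq_single z, if_pos (funext hz), smul_eq_mul, mul_one]
    · intro w _ hw
      rw [if_neg]
      intro h
      refine hw (funext fun j => ?_)
      obtain ⟨i, rfl⟩ := hF j
      have := (hz i).symm.trans (congrFun h i)
      have h' := congrArg (act (F i).2) this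
      simpa [act_act] using h'.symm
    · simp
  · rw [if_neg h, Finset.sum_eq_zero, smul_zero]
    intro z _
    rw [if_neg]
    intro hz
    exact h ⟨z, congrFun hz⟩

/-- A coloring which distinguishes the components. -/
def testColoring {l m : ℕ} (n : ℕ) (h : l ≤ n) (F : Fin m → Fin l × Bool) : Fin m → Color n :=
  fun i => act (F i).2 (Fin.castLE h (F i).1, false)

theorem compatible_testColoring {l m n : ℕ} (h : l ≤ n) (F : Fin m → Fin l × Bool) :
    Compatible F (testColoring n h F) := ⟨fun j => (Fin.castLE h j, false), fun _ => rfl⟩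

/-- If a coloring distinguishing the components of a surface extends to another surface with at
most as many components, the surfaces agree. -/
theorem eq_of_compatible_testColoring {l l' m n : ℕ} (h : l ≤ n) {F : Fin m → Fin l × Bool}
    {F' : Fin m → Fin l' × Bool} (hF : Function.Surjective fun i => (F i).1)
    (hF' : Function.Surjective fun i => (F' i).1) (hl : l' ≤ l)
    (hc : Compatible F' (testColoring n h F)) : UCob.signedCob F = UCob.signedCob F' := by
  obtain ⟨z, hz⟩ := hc
  have h₁ : ∀ i, Fin.castLE h (F i).1 = (z (F' i).1).1 := fun i => congrArg Prod.fst (hz i)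
  have h₂ : ∀ i, (F i).2 = xor (F' i).2 (z (F' i).1).2 := fun i => by
    simpa [testColoring, act] using congrArg Prod.snd (hz i)
  have hlt : ∀ j, (z j).1.val < l := fun j => by
    obtain ⟨i, rfl⟩ := hF' j
    have := congrArg Fin.val (h₁ i)
    simp only [Fin.val_castLE] at this
    rw [← this]
    exact (F i).1.is_lt
  let π : Fin l' → Fin l := fun j => ⟨(z j).1.val, hlt j⟩
  have hπ : ∀ i, (F i).1 = π (F' i).1 := fun i => by
    have := Fin.ext_iff.1 (h₁ i)
    exact Fin.ext this
  have hsurj : Function.Surjective π := fun j => by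
    obtain ⟨i, rfl⟩ := hF j
    exact ⟨(F' i).1, (hπ i).symm⟩
  -- Surjectivity of π gives the missing inequality; then π is a permutation, and with the signs of
  -- z it relates the two signed surjections.
  obtain rfl : l' = l := le_antisymm hl (by simpa using Fintype.card_le_of_surjective π hsurj)
  have := UCob.signedCob_symm (Equiv.ofBijective π (Finite.injective_iff_bijective.1
    (Finite.injective_iff_surjective.2 hsurj))) (fun j => (z j).2) F'
  rw [← this]
  congr 1
  funext i
  refine Prod.ext (hπ i) ?_
  rw [h₂, Bool.xor_comm]

/-- The number of components, for elements of the spanning set. -/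
theorem exists_signedCob {m : ℕ} (c : UCob.spanningSet m) :
    ∃ (l : ℕ) (F : Fin m → Fin l × Bool), (Function.Surjective fun i => (F i).1) ∧
      UCob.signedCob F = c.1 := UCob.mem_spanningSet.1 c.2

/-- Among the cobordisms with non-zero coefficient take one with the most components. Its test
coloring is compatible with no other one of them, so evaluating there isolates its coefficient.
Having n ≥ m guarantees enough colors. -/
theorem eq_zero_of_sum_evalHom_eq_zero (r : kˣ) {n m : ℕ} (hn : m ≤ n)
    (s : UCob.spanningSet m → k) (hs : ∑ c, s c • evalHom r n c.1 = 0) : s = 0 := by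
  classical
  choose l F hF hFc using exists_signedCob (m := m)
  have hl : ∀ c, l c ≤ n := fun c =>
    (by simpa using Fintype.card_le_of_surjective _ (hF c) : l c ≤ m).trans hn
  by_contra hne
  obtain ⟨c₀, hc₀⟩ := Function.ne_iff.1 hne
  obtain ⟨c, hc, hmax⟩ := (Finset.univ.filter fun c => s c ≠ 0).exists_max_image l
    ⟨c₀, by simpa using hc₀⟩
  have hc' : s c ≠ 0 := by simpa using hc
  have h := congrFun (congrFun hs Fin.elim0) (testColoring n (hl c) (F c))
  rw [Matrix.sum_apply, Finset.sum_eq_single c] at h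
  · rw [Matrix.smul_apply, ← hFc c, evalHom_signedCob r n (hF c),
      if_pos (compatible_testColoring _ _)] at h
    have := r.ne_zero
    simp [hc'] at h
  · intro d _ hd
    rw [Matrix.smul_apply]
    by_cases hsd : s d = 0
    · rw [hsd, zero_smul]
    rw [← hFc d, evalHom_signedCob r n (hF d), if_neg, smul_zero]
    intro hcomp
    refine hd (Subtype.ext ?_)
    rw [← hFc d, ← hFc c]
    exact (eq_of_compatible_testColoring (hl c) (hF c) (hF d)
      (hmax d (by simpa using hsd)) hcomp).symm
  · simp

/-- The spanning set is linearly independent in `SOCob`. -/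
theorem eq_zero_of_memIdeal [CharZero k] (r : kˣ) {a₀ : k} (ha₀ : a₀ ≠ 0) {m : ℕ}
    (s : UCob.spanningSet m → k)
    (hs : UCobLin.MemIdeal (OrientableRel (geomSeq (r : k) a₀))
      (∑ c, s c • UCobLin.of c.1)) : s = 0 := by
  obtain ⟨M, hM, h⟩ := exists_evalLin_eq_smul ha₀ hs
  obtain ⟨Q, hQ⟩ := exists_coeffs_of_mem_polyFamilies hM
  -- The bound ensures both n ≠ 0, for the expansion of M, and n ≥ m, for independence of the
  -- values.
  have key : ∀ n : ℕ, m + 1 ≤ n → ∀ c, s c = (2 * (n : k) - r * a₀) * (Q c).eval (n : k) := by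
    intro n hn c
    have h₁ := h n
    rw [hQ n (by omega), map_sum, Finset.smul_sum, ← sub_eq_zero, ← Finset.sum_sub_distrib] at h₁
    simp only [map_smul, evalLin_of, smul_smul, ← sub_smul] at h₁
    have := eq_zero_of_sum_evalHom_eq_zero r (by omega : m ≤ n) _ h₁
    exact sub_eq_zero.1 (congrFun this c)
  funext c
  have hp : Polynomial.C (s c) =
      (2 * Polynomial.X - Polynomial.C ((r : k) * a₀)) * Q c := by
    refine Polynomial.eq_of_infinite_eval_eq _ _ ?_
    refine Set.Infinite.mono (s := (Nat.cast : ℕ → k) '' Set.Ici (m + 1)) ?_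
      ((Set.Ici_infinite _).image Nat.cast_injective.injOn)
    rintro _ ⟨n, hn, rfl⟩
    simpa using key n hn c
  -- The linear factor vanishes at r a₀ / 2, which need not be an integer.
  have := congrArg (Polynomial.eval ((r : k) * a₀ / 2)) hp
  simpa [mul_div_cancel₀] using this

end Coloring

/-! ### The Gram matrix -/

namespace Coloring

variable {k : Type*} [Field k]

/-- The position of the circle which `UCob.pull` moves to position `i`. -/
def pullIndex (m n : ℕ) (i : Fin (m + n + 1)) : Fin (m + 1 + n) :=
  if h : i.val < m then ⟨i, by omega⟩
  else if h' : i.val < m + n then ⟨i + 1, by omega⟩ else ⟨m, by omega⟩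

theorem evalHom_pull (r : kˣ) (n a b : ℕ) :
    evalHom r n (UCob.pull a b) = graph fun x i => x (pullIndex a b i) := by
  induction b with
  | zero =>
    rw [UCob.pull, evalHom_id, one_eq_graph]
    refine congrArg graph (funext fun x => funext fun i => congrArg x (Fin.ext ?_))
    simp only [pullIndex]
    split_ifs <;> simp only [] <;> omega
  | succ b ih =>
    have e : UCob.pull a (b + 1) = UCob.comp (UCob.addStrand (UCob.pull a b))
      (UCob.twistAt (a + b)) := rfl
    have h := evalHom_addStrand r n (UCob.pull a b) 1 _ (ih.trans (one_smul k _).symm)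
    rw [e, evalHom_comp, h, one_smul, evalHom_twistAt, graph_mul_graph]
    refine congrArg graph (funext fun x => funext fun i => ?_)
    refine Fin.lastCases ?_ (fun i => Fin.lastCases ?_ (fun i => ?_) i) i
    · rw [Fin.snoc_last, Fin.snoc_castSucc]
      refine congrArg x (Fin.ext ?_)
      simp only [pullIndex, Fin.val_last, Fin.val_castSucc]
      split_ifs <;> simp only [] <;> omega
    · rw [Fin.snoc_castSucc, Fin.snoc_last, Fin.snoc_last]
      refine congrArg x (Fin.ext ?_)
      simp only [pullIndex, Fin.val_last, Fin.val_castSucc]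
      split_ifs <;> simp only [] <;> omega
    · rw [Fin.snoc_castSucc, Fin.snoc_castSucc, Fin.snoc_castSucc]
      refine congrArg x (Fin.ext ?_)
      have := i.is_lt
      simp only [pullIndex, Fin.val_castSucc]
      split_ifs <;> omega

theorem evalHom_mul_counit (r : kˣ) (n : ℕ) (x : Fin 2 → Color n) (o : Fin 0 → Color n) :
    evalHom r n (UCob.comp UCob.mul UCob.counit) x o =
      (r : k)⁻¹ * if x 0 = x 1 then 1 else 0 := by
  rw [evalHom_comp, evalHom_mul, evalHom_counit, Matrix.mul_smul, Matrix.smul_apply,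
    cograph_mul_graph_apply, smul_eq_mul, Finset.sum_eq_single (x 1)]
  · have ho : o = forget (fun _ => x 1) := Subsingleton.elim _ _
    simp only [eq_dup_iff, and_true, ← ho]
  · intro z _ hz
    rw [if_neg]
    rintro ⟨h, -⟩
    exact hz ((eq_dup_iff x z).1 h).2.symm
  · simp

theorem evalHom_annuli (r : kˣ) (n m : ℕ) (x : Fin (m + m) → Color n) (o : Fin 0 → Color n) :
    evalHom r n (UCob.annuli m) x o = ((r : k)⁻¹) ^ m *
      if ∀ i : Fin m, x (Fin.castAdd m i) = x (Fin.natAdd m i) then 1 else 0 := by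
  induction m generalizing o with
  | zero =>
    rw [UCob.annuli, evalHom_id, if_pos fun i => i.elim0, pow_zero, one_mul,
      Subsingleton.elim (α := Fin 0 → Color n) x o, Matrix.one_apply_eq]
  | succ m ih =>
    have e : UCob.annuli (m + 1) = UCob.comp (UCob.addStrand (UCob.pull m m))
      (UCob.tensor (UCob.annuli m) (UCob.comp UCob.mul UCob.counit) :) := rfl
    have h := evalHom_addStrand r n (UCob.pull m m) 1 _
      ((evalHom_pull r n m m).trans (one_smul k _).symm)
    rw [e, evalHom_comp, h, one_smul, evalHom_tensor]
    refine (graph_mul_apply _ _ _ _).trans ?_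
    refine (congrArg₂ (· * ·) (ih _ _) (evalHom_mul_counit r n _ _)).trans ?_
    have h₀ : ∀ (y : Fin (m + m + 1) → Color n) (c : Color n),
        ((Fin.snoc (α := fun _ => Color n) y c : Fin (m + m + 2) → Color n) ∘
          (Fin.natAdd (m + m) : Fin 2 → Fin (m + m + 2))) 0 = y (Fin.last _) := fun y c =>
      Fin.snoc_castSucc (α := fun _ => Color n) c y (Fin.last _)
    have h₁ : ∀ (y : Fin (m + m + 1) → Color n) (c : Color n),
        ((Fin.snoc (α := fun _ => Color n) y c : Fin (m + m + 2) → Color n) ∘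
          (Fin.natAdd (m + m) : Fin 2 → Fin (m + m + 2))) 1 = c := fun y c =>
      Fin.snoc_last (α := fun _ => Color n) c y
    have h₂ : ∀ (y : Fin (m + m + 1) → Color n) (c : Color n) (i : Fin (m + m)),
        ((Fin.snoc (α := fun _ => Color n) y c : Fin (m + m + 2) → Color n) ∘
          Fin.castAdd 2) i = y i.castSucc := fun y c i =>
      Fin.snoc_castSucc (α := fun _ => Color n) c y i.castSucc
    rw [h₀, h₁]
    simp only [h₂]
    -- `UCob.pull` moves circle m of the first batch next to the last circle of the second batch.
    -- The other pairs keep their order and are joined by the smaller family of annuli.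
    have e₀ : (pullIndex m m (Fin.last _)).castSucc = Fin.castAdd (m + 1) (Fin.last m) := by
      ext; simp [pullIndex]
    have e₁ : ∀ i : Fin m, (pullIndex m m (Fin.castAdd m i).castSucc).castSucc =
        Fin.castAdd (m + 1) i.castSucc := fun i => by
      ext; simp [pullIndex]
    have e₂ : ∀ i : Fin m, (pullIndex m m (Fin.natAdd m i).castSucc).castSucc =
        Fin.natAdd (m + 1) i.castSucc := fun i => by
      ext; simp [pullIndex]; omega
    have e₃ : Fin.last (m + 1 + m) = Fin.natAdd (m + 1) (Fin.last m) := rfl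
    simp only [e₀, e₁, e₂, e₃, Fin.forall_fin_succ' (n := m), ite_and, pow_succ]
    split_ifs <;> simp

/-- The annuli pair colorings diagonally, so gluing becomes the standard scalar product of the
vectors of values, up to r⁻ᵐ. -/
theorem evalHom_glue (r : kˣ) (n : ℕ) {m : ℕ} (c d : UCob.Hom 0 m) (o : Fin 0 → Color n) :
    evalHom r n (UCob.glue c d) o o = ((r : k)⁻¹) ^ m *
      ∑ x, evalHom r n c o x * evalHom r n d o x := by
  have e : ∀ u v : Fin m → Color n,
      (∀ i, Fin.append u v (Fin.castAdd m i) = Fin.append u v (Fin.natAdd m i)) ↔ u = v :=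
    fun u v => by simp only [Fin.append_left, Fin.append_right, funext_iff]
  rw [UCob.glue, evalHom_comp, evalHom_tensor]
  refine (Matrix.mul_apply (M := kron (evalHom r n c) (evalHom r n d))).trans ?_
  rw [← (Fin.appendEquiv (α := Color n) m m).sum_comp, Fintype.sum_prod_type, Finset.mul_sum]
  refine Finset.sum_congr rfl fun u _ => ?_
  simp only [evalHom_annuli, Fin.appendEquiv, Equiv.coe_fn_mk, e, kron, Matrix.of_apply]
  rw [Finset.sum_eq_single u]
  · have h₁ : Fin.append u u ∘ Fin.castAdd m = u := funext fun i => Fin.append_left u u i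
    have h₂ : Fin.append u u ∘ Fin.natAdd m = u := funext fun i => Fin.append_right u u i
    rw [if_pos rfl, h₁, h₂, Subsingleton.elim (o ∘ Fin.castAdd 0) o,
      Subsingleton.elim (o ∘ Fin.natAdd 0) o]
    ring
  · intro v _ hv
    rw [if_neg (Ne.symm hv), mul_zero, mul_zero]
  · simp

theorem evalHom_one_eq_ratCast [CharZero k] (n : ℕ) {m : ℕ} (c : UCob.spanningSet m)
    (o : Fin 0 → Color n) (x : Fin m → Color n) :
    evalHom (1 : kˣ) n c.1 o x = ((evalHom (1 : ℚˣ) n c.1 o x : ℚ) : k) := by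
  classical
  obtain ⟨l, F, hF, h⟩ := exists_signedCob c
  rw [← h, evalHom_signedCob _ _ hF, evalHom_signedCob _ _ hF]
  split_ifs <;> simp

/-- At r = 1 all values are rational, and the Gram matrix is B Bᵀ. Over ℚ the sum of squares is
definite, so a kernel vector v satisfies Bᵀ v = 0 and is zero by independence of the values. The
passage through ℚ replaces positivity in `k`. -/
theorem det_gram_ne_zero [CharZero k] {m n : ℕ} (hn : m ≤ n)
    [DecidableEq (UCob.spanningSet m)] (o : Fin 0 → Color n) :
    (Matrix.of fun c d : UCob.spanningSet m =>
      evalHom (1 : kˣ) n (UCob.glue c.1 d.1) o o).det ≠ 0 := by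
  let B : Matrix (UCob.spanningSet m) (Fin m → Color n) ℚ :=
    Matrix.of fun c x => evalHom (1 : ℚˣ) n c.1 o x
  have hB : (B * B.transpose).det ≠ 0 := by
    rw [Ne, ← Matrix.exists_mulVec_eq_zero_iff]
    rintro ⟨v, hv, h⟩
    have h₁ : B.transpose.mulVec v = 0 := by
      rw [← dotProduct_self_eq_zero, Matrix.dotProduct_mulVec, ← Matrix.mulVec_transpose,
        Matrix.transpose_transpose, Matrix.mulVec_mulVec, h, zero_dotProduct]
    refine hv (eq_zero_of_sum_evalHom_eq_zero (1 : ℚˣ) hn v ?_)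
    ext o' x
    have h₂ := congrFun h₁ x
    rw [Matrix.sum_apply, Subsingleton.elim o' o]
    simpa [Matrix.mulVec, dotProduct, B, mul_comm] using h₂
  have e : (Matrix.of fun c d : UCob.spanningSet m =>
      evalHom (1 : kˣ) n (UCob.glue c.1 d.1) o o) =
        (algebraMap ℚ k).mapMatrix (B * B.transpose) := by
    ext c d
    rw [Matrix.of_apply, evalHom_glue, RingHom.mapMatrix_apply, Matrix.map_apply,
      Matrix.mul_apply, map_sum, Units.val_one, inv_one, one_pow, one_mul]
    refine Finset.sum_congr rfl fun x _ => ?_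
    rw [evalHom_one_eq_ratCast (k := k) n c, evalHom_one_eq_ratCast (k := k) n d, map_mul,
      eq_ratCast, eq_ratCast]
    rfl
  rw [e, ← RingHom.map_det]
  exact (map_ne_zero _).2 hB

end Coloring

/-! ### The number of elements of the spanning set -/

/-- Appending a value to a surjection, or to a surjection onto the complement of that value. -/
def snocSurjection {m l : ℕ} (x : Σ _ : Fin (l + 1),
    {g : Fin m → Fin (l + 1) // Function.Surjective g} ⊕
      {g : Fin m → Fin l // Function.Surjective g}) :
    {f : Fin (m + 1) → Fin (l + 1) // Function.Surjective f} :=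
  match x with
  | ⟨a, .inl g⟩ => ⟨Fin.snoc (α := fun _ => Fin (l + 1)) g.1 a, fun b => by
      obtain ⟨i, hi⟩ := g.2 b
      exact ⟨i.castSucc, by simpa using hi⟩⟩
  | ⟨a, .inr g⟩ => ⟨Fin.snoc (α := fun _ => Fin (l + 1)) (a.succAbove ∘ g.1) a, fun b => by
      by_cases hb : b = a
      · exact ⟨Fin.last m, by simp [hb]⟩
      · obtain ⟨c, rfl⟩ := Fin.exists_succAbove_eq hb
        obtain ⟨i, rfl⟩ := g.2 c
        exact ⟨i.castSucc, by simp⟩⟩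

theorem snocSurjection_bijective (m l : ℕ) :
    Function.Bijective (snocSurjection (m := m) (l := l)) := by
  constructor
  · rintro ⟨a, g | g⟩ ⟨b, h | h⟩ e
    all_goals
      have e' := congrArg Subtype.val e
      simp only [snocSurjection] at e'
      obtain rfl : a = b := by simpa using congrFun e' (Fin.last m)
      have e'' : ∀ i : Fin m, _ := fun i => congrFun e' i.castSucc
      simp only [Fin.snoc_castSucc, Function.comp] at e''
    · rw [Subtype.ext (funext e'')]
    · obtain ⟨i, hi⟩ := g.2 a
      exact absurd ((e'' i).symm.trans hi) (Fin.succAbove_ne _ _)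
    · obtain ⟨i, hi⟩ := h.2 a
      exact absurd ((e'' i).trans hi) (Fin.succAbove_ne _ _)
    · rw [Subtype.ext (funext fun i => Fin.succAbove_right_injective (e'' i))]
  · rintro ⟨f, hf⟩
    by_cases h : ∃ i : Fin m, f i.castSucc = f (Fin.last m)
    · refine ⟨⟨f (Fin.last m), .inl ⟨fun i => f i.castSucc, fun b => ?_⟩⟩,
        Subtype.ext (Fin.snoc_init_self f)⟩
      obtain ⟨i, hi⟩ := hf b
      revert hi
      refine Fin.lastCases (fun hi => ?_) (fun i hi => ?_) i
      · obtain ⟨j, hj⟩ := h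
        exact ⟨j, hj.trans hi⟩
      · exact ⟨i, hi⟩
    · push Not at h
      choose g hg using fun i => Fin.exists_succAbove_eq (h i)
      refine ⟨⟨f (Fin.last m), .inr ⟨g, fun b => ?_⟩⟩, Subtype.ext ?_⟩
      · obtain ⟨i, hi⟩ := hf ((f (Fin.last m)).succAbove b)
        revert hi
        refine Fin.lastCases (fun hi => ?_) (fun i hi => ?_) i
        · exact absurd hi.symm (Fin.succAbove_ne _ _)
        · exact ⟨i, Fin.succAbove_right_injective ((hg i).trans hi)⟩
      · have : (f (Fin.last m)).succAbove ∘ g = Fin.init (α := fun _ => Fin (l + 1)) f :=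
          funext hg
        simp only [snocSurjection, this]
        exact Fin.snoc_init_self f

/-- Restricting a surjection to all but the last point, the value there is either still attained or
omitted. This gives (l + 1) times the sum of two smaller counts, which matches the recursion of the
Stirling numbers. -/
theorem card_surjections (m l : ℕ) :
    Nat.card {f : Fin m → Fin l // Function.Surjective f} =
      l.factorial * Nat.stirlingSecond m l := by
  induction m generalizing l with
  | zero =>
    cases l with
    | zero =>
      have : Unique {f : Fin 0 → Fin 0 // Function.Surjective f} :=
        { default := ⟨Fin.elim0, fun i => i.elim0⟩
          uniq := fun f => Subsingleton.elim _ _ }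
      simp
    | succ l =>
      have : IsEmpty {f : Fin 0 → Fin (l + 1) // Function.Surjective f} :=
        ⟨fun f => (f.2 0).choose.elim0⟩
      simp
  | succ m ih =>
    cases l with
    | zero =>
      have : IsEmpty {f : Fin (m + 1) → Fin 0 // Function.Surjective f} :=
        ⟨fun f => (f.1 0).elim0⟩
      simp
    | succ l =>
      rw [← Nat.card_eq_of_bijective _ (snocSurjection_bijective m l), Nat.card_sigma]
      simp only [Nat.card_sum, ih, Finset.sum_const, Finset.card_univ, Fintype.card_fin,
        smul_eq_mul, Nat.stirlingSecond_succ_succ, Nat.factorial_succ]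
      ring

/-! ### Counting cobordisms as orbits of signed surjections. -/

namespace UCob

/-- Signed surjections: the data describing elements of the spanning set. -/
abbrev SignedSurjection (m l : ℕ) : Type :=
  {F : Fin m → Fin l × Bool // Function.Surjective fun i => (F i).1}

theorem card_signedSurjection (m l : ℕ) :
    Nat.card (SignedSurjection m l) = l.factorial * Nat.stirlingSecond m l * 2 ^ m := by
  let e : SignedSurjection m l ≃
      {f : Fin m → Fin l // Function.Surjective f} × (Fin m → Bool) :=
    { toFun := fun F => (⟨fun i => (F.1 i).1, F.2⟩, fun i => (F.1 i).2)
      invFun := fun x => ⟨fun i => (x.1.1 i, x.2 i), x.1.2⟩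
      left_inv := fun _ => rfl
      right_inv := fun _ => rfl }
  rw [Nat.card_congr e, Nat.card_prod, card_surjections]
  simp

/-- The elements of the spanning set with `l` components. -/
def spanningSetOf (m l : ℕ) : Set (Hom 0 m) :=
  Set.range fun F : SignedSurjection m l => signedCob F.1

/-- The converse of `signedCob_symm`: equal cobordisms have equal values on the test coloring of F,
so this coloring is compatible with F', and its extension provides π and the signs. As l and l' may
differ, this also separates cobordisms with different numbers of components. -/
theorem exists_of_signedCob_eq {m l l' : ℕ} (F : SignedSurjection m l) (F' : SignedSurjection m l')
    (h : signedCob F.1 = signedCob F'.1) : ∃ (π : Fin l' → Fin l) (s : Fin l' → Bool),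
      Function.Surjective π ∧ ∀ i, F.1 i = (π (F'.1 i).1, xor (s (F'.1 i).1) (F'.1 i).2) := by
  classical
  have hc : Coloring.Compatible F'.1 (Coloring.testColoring l le_rfl F.1) := by
    by_contra hc
    have h₁ := Coloring.evalHom_signedCob (1 : ℚˣ) l F.2 Fin.elim0
      (Coloring.testColoring l le_rfl F.1)
    rw [h, Coloring.evalHom_signedCob _ _ F'.2, if_neg hc,
      if_pos (Coloring.compatible_testColoring _ _)] at h₁
    simp at h₁
  obtain ⟨z, hz⟩ := hc
  have hF : ∀ i, F.1 i = ((z (F'.1 i).1).1, xor (z (F'.1 i).1).2 (F'.1 i).2) := fun i => by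
    have h₁ := congrArg Prod.fst (hz i)
    have h₂ := congrArg Prod.snd (hz i)
    simp only [Coloring.testColoring, Coloring.act, Fin.castLE_rfl, id_eq, Bool.xor_false] at h₁ h₂
    exact Prod.ext h₁ (h₂.trans (Bool.xor_comm _ _))
  refine ⟨fun j => (z j).1, fun j => (z j).2, fun j => ?_, hF⟩
  obtain ⟨i, rfl⟩ := F.2 j
  exact ⟨(F'.1 i).1, (congrArg Prod.fst (hF i)).symm⟩

/-- The action of the signed permutations on signed surjections. -/
def actSigned {m l : ℕ} (x : Equiv.Perm (Fin l) × (Fin l → Bool)) (F : SignedSurjection m l) :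
    SignedSurjection m l :=
  ⟨fun i => (x.1 (F.1 i).1, xor (x.2 (F.1 i).1) (F.1 i).2), x.1.surjective.comp F.2⟩

/-- The fibers of `signedCob` are the orbits of the signed permutations. The action is free because
every component meets an outgoing circle, so each orbit has l! 2^l elements. -/
theorem card_spanningSetOf_mul (m l : ℕ) :
    Nat.card (spanningSetOf m l) * (l.factorial * 2 ^ l) = Nat.card (SignedSurjection m l) := by
  choose F hF using fun c : spanningSetOf m l => c.2
  have hb : Function.Bijective fun x : spanningSetOf m l ×
      (Equiv.Perm (Fin l) × (Fin l → Bool)) => actSigned x.2 (F x.1) := by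
    constructor
    · rintro ⟨c, σ, s⟩ ⟨d, τ, t⟩ h
      have hcd : c = d := by
        have h₁ := congrArg (fun G => signedCob G.1) h
        simp only [actSigned] at h₁
        rw [signedCob_symm, signedCob_symm] at h₁
        exact Subtype.ext ((hF c).symm.trans (h₁.trans (hF d)))
      subst hcd
      have h₁ : ∀ i, _ := fun i => congrFun (congrArg Subtype.val h) i
      simp only [actSigned, Prod.mk.injEq] at h₁
      have hσ : σ = τ := Equiv.ext fun j => by
        obtain ⟨i, rfl⟩ := (F c).2 j
        exact (h₁ i).1
      have hs : s = t := funext fun j => by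
        obtain ⟨i, rfl⟩ := (F c).2 j
        exact Bool.xor_left_inj.1 (h₁ i).2
      rw [hσ, hs]
    · intro G
      let c : spanningSetOf m l := ⟨signedCob G.1, G, rfl⟩
      obtain ⟨π, s, hπ, h⟩ := exists_of_signedCob_eq G (F c) (hF c).symm
      refine ⟨(c, Equiv.ofBijective π ⟨Finite.injective_iff_surjective.2 hπ, hπ⟩, s),
        Subtype.ext (funext fun i => ?_)⟩
      exact (h i).symm
  rw [← Nat.card_eq_of_bijective _ hb, Nat.card_prod, Nat.card_prod]
  simp [Fintype.card_perm]

theorem card_spanningSetOf {m l : ℕ} (hl : l ≤ m) :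
    Nat.card (spanningSetOf m l) = 2 ^ (m - l) * Nat.stirlingSecond m l := by
  have h := card_spanningSetOf_mul m l
  rw [card_signedSurjection] at h
  have hpos : 0 < l.factorial * 2 ^ l := by positivity
  refine Nat.eq_of_mul_eq_mul_right hpos (h.trans ?_)
  rw [← Nat.sub_add_cancel hl, pow_add, Nat.add_sub_cancel]
  ring

theorem card_spanningSet {m : ℕ} (hm : 1 ≤ m) : Fintype.card (spanningSet m) =
    ∑ j ∈ Finset.Icc 1 m, 2 ^ (m - j) * Nat.stirlingSecond m j := by
  classical
  have hfin : ∀ l, (spanningSetOf m l).Finite := fun l => Set.finite_range _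
  have h : (spanningSet m).toFinset =
      (Finset.Icc 1 m).biUnion fun l => (hfin l).toFinset := by
    ext c
    simp only [Set.mem_toFinset, mem_spanningSet, Finset.mem_biUnion, Finset.mem_Icc,
      Set.Finite.mem_toFinset, spanningSetOf, Set.mem_range, Subtype.exists, exists_prop]
    constructor
    · rintro ⟨l, F, hF, rfl⟩
      refine ⟨l, ⟨?_, by simpa using Fintype.card_le_of_surjective _ hF⟩, F, hF, rfl⟩
      -- With at least one circle there is at least one component, so the sum starts at 1.
      exact (Nat.zero_le _).trans_lt (F ⟨0, hm⟩).1.is_lt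
    · rintro ⟨l, -, F, hF, rfl⟩
      exact ⟨l, F, hF, rfl⟩
  rw [← Set.toFinset_card, h, Finset.card_biUnion]
  · refine Finset.sum_congr rfl fun l hl => ?_
    rw [← card_spanningSetOf (Finset.mem_Icc.1 hl).2, Nat.card_coe_set_eq,
      Set.ncard_eq_toFinset_card _ (hfin l)]
  · intro l _ l' _ hne
    rw [Function.onFun, Finset.disjoint_left]
    intro c hc hc'
    rw [Set.Finite.mem_toFinset] at hc hc'
    obtain ⟨F, rfl⟩ := hc
    obtain ⟨F', hF'⟩ := hc'
    obtain ⟨π, -, hπ, -⟩ := exists_of_signedCob_eq F F' hF'.symm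
    obtain ⟨π', -, hπ', -⟩ := exists_of_signedCob_eq F' F hF'
    refine hne (le_antisymm ?_ ?_)
    · simpa using Fintype.card_le_of_surjective π hπ
    · simpa using Fintype.card_le_of_surjective π' hπ'

end UCob

/-! ### The dimension formula and the Gram determinant -/

namespace UCobLin

variable {k : Type*} [Field k]

theorem MemIdeal.mono {R R' : ∀ a b : ℕ, Set (UCobLin k a b)} (h : ∀ a b, R a b ⊆ R' a b)
    {a b : ℕ} {f : UCobLin k a b} (hf : MemIdeal R f) : MemIdeal R' f := by
  induction hf with
  | of_mem hf => exact .of_mem (h _ _ hf)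
  | zero => exact .zero
  | add _ _ hf hg => exact .add hf hg
  | smul r _ hf => exact .smul r hf
  | comp_right g _ hf => exact .comp_right g hf
  | comp_left g _ hf => exact .comp_left g hf
  | tensor_right g _ hf => exact .tensor_right g hf
  | tensor_left g _ hf => exact .tensor_left g hf

theorem closedRel_subset_orientableRel (α : ℕ → k) (a b : ℕ) :
    ClosedRel α 0 0 a b ⊆ OrientableRel α a b :=
  fun _ h => .skein (.closed h)

end UCobLin

namespace UCobQuot

variable {k : Type*} [Field k]

theorem span_spanningSet {l a₀ : k} (hl : l ≠ 0) (ha₀ : a₀ ≠ 0) (m : ℕ) :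
    Submodule.span k (Set.range fun c : UCob.spanningSet m =>
      cob (OrientableRel (geomSeq l a₀)) c.1) = ⊤ := by
  refine eq_top_iff.2 fun x _ => ?_
  obtain ⟨f, rfl⟩ := toQuot_surjective x
  induction f using Finsupp.induction_linear with
  | zero => rw [map_zero]; exact Submodule.zero_mem _
  | add f g hf hg => rw [map_add]; exact Submodule.add_mem _ (hf trivial) (hg trivial)
  | single s r =>
    obtain ⟨P, c, hc, h⟩ := exists_eqSMul_spanningSet (k := k) s
    have e : (toQuot (OrientableRel (geomSeq l a₀)) (Finsupp.single s r)) =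
        r • cob (OrientableRel (geomSeq l a₀)) s := by
      rw [← mul_one r, ← smul_eq_mul, ← Finsupp.smul_single, map_smul, smul_eq_mul, mul_one]
      rfl
    rw [e, (h l a₀ hl ha₀).toQuot_eq]
    exact Submodule.smul_mem _ _ (Submodule.smul_mem _ _
      (Submodule.subset_span ⟨⟨c, hc⟩, rfl⟩))

variable [CharZero k]

theorem linearIndependent_spanningSet {l a₀ : k} (hl : l ≠ 0) (ha₀ : a₀ ≠ 0) (m : ℕ) :
    LinearIndependent k fun c : UCob.spanningSet m =>
      cob (OrientableRel (geomSeq l a₀)) c.1 := by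
  refine Fintype.linearIndependent_iff.2 fun s hs => ?_
  refine congrFun (Coloring.eq_zero_of_memIdeal (Units.mk0 l hl) ha₀ s ?_)
  refine (Submodule.Quotient.mk_eq_zero
    (UCobLin.ideal (OrientableRel (geomSeq l a₀)) 0 m)).1 ?_
  refine Eq.trans ?_ hs
  exact (map_sum (toQuot _) _ _).trans
    (Finset.sum_congr rfl fun c _ => map_smul (toQuot _) _ _)

theorem finrank_hom {l a₀ : k} (hl : l ≠ 0) (ha₀ : a₀ ≠ 0) {m : ℕ} (hm : 1 ≤ m) :
    Module.finrank k ((⟨0⟩ : SOCob (geomSeq l a₀)) ⟶ ⟨m⟩) =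
      ∑ j ∈ Finset.Icc 1 m, 2 ^ (m - j) * Nat.stirlingSecond m j := by
  rw [← UCob.card_spanningSet hm]
  exact Module.finrank_eq_card_basis (Module.Basis.mk (linearIndependent_spanningSet hl ha₀ m)
    (span_spanningSet hl ha₀ m).ge)

/-- This makes the inner products well-defined scalars. It is inherited from `SOCob`, where the
empty cobordism is a member of an independent family. -/
theorem id_zero_ne_zero {l a₀ : k} (hl : l ≠ 0) (ha₀ : a₀ ≠ 0) :
    𝟙 (⟨0⟩ : VUCob (geomSeq l a₀) 0 0) ≠ 0 := by
  intro h
  have h₁ := ((Submodule.Quotient.mk_eq_zero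
    (UCobLin.ideal (ClosedRel (geomSeq l a₀) 0 0) 0 0)).1 h :
      UCobLin.MemIdeal _ _).mono (UCobLin.closedRel_subset_orientableRel _)
  have h₂ : UCob.id 0 ∈ UCob.spanningSet 0 :=
    ⟨0, Fin.elim0, ∅, fun i => i.elim0, by
      simp only [UCob.compCob, UCob.units, UCob.spread, UCob.counits, UCob.flips, UCob.id_comp]⟩
  refine (linearIndependent_spanningSet hl ha₀ 0).ne_zero ⟨_, h₂⟩ ?_
  exact (Submodule.Quotient.mk_eq_zero _).2 h₁

/-- The Gram determinant, as a polynomial in the two parameters. -/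
theorem exists_gram_polynomial (m : ℕ) [DecidableEq (UCob.spanningSet m)] :
    ∃ P : Matrix (UCob.spanningSet m) (UCob.spanningSet m) (MvPolynomial (Fin 2) k),
      P.det ≠ 0 ∧ ∀ l a₀ : k, l ≠ 0 → a₀ ≠ 0 → ∀ G,
        IsGramMatrix (geomSeq l a₀) 0 0 m G ↔ G = (MvPolynomial.eval ![l, a₀]).mapMatrix P := by
  choose P hP using fun c d : UCob.spanningSet m =>
    exists_eqSMul_id (k := k) (UCob.glue c.1 d.1)
  refine ⟨Matrix.of P, fun h => ?_, fun l a₀ hl ha₀ G => ?_⟩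
  -- Specialization at λ = 1, α₀ = 2n turns the matrix into the Gram matrix of the field theory; n =
  -- m + 1 is both non-zero and at least m.
  · let n := m + 1
    refine Coloring.det_gram_ne_zero (k := k) (m := m) (n := n) (Nat.le_succ m) Fin.elim0 ?_
    have e : (Matrix.of fun c d : UCob.spanningSet m =>
        Coloring.evalHom (1 : kˣ) n (UCob.glue c.1 d.1) Fin.elim0 Fin.elim0) =
        (MvPolynomial.eval ![1, ((1 : kˣ) : k)⁻¹ * (2 * n)]).mapMatrix (Matrix.of P) := by
      ext c d
      have h₁ : UCobLin.EqSMul (OrientableRel (geomSeq ((1 : kˣ) : k)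
          (((1 : kˣ) : k)⁻¹ * (2 * n)))) (UCob.glue c.1 d.1) _ (UCob.id 0) :=
        UCobLin.MemIdeal.mono (UCobLin.closedRel_subset_orientableRel _) (hP c d _ _)
      rw [Matrix.of_apply, Coloring.evalHom_eq_smul_of_eqSMul (Nat.succ_ne_zero m) h₁,
        Coloring.evalHom_id, Matrix.smul_apply, Matrix.one_apply_eq, smul_eq_mul, mul_one]
      rfl
    rw [e, ← RingHom.map_det, h, map_zero]
  · have hG : IsGramMatrix (geomSeq l a₀) 0 0 m
        ((MvPolynomial.eval ![l, a₀]).mapMatrix (Matrix.of P)) :=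
      fun c d => (hP c d l a₀).toQuot_eq
    refine ⟨fun h => ?_, fun h => h ▸ hG⟩
    ext c d
    exact smul_left_injective k (id_zero_ne_zero hl ha₀) ((h c d).symm.trans (hG c d))

end UCobQuot

open Classical in
theorem mainTheorem6 (k : Type*) [Field k] [IsAlgClosed k] [CharZero k] :
    {x : kˣ × kˣ | ¬ ∀ m : ℕ, 1 ≤ m →
      Module.finrank k ((⟨0⟩ : SOCob (geomSeq (x.1 : k) (x.2 : k))) ⟶ ⟨m⟩) =
        ∑ j ∈ Finset.Icc 1 m, 2 ^ (m - j) * Nat.stirlingSecond m j}.Countable ∧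
    ∀ m : ℕ, 1 ≤ m → ∃ p : MvPolynomial (Fin 2) k, p ≠ 0 ∧
      ∀ l a₀ : k, l ≠ 0 → a₀ ≠ 0 →
        Submodule.span k (Set.range fun c : UCob.spanningSet m =>
          UCobQuot.cob (OrientableRel (geomSeq l a₀)) c.1) = ⊤ ∧
        (∃ G : Matrix (UCob.spanningSet m) (UCob.spanningSet m) k,
          (∀ G', IsGramMatrix (geomSeq l a₀) 0 0 m G' ↔ G' = G) ∧
          G.det = MvPolynomial.eval ![l, a₀] p) ∧
        (MvPolynomial.eval ![l, a₀] p ≠ 0 →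
          Module.finrank k ((⟨0⟩ : SOCob (geomSeq l a₀)) ⟶ ⟨m⟩) =
            ∑ j ∈ Finset.Icc 1 m, 2 ^ (m - j) * Nat.stirlingSecond m j) := by
  refine ⟨?_, fun m hm => ?_⟩
  -- By interpolation in the number of colors no pair of parameters is exceptional.
  · convert Set.countable_empty
    refine Set.eq_empty_of_forall_notMem fun x hx => hx fun m hm => ?_
    exact UCobQuot.finrank_hom x.1.ne_zero x.2.ne_zero hm
  · obtain ⟨P, hP, h⟩ := UCobQuot.exists_gram_polynomial (k := k) m
    refine ⟨P.det, hP, fun l a₀ hl ha₀ => ⟨UCobQuot.span_spanningSet hl ha₀ m, ?_,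
      fun _ => UCobQuot.finrank_hom hl ha₀ hm⟩⟩
    exact ⟨_, h l a₀ hl ha₀, (RingHom.map_det _ _).symm⟩
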